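/- **Boltzmann–Gibbs principle for the symmetric facilitated exclusion process.** Let $\Sigma=\{0,1\}^{\mathbb Z}$. For $N\in\mathbb N$ let $\mathscr L_N$ be the generator of the symmetric facilitated exclusion process (FEP) on $\Sigma$, accelerated by $N^2$: for local $f:\Sigma\to\mathbb R$ (i.e. $f$ depends on finitely many coordinates), $$\mathscr L_N f(\eta)=N^2\sum_{x\in\mathbb Z}\big(\eta_{x-1}\eta_x(1-\eta_{x+1})+(1-\eta_x)\eta_{x+1}\eta_{x+2}\big)\big(f(\eta^{x,x+1})-f(\eta)\big),$$ where $\eta^{x,x+1}$ is $\eta$ with the values at $x$ and $x+1$ exchanged. For $\rho\in(1/2,1)$ let $\pi_\rho$ be the translation invariant probability measure on $\Sigma$ such that, for all $\ell\ge 1$ and $\sigma\in\{0,1\}^{\{1,\dots,\ell\}}$ with $p=\sum_{x=1}^{\ell}\sigma_x$, $$\pi_\rho\big(\eta_{|\{1,\dots,\ell\}}=\sigma\big)=\mathbf 1_{\{\sigma_x+\sigma_{x+1}\ge 1\ \text{for } 1\le x<\ell\}}\,(1-\rho)\Big(\frac{1-\rho}{\rho}\Big)^{\ell-1-p}\Big(\frac{2\rho-1}{\rho}\Big)^{2p-\ell+1-\sigma_1-\sigma_\ell};$$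 equivalently, $\pi_\rho$ is the law of the two-sided stationary Markov chain on $\{0,1\}$ with density $\rho$ and transition probabilities $p(0,1)=1$, $p(1,1)=(2\rho-1)/\rho$. Fix $\rho\in(1/2,1)$, and let $\eta(\cdot)=(\eta(s))_{s\ge 0}$ be the (càdlàg) Markov process with generator $\mathscr L_N$ and initial law $\pi_\rho$; write $\mathbb E^N_\rho$ for the corresponding expectation. Let $\psi:\Sigma\to\mathbb R$ be a local function and $\widetilde\psi(r)=E_{\pi_r}[\psi]$ for $r\in(1/2,1)$. Then $\widetilde\psi$ is differentiable at $\rho$, and with $$V_\psi(\eta)=\psi(\eta)-\widetilde\psi(\rho)-\widetilde\psi'(\rho)(\eta_0-\rho),\qquad \tau_xV_\psi(\eta)=V_\psi(\eta_{\cdot-x}),$$ for every smooth compactly supported $G:\mathbb R\to\mathbb R$ and every $t>0$, the random variables $\int_0^t N^{-1/2}\sum_{x\in\mathbb Z}G(x/N)\,\tau_xV_\psi(\eta(s))\,ds$ are square integrable and $$\lim_{N\to\infty}\mathbb E^N_\rho\Big[\Big(\int_0^t \frac1{\sqrt N}\sum_{x\in\mathbb Z}G(x/N)\,\tau_xV_\psi(\eta(s))\,ds\Big)^2\Big]=0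 .$$ -/

import Mathlib

open MeasureTheory ProbabilityTheory Filter Topology
open scoped NNReal ENNReal

namespace FEP

/-- Configurations of particles on `ℤ`: `η x = true` iff the site `x` is occupied. -/
abbrev Config : Type := ℤ → Bool

/-- The occupation variable `η_x ∈ {0, 1}`, as a real number. -/
def occ (η : Config) (x : ℤ) : ℝ := if η x then 1 else 0

/-- A local function depends on finitely many sites only. -/
def IsLocal (f : Config → ℝ) : Prop := ∃ A : Finset ℤ, DependsOn f (A : Set ℤ)

/-- The configuration obtained from `η` by exchanging the values at `x` and `y`. -/
def swap (η : Config) (x y : ℤ) : Config := fun z => η (Equiv.swap x y z)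

/-- Rate of the jump `x → x + 1`: the particle at `x` needs a neighbour at `x - 1` and an empty
target. -/
def rateRight (η : Config) (x : ℤ) : ℝ := occ η (x - 1) * occ η x * (1 - occ η (x + 1))

/-- Rate of the jump `x + 1 → x`: the particle at `x + 1` needs a neighbour at `x + 2` and an empty
target. -/
def rateLeft (η : Config) (x : ℤ) : ℝ := (1 - occ η x) * occ η (x + 1) * occ η (x + 2)

/-- The generator of the facilitated exclusion process with jump intensities `p` to the right and
`q` to the left, acting on local functions (for which the sum has finitely many nonzero terms). -/
noncomputable def generator (p q : ℝ) (f : Config → ℝ) (η : Config) : ℝ :=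
  ∑' x : ℤ, (p * rateRight η x + q * rateLeft η x) * (f (swap η x (x + 1)) - f η)

/-- `η` is, under `P`, a facilitated exclusion process with jump intensities `p` and `q` and initial
law `μ₀`: a càdlàg process solving the martingale problem of `generator p q` on local functions, with
respect to its natural filtration. (This martingale problem is well posed: the rates are bounded
and of finite range.) -/
structure IsProcess {Ω : Type*} [MeasurableSpace Ω] (P : Measure Ω) (p q : ℝ)
    (μ₀ : Measure Config) (η : ℝ≥0 → Ω → Config) : Prop where
  measurable : ∀ t, Measurable (η t)
  right_continuous : ∀ ω t, ContinuousWithinAt (fun s => η s ω) (Set.Ici t) t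
  left_limits : ∀ ω t, ∃ ζ, Tendsto (fun s => η s ω) (𝓝[<] t) (𝓝 ζ)
  initial : P.map (η 0) = μ₀
  martingale : ∀ f : Config → ℝ, IsLocal f →
    Martingale
      (fun t ω => f (η t ω) - f (η 0 ω)
        - ∫ s in (0 : ℝ)..t, generator p q f (η s.toNNReal ω))
      (Filtration.natural η fun t => (measurable t).stronglyMeasurable) P

/-- The density of active particles, `(2ρ - 1) / ρ`. -/
noncomputable def activity (ρ : ℝ) : ℝ := (2 * ρ - 1) / ρ

/-- Bernoulli law on `Bool` with success probability `p` (truncated to `[0, 1]`). -/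
noncomputable def ber (p : ℝ) : Measure Bool :=
  bernoulliMeasure true false (Set.projIcc (0 : ℝ) 1 zero_le_one p)

/-- The trajectory of the chain on `Bool` driven by the noise `u` and started from `u 0`: an empty
site is followed by a particle, and a particle at `k` is followed by the value `u (k + 1)`. -/
def chain (u : ℕ → Bool) : ℕ → Bool
  | 0 => u 0
  | k + 1 => !(chain u k) || u (k + 1)

/-- The configuration whose value at `0` is `ξ 0` and which is built by `chain` in both
directions from the origin. -/
def build (ξ : ℤ → Bool) : Config
  | Int.ofNat k => chain (fun j => ξ j) k
  | Int.negSucc k => chain (fun j => ξ (-j)) (k + 1)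

/-- The law of the noise: independent, Bernoulli `ρ` at the origin and Bernoulli
`(2ρ - 1) / ρ` elsewhere. -/
noncomputable def noise (ρ : ℝ) : (x : ℤ) → Measure Bool :=
  fun x => if x = 0 then ber ρ else ber (activity ρ)

instance (ρ : ℝ) (x : ℤ) : IsProbabilityMeasure (noise ρ x) := by
  unfold noise ber; split_ifs <;> infer_instance

/-- The stationary measure `π_ρ`, for `1/2 < ρ < 1`: the law of the two-sided stationary Markov
chain on `{0, 1}` with density `ρ` and transition probabilities `p(0,1) = 1`,
`p(1,1) = (2ρ - 1) / ρ`. Its finite-dimensional distributions are given by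
`stationaryMeasure_cylinder` below. -/
noncomputable def stationaryMeasure (ρ : ℝ) : Measure Config :=
  (Measure.infinitePi (noise ρ)).map build

theorem measurable_build : Measurable build := by
  have hc : ∀ (k : ℕ) (e : ℕ → ℤ), Measurable fun ξ : ℤ → Bool => chain (fun j => ξ (e j)) k := by
    intro k e
    induction k with
    | zero => exact measurable_pi_apply _
    | succ k ih =>
      have h2 : Measurable fun ξ : ℤ → Bool => ξ (e (k + 1)) := measurable_pi_apply _
      have h3 : Measurable fun b : Bool × Bool => (!b.1 || b.2) := measurable_of_countable _
      exact h3.comp (ih.prodMk h2)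
  rw [measurable_pi_iff]
  rintro (k | k)
  · exact hc k _
  · exact hc (k + 1) _

instance (ρ : ℝ) : IsProbabilityMeasure (stationaryMeasure ρ) :=
  Measure.isProbabilityMeasure_map measurable_build.aemeasurable

section Cylinder

/-- The one-site marginal. -/
def wt (ρ : ℝ) (s : Bool) : ℝ := if s then ρ else 1 - ρ

/-- The transition probabilities. -/
noncomputable def tr (ρ : ℝ) (s s' : Bool) : ℝ :=
  if s then (if s' then activity ρ else 1 - activity ρ) else (if s' then 1 else 0)

/-- Values of the noise at a site compatible with the step from `s` to `s'`. -/
def stepSet (s s' : Bool) : Set Bool :=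
  {b | s' = (!s || b)}

theorem chain_eq_iff (u s : ℕ → Bool) (n : ℕ) :
    (∀ k ≤ n, chain u k = s k) ↔ u 0 = s 0 ∧ ∀ k < n, u (k + 1) ∈ stepSet (s k) (s (k + 1)) := by
  induction n with
  | zero => simp [chain]
  | succ n ih =>
    constructor
    · intro h
      have h1 := ih.1 fun k hk => h k (by omega)
      refine ⟨h1.1, fun k hk => ?_⟩
      have ha := h (k + 1) (by omega)
      have hb := h k (by omega)
      simp only [chain, hb] at ha
      exact ha.symm
    · rintro ⟨h0, h⟩ k hk
      have h1 := ih.2 ⟨h0, fun k hk => h k (by omega)⟩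
      rcases Nat.lt_or_ge k (n + 1) with h2 | h2
      · exact h1 k (by omega)
      · obtain rfl : k = n + 1 := by omega
        have := h n (by omega)
        simp only [chain, h1 n le_rfl]
        exact this.symm

variable {ρ : ℝ}

theorem activity_mem (hρ : 1 / 2 < ρ) (hρ' : ρ < 1) : 0 < activity ρ ∧ activity ρ < 1 := by
  unfold activity
  constructor
  · apply div_pos <;> linarith
  · rw [div_lt_one (by linarith)]; linarith

open Classical in
theorem ber_real {p : ℝ} (h0 : 0 ≤ p) (h1 : p ≤ 1) (S : Set Bool) :
    (ber p).real S = (if true ∈ S then p else 0) + (if false ∈ S then 1 - p else 0) := by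
  have hp : ((Set.projIcc (0 : ℝ) 1 zero_le_one p : Set.Icc (0 : ℝ) 1) : ℝ) = p := by
    rw [Set.projIcc_of_mem zero_le_one ⟨h0, h1⟩]
  unfold ber
  rw [bernoulliMeasure_real_apply _ (Set.toFinite S).measurableSet]
  split_ifs <;> (try simp only [unitInterval.coe_toNNReal, unitInterval.coe_symm_eq, hp]) <;> ring

theorem ber_step (hρ : 1 / 2 < ρ) (hρ' : ρ < 1) (s s' : Bool) :
    (ber (activity ρ)).real (stepSet s s') = tr ρ s s' := by
  have := activity_mem hρ hρ'
  rw [ber_real this.1.le this.2.le]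
  cases s <;> cases s' <;> simp [stepSet, tr]

/-- The event of seeing `σ` on the box `{x, …, x + n}`. -/
def cyl (σ : Config) (x : ℤ) (n : ℕ) : Set Config := {η | ∀ k ≤ n, η (x + k) = σ (x + k)}

theorem measurableSet_cyl (σ : Config) (x : ℤ) (n : ℕ) : MeasurableSet (cyl σ x n) := by
  have : cyl σ x n = ⋂ k : ℕ, ⋂ _ : k ≤ n, (fun η : Config => η (x + k)) ⁻¹' {σ (x + k)} := by
    ext η; simp [cyl]
  rw [this]
  exact MeasurableSet.iInter fun k => MeasurableSet.iInter fun _ =>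
    measurable_pi_apply _ (measurableSet_singleton _)

/-- The weight of `σ` on `{x, …, x + n}` along the chain. -/
noncomputable def cw (ρ : ℝ) (σ : Config) (x : ℤ) (n : ℕ) : ℝ :=
  wt ρ (σ x) * ∏ k ∈ Finset.range n, tr ρ (σ (x + k)) (σ (x + k + 1))

theorem wt_tr (hρ : 1 / 2 < ρ) (s s' : Bool) : wt ρ s * tr ρ s s' = wt ρ s' * tr ρ s' s := by
  have : ρ ≠ 0 := by linarith
  cases s <;> cases s' <;> simp [wt, tr, activity] <;> field_simp <;> ring

theorem cw_succ_left (σ : Config) (x : ℤ) (n : ℕ) :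
    cw ρ σ x (n + 1) = wt ρ (σ x) * tr ρ (σ x) (σ (x + 1)) *
      ∏ k ∈ Finset.range n, tr ρ (σ (x + 1 + k)) (σ (x + 1 + k + 1)) := by
  unfold cw
  rw [Finset.prod_range_succ', mul_assoc, mul_comm (tr ρ (σ x) _)]
  simp only [Nat.cast_add, Nat.cast_one, Nat.cast_zero, add_zero]
  congr 3
  ext k
  rw [show x + ((k : ℤ) + 1) = x + 1 + k by ring]

theorem cw_two_sided (hρ : 1 / 2 < ρ) (σ : Config) (m n : ℕ) :
    cw ρ σ (-m) (m + n) = wt ρ (σ 0) * (∏ k ∈ Finset.range n, tr ρ (σ k) (σ (k + 1))) *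
      ∏ k ∈ Finset.range m, tr ρ (σ (-k)) (σ (-(k + 1))) := by
  have key : ∀ m n : ℕ, cw ρ σ (-m) (m + n) = cw ρ σ 0 n *
      ∏ k ∈ Finset.range m, tr ρ (σ (-k)) (σ (-(k + 1))) := by
    intro m
    induction m with
    | zero => intro n; simp
    | succ m ih =>
      intro n
      rw [Finset.prod_range_succ, ← mul_assoc, ← ih n, show m + 1 + n = m + n + 1 by ring,
        cw_succ_left, wt_tr hρ]
      unfold cw
      have e : (-((m + 1 : ℕ) : ℤ)) + 1 = -m := by push_cast; ring
      have e' : (-((m + 1 : ℕ) : ℤ)) = -((m : ℤ) + 1) := by push_cast; ring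
      rw [e, e']
      ring
  rw [key]
  simp [cw]

theorem prod_Icc_split (g : ℤ → ℝ) (m n : ℕ) :
    ∏ i ∈ Finset.Icc (-(m : ℤ)) n, g i = g 0 * (∏ k ∈ Finset.range n, g (k + 1)) *
      ∏ k ∈ Finset.range m, g (-(k + 1)) := by
  induction m with
  | zero =>
    induction n with
    | zero => simp
    | succ n ih =>
      have : Finset.Icc (-((0 : ℕ) : ℤ)) ((n + 1 : ℕ) : ℤ)
          = insert ((n : ℤ) + 1) (Finset.Icc (-((0 : ℕ) : ℤ)) n) := by
        ext i; simp only [Finset.mem_Icc, Finset.mem_insert]; push_cast; omega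
      rw [this, Finset.prod_insert (by simp), ih, Finset.prod_range_succ]
      simp; ring
  | succ m ih =>
    have : Finset.Icc (-((m + 1 : ℕ) : ℤ)) (n : ℤ)
        = insert (-((m : ℤ) + 1)) (Finset.Icc (-(m : ℤ)) n) := by
      ext i; simp only [Finset.mem_Icc, Finset.mem_insert]; push_cast; omega
    rw [this, Finset.prod_insert (by simp), ih, Finset.prod_range_succ]
    ring

theorem build_ofNat (ξ : ℤ → Bool) (k : ℕ) : build ξ k = chain (fun j => ξ j) k := rfl

theorem build_neg (ξ : ℤ → Bool) (k : ℕ) : build ξ (-k) = chain (fun j => ξ (-j)) k := by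
  cases k with
  | zero => simp [chain]; exact build_ofNat ξ 0
  | succ k => rfl

/-- Constraint on the noise at `i` so that the built configuration is `σ`. -/
def noiseSet (σ : Config) (i : ℤ) : Set Bool :=
  if i = 0 then {σ 0} else if 0 < i then stepSet (σ (i - 1)) (σ i) else stepSet (σ (i + 1)) (σ i)

theorem build_preimage (σ : Config) (m n : ℕ) :
    build ⁻¹' (cyl σ (-m) (m + n)) =
      Set.pi (Finset.Icc (-(m : ℤ)) n : Finset ℤ) (noiseSet σ) := by
  ext ξ
  have h1 : ξ ∈ build ⁻¹' (cyl σ (-m) (m + n)) ↔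
      (∀ k ≤ n, chain (fun j => ξ j) k = σ k) ∧
      (∀ k ≤ m, chain (fun j => ξ (-j)) k = σ (-k)) := by
    simp only [Set.mem_preimage, cyl, Set.mem_ofPred_eq]
    constructor
    · intro h
      refine ⟨fun k hk => ?_, fun k hk => ?_⟩
      · have := h (m + k) (by omega)
        rw [show -(m : ℤ) + ((m + k : ℕ) : ℤ) = k by push_cast; ring] at this
        rw [← build_ofNat]; exact this
      · have := h (m - k) (by omega)
        rw [show -(m : ℤ) + ((m - k : ℕ) : ℤ) = -k by omega] at this
        rw [← build_neg]; exact this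
    · rintro ⟨ha, hb⟩ k hk
      rcases le_total m k with h | h
      · obtain ⟨j, rfl⟩ := Nat.exists_eq_add_of_le h
        rw [show -(m : ℤ) + ((m + j : ℕ) : ℤ) = j by push_cast; ring, build_ofNat]
        exact ha j (by omega)
      · obtain ⟨j, rfl⟩ := Nat.exists_eq_add_of_le h
        rw [show -((k + j : ℕ) : ℤ) + (k : ℤ) = -j by push_cast; ring, build_neg]
        exact hb j (by omega)
  rw [h1, chain_eq_iff _ (fun k => σ k), chain_eq_iff _ (fun k => σ (-k))]
  simp only [Set.mem_pi, Finset.coe_Icc, Set.mem_Icc]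
  constructor
  · rintro ⟨⟨h0, hr⟩, -, hl⟩ i ⟨hi, hi'⟩
    unfold noiseSet
    split_ifs with ha hb
    · subst ha; exact h0
    · obtain ⟨k, rfl⟩ : ∃ k : ℕ, i = (k : ℤ) + 1 := ⟨(i - 1).toNat, by omega⟩
      have := hr k (by omega)
      push_cast at this
      simpa using this
    · obtain ⟨k, rfl⟩ : ∃ k : ℕ, i = -((k : ℤ) + 1) := ⟨(-i - 1).toNat, by omega⟩
      have := hl k (by omega)
      push_cast at this
      rw [show -((k : ℤ) + 1) + 1 = -k by ring]
      exact this
  · intro h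
    have h0 : ξ 0 = σ 0 := by simpa [noiseSet] using h 0 (by omega)
    refine ⟨⟨h0, fun k hk => ?_⟩, by simpa using h0, fun k hk => ?_⟩
    · have := h ((k : ℤ) + 1) (by omega)
      unfold noiseSet at this
      rw [if_neg (by omega), if_pos (by omega)] at this
      push_cast
      simpa using this
    · have := h (-((k : ℤ) + 1)) (by omega)
      unfold noiseSet at this
      rw [if_neg (by omega), if_neg (by omega), show -((k : ℤ) + 1) + 1 = -k by ring] at this
      push_cast
      exact this

theorem stationaryMeasure_cyl_zero (hρ : 1 / 2 < ρ) (hρ' : ρ < 1) (σ : Config) (m n : ℕ) :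
    (stationaryMeasure ρ).real (cyl σ (-m) (m + n)) = cw ρ σ (-m) (m + n) := by
  have h : (stationaryMeasure ρ).real (cyl σ (-m) (m + n))
      = ∏ i ∈ Finset.Icc (-(m : ℤ)) n, (noise ρ i).real (noiseSet σ i) := by
    unfold stationaryMeasure
    rw [map_measureReal_apply measurable_build (measurableSet_cyl _ _ _), build_preimage,
      measureReal_def, Measure.infinitePi_pi _ fun i _ => (Set.toFinite _).measurableSet,
      ENNReal.toReal_prod]
    rfl
  rw [h, prod_Icc_split, cw_two_sided hρ]
  congr 1
  · congr 1
    · simp only [noise, noiseSet, if_true]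
      rw [ber_real (by linarith) hρ'.le]
      cases σ 0 <;> simp [wt]
    · refine Finset.prod_congr rfl fun k _ => ?_
      simp only [noise, noiseSet]
      rw [if_neg (by omega), if_neg (by omega), if_pos (by omega), ber_step hρ hρ']
      simp
  · refine Finset.prod_congr rfl fun k _ => ?_
    simp only [noise, noiseSet]
    rw [if_neg (by omega), if_neg (by omega), if_neg (by omega), ber_step hρ hρ',
      show -((k : ℤ) + 1) + 1 = -k by ring]

theorem shrink_right {x : ℤ} {n : ℕ}
    (h : ∀ σ, (stationaryMeasure ρ).real (cyl σ x (n + 1)) = cw ρ σ x (n + 1)) (σ : Config) :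
    (stationaryMeasure ρ).real (cyl σ x n) = cw ρ σ x n := by
  have hu : cyl σ x n = cyl (Function.update σ (x + n + 1) true) x (n + 1) ∪
      cyl (Function.update σ (x + n + 1) false) x (n + 1) := by
    ext η
    simp only [cyl, Set.mem_ofPred_eq, Set.mem_union]
    constructor
    · intro hη
      have : ∀ b, η (x + n + 1) = b → ∀ k ≤ n + 1,
          η (x + k) = Function.update σ (x + n + 1) b (x + k) := by
        intro b hb k hk
        rcases Nat.lt_or_ge k (n + 1) with h2 | h2
        · rw [Function.update_of_ne (by omega)]; exact hη k (by omega)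
        · obtain rfl : k = n + 1 := by omega
          push_cast; rw [← add_assoc, hb]; simp
      cases hb : η (x + n + 1)
      · exact Or.inr (this _ hb)
      · exact Or.inl (this _ hb)
    · rintro (hη | hη) k hk <;>
      · have := hη k (by omega)
        rwa [Function.update_of_ne (by omega)] at this
  have hd : Disjoint (cyl (Function.update σ (x + n + 1) true) x (n + 1))
      (cyl (Function.update σ (x + n + 1) false) x (n + 1)) := by
    rw [Set.disjoint_left]
    intro η h1 h2
    have a := h1 (n + 1) le_rfl
    have b := h2 (n + 1) le_rfl
    push_cast at a b
    rw [← add_assoc, Function.update_self] at a b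
    rw [a] at b; simp at b
  have hc : ∀ b, cw ρ (Function.update σ (x + n + 1) b) x (n + 1)
      = cw ρ σ x n * tr ρ (σ (x + n)) b := by
    intro b
    unfold cw
    rw [Finset.prod_range_succ, Function.update_self, Function.update_of_ne (by omega),
      Function.update_of_ne (by omega), ← mul_assoc]
    congr 2
    refine Finset.prod_congr rfl fun k hk => ?_
    have := Finset.mem_range.1 hk
    rw [Function.update_of_ne (by omega), Function.update_of_ne (by omega)]
  rw [hu, measureReal_union hd (measurableSet_cyl _ _ _), h, h, hc, hc, ← mul_add]
  cases σ (x + n) <;> simp [tr]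

theorem shrink_left (hρ : 1 / 2 < ρ) {x : ℤ} {n : ℕ}
    (h : ∀ σ, (stationaryMeasure ρ).real (cyl σ x (n + 1)) = cw ρ σ x (n + 1)) (σ : Config) :
    (stationaryMeasure ρ).real (cyl σ (x + 1) n) = cw ρ σ (x + 1) n := by
  have hu : cyl σ (x + 1) n = cyl (Function.update σ x true) x (n + 1) ∪
      cyl (Function.update σ x false) x (n + 1) := by
    ext η
    simp only [cyl, Set.mem_ofPred_eq, Set.mem_union]
    constructor
    · intro hη
      have : ∀ b, η x = b → ∀ k ≤ n + 1, η (x + k) = Function.update σ x b (x + k) := by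
        intro b hb k hk
        cases k with
        | zero => simpa using hb
        | succ k =>
          rw [Function.update_of_ne (by omega)]
          have := hη k (by omega)
          rw [show x + ((k + 1 : ℕ) : ℤ) = x + 1 + k by push_cast; ring]
          exact this
      cases hb : η x
      · exact Or.inr (this _ hb)
      · exact Or.inl (this _ hb)
    · rintro (hη | hη) k hk <;>
      · have := hη (k + 1) (by omega)
        rw [Function.update_of_ne (by omega),
          show x + ((k + 1 : ℕ) : ℤ) = x + 1 + k by push_cast; ring] at this
        exact this
  have hd : Disjoint (cyl (Function.update σ x true) x (n + 1))
      (cyl (Function.update σ x false) x (n + 1)) := by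
    rw [Set.disjoint_left]
    intro η h1 h2
    have a := h1 0 (by omega)
    have b := h2 0 (by omega)
    simp only [Nat.cast_zero, add_zero, Function.update_self] at a b
    rw [a] at b; simp at b
  have hc : ∀ b, cw ρ (Function.update σ x b) x (n + 1)
      = wt ρ b * tr ρ b (σ (x + 1)) *
        ∏ k ∈ Finset.range n, tr ρ (σ (x + 1 + k)) (σ (x + 1 + k + 1)) := by
    intro b
    rw [cw_succ_left, Function.update_self, Function.update_of_ne (by omega)]
    congr 1
    refine Finset.prod_congr rfl fun k hk => ?_
    rw [Function.update_of_ne (by omega), Function.update_of_ne (by omega)]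
  rw [hu, measureReal_union hd (measurableSet_cyl _ _ _), h, h, hc, hc, ← add_mul, cw]
  congr 1
  have : ρ ≠ 0 := by linarith
  cases σ (x + 1) <;> simp [tr, wt, activity] <;> field_simp <;> ring

theorem stationaryMeasure_cyl (hρ : 1 / 2 < ρ) (hρ' : ρ < 1) (σ : Config) (x : ℤ) (n : ℕ) :
    (stationaryMeasure ρ).real (cyl σ x n) = cw ρ σ x n := by
  have hR : ∀ (j n : ℕ) (x : ℤ),
      (∀ σ, (stationaryMeasure ρ).real (cyl σ x (n + j)) = cw ρ σ x (n + j)) →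
      ∀ σ, (stationaryMeasure ρ).real (cyl σ x n) = cw ρ σ x n := by
    intro j
    induction j with
    | zero => intro n x h; exact h
    | succ j ih => intro n x h; exact ih n x (shrink_right h)
  have hL : ∀ (j n : ℕ) (x : ℤ),
      (∀ σ, (stationaryMeasure ρ).real (cyl σ x (n + j)) = cw ρ σ x (n + j)) →
      ∀ σ, (stationaryMeasure ρ).real (cyl σ (x + j) n) = cw ρ σ (x + j) n := by
    intro j
    induction j with
    | zero => intro n x h; simpa using h
    | succ j ih =>
      intro n x h
      have := ih n (x + 1) (shrink_left hρ h)
      rw [show x + ((j + 1 : ℕ) : ℤ) = x + 1 + j by push_cast; ring]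
      exact this
  have h0 := hR x.natAbs (n + (x + x.natAbs).toNat) (-x.natAbs) (fun σ => by
    rw [show n + (x + x.natAbs).toNat + x.natAbs = x.natAbs + (n + (x + x.natAbs).toNat) by ring]
    exact stationaryMeasure_cyl_zero hρ hρ' σ _ _)
  have h1 := hL _ _ _ h0 σ
  rwa [show -(x.natAbs : ℤ) + ((x + x.natAbs).toNat : ℤ) = x by omega] at h1

end Cylinder

/-- The finite-dimensional distributions of `π_ρ` on every box `{x, …, x + n}` of `n + 1` sites,
with `p` the number of particles of `σ` in the box: in particular `π_ρ` is translation invariant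
and is carried by the ergodic configurations, those without two adjacent empty sites. -/
theorem stationaryMeasure_cylinder {ρ : ℝ} (hρ : 1 / 2 < ρ) (hρ' : ρ < 1) (σ : Config) (x : ℤ)
    (n : ℕ) (p : ℤ) (hp : p = ∑ k ∈ Finset.range (n + 1), if σ (x + k) then 1 else 0) :
    (stationaryMeasure ρ).real {η | ∀ k ≤ n, η (x + k) = σ (x + k)} =
      open Classical in
      if ∀ k < n, σ (x + k) = true ∨ σ (x + k + 1) = true then
        (1 - ρ) * ((1 - ρ) / ρ) ^ ((n : ℤ) - p) *
          ((2 * ρ - 1) / ρ) ^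
            (2 * p - n - (if σ x then 1 else 0) - (if σ (x + n) then 1 else 0))
      else 0 := by
  have hr : (1 - ρ) / ρ ≠ 0 := div_ne_zero (by linarith) (by linarith)
  have ha : (2 * ρ - 1) / ρ ≠ 0 := (activity_mem hρ hρ').1.ne'
  have h0 : ρ ≠ 0 := by linarith
  have h1 : 1 - ρ ≠ 0 := by linarith
  have h2 : 1 - (2 * ρ - 1) / ρ = (1 - ρ) / ρ := by field_simp; ring
  refine (stationaryMeasure_cyl hρ hρ' σ x n).trans ?_
  subst hp
  induction n with
  | zero =>
    rw [zero_add, Finset.sum_range_one]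
    cases h : σ x
    · simp [cw, wt, h]
    · simp [cw, wt, h]
      field_simp
  | succ n ih =>
    have hs : cw ρ σ x (n + 1) = cw ρ σ x n * tr ρ (σ (x + n)) (σ (x + n + 1)) := by
      unfold cw; rw [Finset.prod_range_succ, mul_assoc]
    have hE : (∀ k < n + 1, σ (x + k) = true ∨ σ (x + k + 1) = true) ↔
        (∀ k < n, σ (x + k) = true ∨ σ (x + k + 1) = true) ∧
          (σ (x + n) = true ∨ σ (x + n + 1) = true) :=
      Nat.forall_lt_succ_right
    rw [hs, ih, Finset.sum_range_succ _ (n + 1)]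
    set S : ℤ := ∑ k ∈ Finset.range (n + 1), if σ (x + k) then 1 else 0
    have e : x + ((n + 1 : ℕ) : ℤ) = x + n + 1 := by push_cast; ring
    rw [e]
    generalize (if σ x = true then (1 : ℤ) else 0) = c
    by_cases hc : ∀ k < n, σ (x + k) = true ∨ σ (x + k + 1) = true
    · rw [if_pos hc]
      cases hA : σ (x + n) <;> cases hB : σ (x + n + 1)
      · have hF : ¬ ∀ k < n + 1, σ (x + k) = true ∨ σ (x + k + 1) = true :=
          fun h => by simpa [hA, hB] using (hE.1 h).2
        rw [if_neg hF]; simp [tr]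
      · rw [if_pos (hE.2 ⟨hc, Or.inr hB⟩)]
        simp only [tr, if_true, Bool.false_eq_true, if_false, mul_one]
        congr 2 <;> [congr 1; skip] <;> push_cast <;> ring
      · rw [if_pos (hE.2 ⟨hc, Or.inl hA⟩)]
        simp only [tr, if_true, Bool.false_eq_true, if_false, activity, h2]
        rw [show (((n + 1 : ℕ) : ℤ) - (S + 0)) = ((n : ℤ) - S) + 1 by push_cast; ring,
          zpow_add_one₀ hr]
        rw [show (2 * (S + 0) - ((n + 1 : ℕ) : ℤ) - c - 0)
          = 2 * S - (n : ℤ) - c - 1 by push_cast; ring]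
        ring
      · rw [if_pos (hE.2 ⟨hc, Or.inl hA⟩)]
        simp only [tr, if_true, activity]
        rw [show (((n + 1 : ℕ) : ℤ) - (S + 1)) = ((n : ℤ) - S) by push_cast; ring,
          show (2 * (S + 1) - ((n + 1 : ℕ) : ℤ) - c - 1)
          = (2 * S - (n : ℤ) - c - 1) + 1 by push_cast; ring,
          zpow_add_one₀ ha]
        ring
    · rw [if_neg hc, if_neg (fun h => hc (hE.1 h).1), zero_mul]

/-- `ψ̃(r)`, the mean of `ψ` under the stationary measure of density `r`. -/
noncomputable def mean (ψ : Config → ℝ) (r : ℝ) : ℝ := ∫ η, ψ η ∂(stationaryMeasure r)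

/-- `V_ψ(η) = ψ(η) - ψ̃(ρ) - ψ̃'(ρ) (η_0 - ρ)`. -/
noncomputable def centred (ψ : Config → ℝ) (ρ : ℝ) (η : Config) : ℝ :=
  ψ η - mean ψ ρ - deriv (mean ψ) ρ * (occ η 0 - ρ)

/-- `(τ_x ψ)(η) = ψ(η_{· - x})`. -/
def translate (x : ℤ) (ψ : Config → ℝ) (η : Config) : ℝ := ψ fun y => η (y - x)

/-- `N^{-1/2} ∑_x G(x/N) (τ_x V)(η)`. -/
noncomputable def field (N : ℕ) (G : ℝ → ℝ) (V : Config → ℝ) (η : Config) : ℝ :=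
  (√(N : ℝ))⁻¹ * ∑' x : ℤ, G ((x : ℝ) / (N : ℝ)) * translate x V η

/-- `∫_0^t N^{-1/2} ∑_x G(x/N) (τ_x V)(η(s)) ds`. -/
noncomputable def integratedField {Ω : Type*} (N : ℕ) (G : ℝ → ℝ) (V : Config → ℝ)
    (η : ℝ≥0 → Ω → Config) (t : ℝ) (ω : Ω) : ℝ :=
  ∫ s in (0 : ℝ)..t, field N G V (η s.toNNReal ω)

end FEP

/-! The measure `π_ρ` is carried by configurations without two adjacent empty sites (`Ergodic`). On
these, what follows a particle reads as a sequence of letters `1` and `01`. Under `π_ρ` the letters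
are independent, `01` having probability `hole ρ = (1 - ρ) / ρ`, and the jumps of the process
exchange adjacent letters, all at the same rate (`word_exchange`, `generator_eq_sum_exchange`). In
the letters the dynamics is thus a symmetric exclusion process.

Let `Z` be the space of local functions whose integrated field has vanishing second moment. It
contains the local functions null on ergodic configurations, the gradients `f - translate 1 f`
(summation by parts) and the differences `f ∘ exchange x - f`. The last point is a Kipnis–Varadhan
type estimate (`IsProcess.integral_sq_le_dynamic`): the field of such a difference is bounded by the
square root of the Dirichlet form with a constant independent of `N`, so that the acceleration `N ^
2` yields a factor `1 / N`, while its static norm is at most of order `√N`.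

Modulo `Z`, a word may be moved, its letters may be permuted, and it is the sum of its two
one-letter extensions. Hence (`IsReducing.exists_polyField`) every local `ψ` reduces to a polynomial
`Q` in the probability `X` of the letter `01`, and the mean of `ψ` at density `r` is `r * Q (hole
r)`. The constant `1` reduces to `1 + X` and `η_0` to `1`, and subtracting the mean and the linear
response leaves a polynomial with a double root at `y = hole ρ`.

It remains to treat `X ^ k * (X - y) ^ 2`. The factor `X - y` is represented by the average of `l`
consecutive centred letters, so the polynomial is equivalent to `k` letters `01` followed by the
product of the averages over two successive blocks of `l` letters. That product has second moment at
most `l⁻²`, is centred given the past and has range of order `l`; its field has static variance of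
order `1 / l`, uniformly in `N`. One lets `N → ∞`, then `l → ∞`. Neither an equivalence of ensembles
nor a spectral gap is needed.

The process is known only through its martingale problem. Invariance of `π_ρ` comes from iterating
the forward equation (`IsProcess.abs_integral_sub_le`), and the resolvent equation `u - generator u
= F` is solved approximately by local `u`, because the range of `1 - generator` on local functions
is dense in `L²` (`orthogonal_boxOp_eq_zero`). -/

namespace FEP

/-! ### Local functions and their decomposition into cylinders -/

section LocalFunctions

theorem IsLocal.exists_box {f : Config → ℝ} (hf : IsLocal f) (m : ℕ) :
    ∃ n : ℕ, m ≤ n ∧ DependsOn f (Set.Icc (-(n : ℤ)) n) := by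
  obtain ⟨A, hA⟩ := hf
  refine ⟨m + ∑ a ∈ A, a.natAbs, by omega, hA.mono fun a ha => ?_⟩
  have : a.natAbs ≤ ∑ a ∈ A, a.natAbs :=
    Finset.single_le_sum (f := fun a : ℤ => a.natAbs) (fun _ _ => Nat.zero_le _) ha
  simp only [Set.mem_Icc]
  omega

theorem isLocal_of_dependsOn_Icc {f : Config → ℝ} {a b : ℤ} (hf : DependsOn f (Set.Icc a b)) :
    IsLocal f :=
  ⟨Finset.Icc a b, by simpa using hf⟩

theorem IsLocal.map₂ {f g : Config → ℝ} (hf : IsLocal f) (hg : IsLocal g) (F : ℝ → ℝ → ℝ) :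
    IsLocal fun η => F (f η) (g η) := by
  obtain ⟨A, hA⟩ := hf
  obtain ⟨B, hB⟩ := hg
  refine ⟨A ∪ B, fun η ζ h => ?_⟩
  simp only [Finset.coe_union, Set.mem_union] at h
  simp only [hA fun i hi => h i (Or.inl hi), hB fun i hi => h i (Or.inr hi)]

theorem isLocal_const (c : ℝ) : IsLocal fun _ => c :=
  ⟨∅, by simpa using dependsOn_const c⟩

theorem isLocal_zero : IsLocal 0 := isLocal_const 0

theorem IsLocal.add {f g : Config → ℝ} (hf : IsLocal f) (hg : IsLocal g) :
    IsLocal fun η => f η + g η :=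
  hf.map₂ hg (· + ·)

theorem IsLocal.sub {f g : Config → ℝ} (hf : IsLocal f) (hg : IsLocal g) :
    IsLocal fun η => f η - g η :=
  hf.map₂ hg (· - ·)

theorem IsLocal.mul {f g : Config → ℝ} (hf : IsLocal f) (hg : IsLocal g) :
    IsLocal fun η => f η * g η :=
  hf.map₂ hg (· * ·)

theorem IsLocal.smul {f : Config → ℝ} (hf : IsLocal f) (c : ℝ) :
    IsLocal fun η => c * f η :=
  hf.map₂ hf fun a _ => c * a

theorem IsLocal.neg {f : Config → ℝ} (hf : IsLocal f) : IsLocal fun η => -f η :=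
  hf.map₂ hf fun a _ => -a

theorem IsLocal.sum {ι : Type*} {f : ι → Config → ℝ} (s : Finset ι)
    (hf : ∀ i ∈ s, IsLocal (f i)) : IsLocal (∑ i ∈ s, f i) := by
  classical
  induction s using Finset.induction_on with
  | empty => simpa using isLocal_zero
  | insert a s ha ih =>
    rw [Finset.sum_insert ha]
    exact (hf a (by simp)).add (ih fun i hi => hf i (by simp [hi]))

theorem isLocal_occ (x : ℤ) : IsLocal fun η => occ η x :=
  ⟨{x}, fun η ζ h => by simp [occ, h x (by simp)]⟩

theorem IsLocal.comp {f : Config → ℝ} (hf : IsLocal f) {T : Config → Config}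
    (hT : ∀ z, ∃ A : Finset ℤ, DependsOn (fun η => T η z) (A : Set ℤ)) :
    IsLocal fun η => f (T η) := by
  obtain ⟨A, hA⟩ := hf
  choose B hB using hT
  refine ⟨A.biUnion B, fun η ζ h => hA fun z hz => hB z fun i hi => h i ?_⟩
  simp only [Finset.coe_biUnion, Set.mem_iUnion]
  exact ⟨z, hz, hi⟩

theorem IsLocal.continuous {f : Config → ℝ} (hf : IsLocal f) : Continuous f := by
  obtain ⟨A, hA⟩ := hf
  obtain ⟨g, rfl⟩ := dependsOn_iff_exists_comp.1 hA
  exact (continuous_of_discreteTopology (f := g)).comp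
    (continuous_pi fun i => continuous_apply i.1)

theorem IsLocal.measurable {f : Config → ℝ} (hf : IsLocal f) : Measurable f := by
  obtain ⟨A, hA⟩ := hf
  obtain ⟨g, rfl⟩ := dependsOn_iff_exists_comp.1 hA
  exact (measurable_of_countable g).comp (measurable_pi_lambda _ fun i => measurable_pi_apply i.1)

theorem IsLocal.bounded {f : Config → ℝ} (hf : IsLocal f) : ∃ M, 0 ≤ M ∧ ∀ η, |f η| ≤ M := by
  obtain ⟨M, hM⟩ := (isCompact_range hf.continuous).isBounded.exists_norm_le
  exact ⟨|M|, abs_nonneg _, fun η => (hM _ ⟨η, rfl⟩).trans (le_abs_self M)⟩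

theorem IsLocal.memLp {f : Config → ℝ} (hf : IsLocal f) (μ : Measure Config) [IsFiniteMeasure μ]
    (p : ℝ≥0∞) : MemLp f p μ := by
  obtain ⟨M, -, hM⟩ := hf.bounded
  exact MemLp.of_bound hf.measurable.aestronglyMeasurable M (.of_forall hM)

theorem IsLocal.integrable {f : Config → ℝ} (hf : IsLocal f) (μ : Measure Config)
    [IsFiniteMeasure μ] : Integrable f μ :=
  memLp_one_iff_integrable.1 (hf.memLp μ 1)

/-- The configuration which agrees with `σ` on `{z, …, z + n}` and is empty elsewhere. -/
noncomputable def extend (z : ℤ) (n : ℕ) (σ : Finset.Icc z (z + n) → Bool) : Config :=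
  fun y => if h : y ∈ Finset.Icc z (z + n) then σ ⟨y, h⟩ else false

theorem mem_cyl_iff {σ η : Config} {z : ℤ} {n : ℕ} :
    η ∈ cyl σ z n ↔ ∀ y ∈ Set.Icc z (z + n), η y = σ y := by
  constructor
  · intro h y hy
    simp only [Set.mem_Icc] at hy
    have := h (y - z).toNat (by omega)
    rwa [show z + ((y - z).toNat : ℤ) = y by omega] at this
  · intro h k hk
    exact h _ (by simp only [Set.mem_Icc]; omega)

theorem eq_sum_indicator_cyl {f : Config → ℝ} {z : ℤ} {n : ℕ}
    (hf : DependsOn f (Set.Icc z (z + n))) :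
    f = ∑ σ : Finset.Icc z (z + n) → Bool,
      f (extend z n σ) • (cyl (extend z n σ) z n).indicator (fun _ => (1 : ℝ)) := by
  classical
  ext η
  rw [Finset.sum_apply, Finset.sum_eq_single (fun y : Finset.Icc z (z + n) => η y)]
  · have h : ∀ y ∈ Set.Icc z (z + n), η y = extend z n (fun y => η y) y := by
      intro y hy
      have : y ∈ Finset.Icc z (z + n) := by simpa using hy
      simp only [extend, dif_pos this]
    rw [Pi.smul_apply, Set.indicator_of_mem (mem_cyl_iff.2 h), smul_eq_mul, mul_one]
    exact hf h
  · intro σ _ hσ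
    rw [Pi.smul_apply, Set.indicator_of_notMem, smul_zero]
    intro h
    apply hσ
    ext ⟨y, hy⟩
    have := mem_cyl_iff.1 h y (by simpa using hy)
    simp only [extend, dif_pos hy] at this
    exact this.symm
  · simp

/-- Local functions on a box are generated by the indicators of cylinders of that box. -/
theorem dependsOn_induction {p : (Config → ℝ) → Prop} (z : ℤ) (n : ℕ) (h0 : p 0)
    (hcyl : ∀ σ, p ((cyl σ z n).indicator fun _ => (1 : ℝ)))
    (hadd : ∀ f g, DependsOn f (Set.Icc z (z + n)) → DependsOn g (Set.Icc z (z + n)) →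
      p f → p g → p (f + g))
    (hsmul : ∀ (c : ℝ) f, DependsOn f (Set.Icc z (z + n)) → p f → p (c • f))
    {f : Config → ℝ} (hf : DependsOn f (Set.Icc z (z + n))) : p f := by
  classical
  rw [eq_sum_indicator_cyl hf]
  have hc : ∀ σ, DependsOn ((cyl σ z n).indicator fun _ => (1 : ℝ)) (Set.Icc z (z + n)) := by
    intro σ η ζ h
    have : η ∈ cyl σ z n ↔ ζ ∈ cyl σ z n := by
      simp only [mem_cyl_iff]
      exact forall₂_congr fun y hy => by rw [h y hy]
    simp only [Set.indicator, this]
  have key : ∀ s : Finset (Finset.Icc z (z + n) → Bool),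
      DependsOn (∑ σ ∈ s, f (extend z n σ) • (cyl (extend z n σ) z n).indicator
        (fun _ => (1 : ℝ))) (Set.Icc z (z + n)) ∧
      p (∑ σ ∈ s, f (extend z n σ) • (cyl (extend z n σ) z n).indicator (fun _ => (1 : ℝ))) := by
    intro s
    induction s using Finset.induction_on with
    | empty => exact ⟨fun _ _ _ => rfl, by simpa using h0⟩
    | insert a s ha ih =>
      have h1 : DependsOn (f (extend z n a) • (cyl (extend z n a) z n).indicator
          (fun _ => (1 : ℝ))) (Set.Icc z (z + n)) := fun η ζ h => by
        simp only [Pi.smul_apply, hc _ h]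
      rw [Finset.sum_insert ha]
      refine ⟨fun η ζ h => ?_, hadd _ _ h1 ih.1 (hsmul _ _ (hc _) (hcyl _)) ih.2⟩
      rw [Pi.add_apply, Pi.add_apply, h1 h, ih.1 h]
  exact (key _).2

end LocalFunctions

/-! ### The stationary measure: Markov property, support, invariance under exchanges -/

section Stationary

variable {ρ : ℝ}

theorem integral_indicator_cyl (hρ : 1 / 2 < ρ) (hρ' : ρ < 1) (σ : Config) (z : ℤ) (n : ℕ) :
    ∫ η, (cyl σ z n).indicator (fun _ => (1 : ℝ)) η ∂stationaryMeasure ρ = cw ρ σ z n := by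
  rw [integral_indicator (measurableSet_cyl _ _ _), setIntegral_const, smul_eq_mul, mul_one,
    stationaryMeasure_cyl hρ hρ']

/-- One-step Markov property of the stationary measure. -/
theorem integral_mul_next (hρ : 1 / 2 < ρ) (hρ' : ρ < 1) {z : ℤ} {n : ℕ} {φ : Config → ℝ}
    (hφ : DependsOn φ (Set.Icc z (z + n))) (b : Bool) :
    ∫ η, φ η * (if η (z + n + 1) = b then 1 else 0) ∂stationaryMeasure ρ =
      ∫ η, φ η * tr ρ (η (z + n)) b ∂stationaryMeasure ρ := by
  have hl1 : IsLocal fun η : Config => if η (z + n + 1) = b then (1 : ℝ) else 0 :=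
    ⟨{z + n + 1}, fun η ζ h => by simp [h (z + n + 1) (by simp)]⟩
  have hl2 : IsLocal fun η : Config => tr ρ (η (z + n)) b :=
    ⟨{z + (n : ℤ)}, fun η ζ h => by simp [h (z + n) (by simp)]⟩
  refine dependsOn_induction (p := fun φ =>
    ∫ η, φ η * (if η (z + n + 1) = b then 1 else 0) ∂stationaryMeasure ρ =
      ∫ η, φ η * tr ρ (η (z + n)) b ∂stationaryMeasure ρ) z n ?_ ?_ ?_ ?_ hφ
  · simp
  · intro σ
    have e1 : ∀ η : Config, (cyl σ z n).indicator (fun _ => (1 : ℝ)) η *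
        (if η (z + n + 1) = b then 1 else 0) =
        (cyl (Function.update σ (z + n + 1) b) z (n + 1)).indicator (fun _ => (1 : ℝ)) η := by
      intro η
      have : η ∈ cyl (Function.update σ (z + n + 1) b) z (n + 1) ↔
          η ∈ cyl σ z n ∧ η (z + n + 1) = b := by
        simp only [mem_cyl_iff, Set.mem_Icc]
        constructor
        · intro h
          refine ⟨fun y hy => ?_, ?_⟩
          · rw [h y (by push_cast; omega), Function.update_of_ne (by omega)]
          · rw [h _ (by push_cast; omega), Function.update_self]
        · rintro ⟨h1, h2⟩ y hy
          by_cases hy' : y = z + n + 1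
          · rw [hy', h2, Function.update_self]
          · rw [Function.update_of_ne hy']
            exact h1 y (by push_cast at hy; omega)
      by_cases h1 : η ∈ cyl σ z n <;> by_cases h2 : η (z + n + 1) = b <;>
        simp [Set.indicator, this, h1, h2]
    have e2 : ∀ η : Config, (cyl σ z n).indicator (fun _ => (1 : ℝ)) η * tr ρ (η (z + n)) b =
        (cyl σ z n).indicator (fun _ => (1 : ℝ)) η * tr ρ (σ (z + n)) b := by
      intro η
      by_cases h1 : η ∈ cyl σ z n
      · rw [mem_cyl_iff.1 h1 (z + n) (by simp)]
      · simp [h1]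
    simp only [e1, e2]
    rw [integral_mul_const, integral_indicator_cyl hρ hρ', integral_indicator_cyl hρ hρ']
    unfold cw
    rw [Finset.prod_range_succ, Function.update_self, Function.update_of_ne (by omega),
      Function.update_of_ne (by omega), ← mul_assoc]
    congr 2
    refine Finset.prod_congr rfl fun k hk => ?_
    have := Finset.mem_range.1 hk
    rw [Function.update_of_ne (by omega), Function.update_of_ne (by omega)]
  · intro f g hf hg h1 h2
    have hf := isLocal_of_dependsOn_Icc hf
    have hg := isLocal_of_dependsOn_Icc hg
    simp only [Pi.add_apply, add_mul]
    refine (integral_add ((hf.mul hl1).integrable _) ((hg.mul hl1).integrable _)).trans ?_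
    refine Eq.trans ?_ (integral_add ((hf.mul hl2).integrable _) ((hg.mul hl2).integrable _)).symm
    exact congrArg₂ (· + ·) h1 h2
  · intro c f hf h1
    simp only [Pi.smul_apply, smul_eq_mul, mul_assoc]
    rw [integral_const_mul, integral_const_mul, h1]

theorem integral_occ (hρ : 1 / 2 < ρ) (hρ' : ρ < 1) (x : ℤ) :
    ∫ η, occ η x ∂stationaryMeasure ρ = ρ := by
  have := integral_indicator_cyl hρ hρ' (fun _ => true) x 0
  rw [show cw ρ (fun _ => true) x 0 = ρ by simp [cw, wt]] at this
  refine Eq.trans ?_ this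
  refine integral_congr_ae (.of_forall fun η => ?_)
  simp [occ, Set.indicator, cyl]

/-- The configurations without two adjacent empty sites. -/
def Ergodic (η : Config) : Prop := ∀ x, η x = true ∨ η (x + 1) = true

/-- An empty site is followed by a particle with probability one, and there are countably many pairs
of neighbours. -/
theorem ae_ergodic (hρ : 1 / 2 < ρ) (hρ' : ρ < 1) : ∀ᵐ η ∂stationaryMeasure ρ, Ergodic η := by
  unfold Ergodic
  rw [ae_all_iff]
  intro x
  have h : (stationaryMeasure ρ).real (cyl (fun _ => false) x 1) = 0 := by
    rw [stationaryMeasure_cyl hρ hρ']; simp [cw, tr]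
  rw [measureReal_eq_zero_iff] at h
  rw [ae_iff]
  refine measure_mono_null (fun η hη => ?_) h
  rw [mem_cyl_iff]
  intro y hy
  simp only [Set.mem_Icc, Nat.cast_one] at hy
  simp only [Set.mem_ofPred_eq, not_or, Bool.not_eq_true] at hη
  rcases (by omega : y = x ∨ y = x + 1) with rfl | rfl
  · exact hη.1
  · exact hη.2

/-- Exchange of the values at `x` and `x + 1`, when the sites `x - 1` and `x + 2` are occupied. -/
def exchange (x : ℤ) (η : Config) : Config :=
  if η (x - 1) = true ∧ η (x + 2) = true then swap η x (x + 1) else η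

theorem swap_left (η : Config) (x : ℤ) : swap η x (x + 1) x = η (x + 1) := by simp [swap]

theorem swap_right (η : Config) (x : ℤ) : swap η x (x + 1) (x + 1) = η x := by simp [swap]

theorem swap_of_ne (η : Config) {x z : ℤ} (h : z ≠ x) (h' : z ≠ x + 1) :
    swap η x (x + 1) z = η z := by simp [swap, Equiv.swap_apply_of_ne_of_ne h h']

theorem exchange_of_ne (η : Config) {x z : ℤ} (h : z ≠ x) (h' : z ≠ x + 1) :
    exchange x η z = η z := by
  unfold exchange
  split_ifs
  · exact swap_of_ne η h h'
  · rfl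

theorem exchange_exchange (x : ℤ) (η : Config) : exchange x (exchange x η) = η := by
  by_cases h : η (x - 1) = true ∧ η (x + 2) = true
  · have h' : exchange x η (x - 1) = true ∧ exchange x η (x + 2) = true := by
      rw [exchange_of_ne η (by omega) (by omega), exchange_of_ne η (by omega) (by omega)]
      exact h
    rw [exchange, if_pos h', exchange, if_pos h]
    ext z
    simp [swap]
  · simp [exchange, h]

theorem dependsOn_exchange (x z : ℤ) :
    DependsOn (fun η => exchange x η z) (({z, x - 1, x, x + 1, x + 2} : Finset ℤ) : Set ℤ) := by
  intro η ζ h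
  simp only [Finset.coe_insert, Finset.coe_singleton, Set.mem_insert_iff,
    Set.mem_singleton_iff] at h
  have h1 := h (x - 1) (by simp)
  have h2 := h (x + 2) (by simp)
  have h3 := h z (by simp)
  simp only [exchange, h1, h2]
  split_ifs
  · by_cases hz : z = x
    · subst hz; rw [swap_left, swap_left]; exact h _ (by simp)
    · by_cases hz' : z = x + 1
      · subst hz'; rw [swap_right, swap_right]; exact h _ (by simp)
      · rw [swap_of_ne _ hz hz', swap_of_ne _ hz hz', h3]
  · exact h3

theorem IsLocal.comp_exchange {f : Config → ℝ} (hf : IsLocal f) (x : ℤ) :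
    IsLocal fun η => f (exchange x η) :=
  hf.comp fun z => ⟨_, dependsOn_exchange x z⟩

theorem dependsOn_comp_exchange {f : Config → ℝ} {a b x : ℤ} (hf : DependsOn f (Set.Icc a b))
    (hx : a ≤ x - 1) (hx' : x + 2 ≤ b) : DependsOn (fun η => f (exchange x η)) (Set.Icc a b) := by
  intro η ζ h
  refine hf fun z hz => dependsOn_exchange x z fun i hi => h i ?_
  simp only [Finset.coe_insert, Finset.coe_singleton, Set.mem_insert_iff,
    Set.mem_singleton_iff, Set.mem_Icc] at *
  omega

theorem comp_exchange_of_notMem {f : Config → ℝ} {a b x : ℤ} (hf : DependsOn f (Set.Icc a b))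
    (hx : x + 1 < a ∨ b < x) (η : Config) : f (exchange x η) = f η := by
  refine hf fun z hz => exchange_of_ne η ?_ ?_ <;>
  · simp only [Set.mem_Icc] at hz
    omega

theorem measurable_exchange (x : ℤ) : Measurable (exchange x) := by
  rw [measurable_pi_iff]
  intro z
  obtain ⟨g, hg⟩ := dependsOn_iff_exists_comp.1 (dependsOn_exchange x z)
  rw [hg]
  exact (measurable_of_countable g).comp (measurable_pi_lambda _ fun i => measurable_pi_apply i.1)

/-- Between two particles, `1 1 0 1` and `1 0 1 1` use the same transitions in a different order, so
they have the same weight. This is the reversibility of `π_ρ`. -/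
theorem cw_exchange (σ : Config) {x z : ℤ} {n : ℕ} (hx : z ≤ x - 1) (hx' : x + 2 ≤ z + n) :
    cw ρ (exchange x σ) z n = cw ρ σ z n := by
  by_cases h : σ (x - 1) = true ∧ σ (x + 2) = true
  swap
  · simp [exchange, h]
  obtain ⟨j, rfl⟩ : ∃ j : ℕ, x = z + j + 1 := ⟨(x - 1 - z).toNat, by omega⟩
  -- Only the three transitions inside `{x - 1, …, x + 2}` are affected.
  have hsub : Finset.Ico j (j + 3) ⊆ Finset.range n := by
    intro k; simp only [Finset.mem_Ico, Finset.mem_range]; omega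
  unfold cw
  rw [exchange_of_ne σ (by omega) (by omega), ← Finset.prod_sdiff hsub, ← Finset.prod_sdiff hsub]
  congr 2
  · refine Finset.prod_congr rfl fun k hk => ?_
    simp only [Finset.mem_sdiff, Finset.mem_range, Finset.mem_Ico] at hk
    rw [exchange_of_ne σ (by omega) (by omega), exchange_of_ne σ (by omega) (by omega)]
  · have e0 : exchange (z + j + 1) σ (z + j + 1) = σ (z + j + 1 + 1) := by
      rw [exchange, if_pos h, swap_left]
    have e1 : exchange (z + j + 1) σ (z + j + 1 + 1) = σ (z + j + 1) := by
      rw [exchange, if_pos h, swap_right]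
    have e2 : exchange (z + j + 1) σ (z + j) = σ (z + j) :=
      exchange_of_ne σ (by omega) (by omega)
    have e3 : exchange (z + j + 1) σ (z + j + 2 + 1) = σ (z + j + 2 + 1) :=
      exchange_of_ne σ (by omega) (by omega)
    have h1 : σ (z + j) = true := by rw [← h.1]; congr 1; ring
    have h2 : σ (z + j + 2 + 1) = true := by rw [← h.2]; congr 1; ring
    simp only [Finset.prod_Ico_eq_prod_range, show j + 3 - j = 3 by omega, Finset.prod_range_succ,
      Finset.prod_range_zero, Nat.cast_add, Nat.cast_zero, Nat.cast_one, Nat.cast_ofNat, add_zero,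
      one_mul, ← add_assoc]
    rw [show z + (j : ℤ) + 2 = z + j + 1 + 1 by ring] at *
    rw [e0, e1, e2, e3, h1, h2]
    cases σ (z + j + 1) <;> cases σ (z + j + 1 + 1) <;> simp [tr, mul_comm]

theorem integral_comp_exchange (hρ : 1 / 2 < ρ) (hρ' : ρ < 1) {f : Config → ℝ} (hf : IsLocal f)
    (x : ℤ) : ∫ η, f (exchange x η) ∂stationaryMeasure ρ = ∫ η, f η ∂stationaryMeasure ρ := by
  -- The margin puts the whole window `{x - 1, …, x + 2}` inside the box, as `cw_exchange` demands.
  obtain ⟨m, hm, hf'⟩ := hf.exists_box (x.natAbs + 2)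
  replace hf' : DependsOn f (Set.Icc (-(m : ℤ)) (-m + ((2 * m : ℕ) : ℤ))) := by
    rwa [show -(m : ℤ) + ((2 * m : ℕ) : ℤ) = m by push_cast; ring]
  refine dependsOn_induction (p := fun f => ∫ η, f (exchange x η) ∂stationaryMeasure ρ =
    ∫ η, f η ∂stationaryMeasure ρ) _ _ ?_ ?_ ?_ ?_ hf'
  · simp
  · intro σ
    rw [integral_indicator_cyl hρ hρ', ← cw_exchange σ (x := x) (by omega)
      (by push_cast; omega), ← integral_indicator_cyl hρ hρ']
    refine integral_congr_ae (.of_forall fun η => ?_)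
    have : ∀ η σ : Config, η ∈ cyl σ (-m) (2 * m) → exchange x η ∈
        cyl (exchange x σ) (-m) (2 * m) := by
      intro η σ h
      rw [mem_cyl_iff] at *
      intro y hy
      refine dependsOn_exchange x y fun i hi => h i ?_
      simp only [Finset.coe_insert, Finset.coe_singleton, Set.mem_insert_iff,
        Set.mem_singleton_iff, Set.mem_Icc] at *
      push_cast at *
      omega
    have : exchange x η ∈ cyl σ (-m) (2 * m) ↔ η ∈ cyl (exchange x σ) (-m) (2 * m) :=
      ⟨fun h => by simpa [exchange_exchange] using this _ _ h,
        fun h => by simpa [exchange_exchange] using this _ _ h⟩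
    exact Set.indicator_const_eq_indicator_const this
  · intro f g hf hg h1 h2
    have hf := isLocal_of_dependsOn_Icc hf
    have hg := isLocal_of_dependsOn_Icc hg
    simp only [Pi.add_apply]
    rw [integral_add ((hf.comp_exchange x).integrable _) ((hg.comp_exchange x).integrable _),
      integral_add (hf.integrable _) (hg.integrable _), h1, h2]
  · intro c f hf h1
    simp only [Pi.smul_apply, smul_eq_mul]
    rw [integral_const_mul, integral_const_mul, h1]

theorem isLocal_indicator_of_mem_measurableCylinders {t : Set Config}
    (ht : t ∈ measurableCylinders fun _ : ℤ => Bool) : IsLocal (t.indicator fun _ => (1 : ℝ)) := by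
  obtain ⟨s, S, -, rfl⟩ := (mem_measurableCylinders _).1 ht
  exact ⟨s, dependsOn_cylinder_indicator_const (α := fun _ : ℤ => Bool) S (1 : ℝ)⟩

theorem measurePreserving_exchange (hρ : 1 / 2 < ρ) (hρ' : ρ < 1) (x : ℤ) :
    MeasurePreserving (exchange x) (stationaryMeasure ρ) (stationaryMeasure ρ) := by
  refine ⟨measurable_exchange x, ?_⟩
  have : IsProbabilityMeasure ((stationaryMeasure ρ).map (exchange x)) :=
    Measure.isProbabilityMeasure_map (measurable_exchange x).aemeasurable
  refine ext_of_generate_finite _ (generateFrom_measurableCylinders (α := fun _ : ℤ => Bool)).symm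
    isPiSystem_measurableCylinders (fun t ht => ?_) (by simp)
  have hm := MeasurableSet.of_mem_measurableCylinders ht
  have hl := isLocal_indicator_of_mem_measurableCylinders ht
  have h := integral_comp_exchange hρ hρ' hl x
  rw [Measure.map_apply (measurable_exchange x) hm]
  have e : ∀ η, t.indicator (fun _ => (1 : ℝ)) (exchange x η) =
    (exchange x ⁻¹' t).indicator (fun _ => (1 : ℝ)) η := fun η => rfl
  simp only [e] at h
  rw [integral_indicator (measurable_exchange x hm), integral_indicator hm, setIntegral_const,
    setIntegral_const, smul_eq_mul, mul_one, smul_eq_mul, mul_one] at h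
  exact (measureReal_eq_measureReal_iff).1 h

end Stationary

/-! ### The generator on local functions -/

section Generator

variable {p : ℝ}

theorem dependsOn_swap_comp {f : Config → ℝ} {a b : ℤ} (hf : DependsOn f (Set.Icc a b))
    {x : ℤ} (hx : x + 1 < a ∨ b < x) (η : Config) : f (swap η x (x + 1)) = f η := by
  refine hf fun z hz => swap_of_ne η ?_ ?_ <;>
  · simp only [Set.mem_Icc] at hz
    omega

theorem generator_eq_sum {f : Config → ℝ} {a b : ℤ} (hf : DependsOn f (Set.Icc a b))
    (q : ℝ) (η : Config) :
    generator p q f η = ∑ x ∈ Finset.Icc (a - 1) b,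
      (p * rateRight η x + q * rateLeft η x) * (f (swap η x (x + 1)) - f η) := by
  refine tsum_eq_sum fun x hx => ?_
  rw [dependsOn_swap_comp hf, sub_self, mul_zero]
  simp only [Finset.mem_Icc] at hx
  omega

theorem occ_eq_of_eq {η ζ : Config} {x : ℤ} (h : η x = ζ x) : occ η x = occ ζ x := by
  simp [occ, h]

theorem dependsOn_generator {f : Config → ℝ} {a b : ℤ} (hf : DependsOn f (Set.Icc a b))
    (q : ℝ) : DependsOn (generator p q f) (Set.Icc (a - 2) (b + 2)) := by
  intro η ζ h
  rw [generator_eq_sum hf, generator_eq_sum hf]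
  refine Finset.sum_congr rfl fun x hx => ?_
  simp only [Finset.mem_Icc] at hx
  simp only [Set.mem_Icc] at h
  have h1 := h (x - 1) (by omega)
  have h2 := h x (by omega)
  have h3 := h (x + 1) (by omega)
  have h4 := h (x + 2) (by omega)
  have h5 : f η = f ζ := hf fun i hi => by simp only [Set.mem_Icc] at hi; exact h i (by omega)
  have h6 : f (swap η x (x + 1)) = f (swap ζ x (x + 1)) := hf fun i hi => by
    simp only [Set.mem_Icc] at hi
    by_cases hz : i = x
    · subst hz; rw [swap_left, swap_left, h3]
    · by_cases hz' : i = x + 1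
      · subst hz'; rw [swap_right, swap_right, h2]
      · rw [swap_of_ne _ hz hz', swap_of_ne _ hz hz', h i (by omega)]
  simp only [rateRight, rateLeft, occ_eq_of_eq h1, occ_eq_of_eq h2, occ_eq_of_eq h3,
    occ_eq_of_eq h4, h5, h6]

theorem IsLocal.generator {f : Config → ℝ} (hf : IsLocal f) (p q : ℝ) :
    IsLocal (generator p q f) := by
  obtain ⟨n, -, hn⟩ := hf.exists_box 0
  exact isLocal_of_dependsOn_Icc (dependsOn_generator hn q)

/-- At most `2 n + 2` bonds touch the box; on each the rate is at most `2 p` and the increment at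
most `2 M`. The linear growth in `n` is what the iteration of the forward equation can afford. -/
theorem abs_generator_le (hp : 0 ≤ p) {f : Config → ℝ} {n : ℕ} {M : ℝ}
    (hf : DependsOn f (Set.Icc (-(n : ℤ)) n)) (hM : ∀ η, |f η| ≤ M) (η : Config) :
    |generator p p f η| ≤ 8 * p * (n + 1) * M := by
  rw [generator_eq_sum hf]
  have h : ∀ x ∈ Finset.Icc (-(n : ℤ) - 1) n,
      |(p * rateRight η x + p * rateLeft η x) * (f (swap η x (x + 1)) - f η)| ≤ 4 * p * M := by
    intro x _
    have h1 : |p * rateRight η x + p * rateLeft η x| ≤ 2 * p := by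
      simp only [rateRight, rateLeft, occ]
      split_ifs <;> norm_num <;> (try rw [abs_of_nonneg hp]) <;> nlinarith
    have h2 : |f (swap η x (x + 1)) - f η| ≤ 2 * M :=
      (abs_sub _ _).trans (by linarith [hM η, hM (swap η x (x + 1))])
    rw [abs_mul]
    calc _ ≤ (2 * p) * (2 * M) := by gcongr
      _ = _ := by ring
  refine (Finset.abs_sum_le_sum_abs _ _).trans ((Finset.sum_le_card_nsmul _ _ _ h).trans ?_)
  rw [Int.card_Icc, nsmul_eq_mul, show ((n : ℤ) + 1 - (-n - 1)).toNat = 2 * n + 2 by omega]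
  push_cast
  apply le_of_eq; ring

/-- On configurations without two adjacent empty sites, all the exchanges allowed by `exchange` are
performed at the same rate. -/
theorem generator_eq_sum_exchange {f : Config → ℝ} {a b : ℤ} (hf : DependsOn f (Set.Icc a b))
    {η : Config} (hη : Ergodic η) :
    generator p p f η = p * ∑ x ∈ Finset.Icc (a - 1) b, (f (exchange x η) - f η) := by
  rw [generator_eq_sum hf, Finset.mul_sum]
  refine Finset.sum_congr rfl fun x _ => ?_
  have hs : η x = η (x + 1) → swap η x (x + 1) = η := by
    intro h
    ext z
    by_cases hz : z = x
    · subst hz; rw [swap_left, h]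
    · by_cases hz' : z = x + 1
      · subst hz'; rw [swap_right, h]
      · rw [swap_of_ne _ hz hz']
  have h1 := hη (x - 1)
  have h2 := hη (x + 1)
  rw [sub_add_cancel] at h1
  rw [show x + 1 + 1 = x + 2 by ring] at h2
  unfold exchange rateRight rateLeft occ
  cases hA : η (x - 1) <;> cases hB : η x <;> cases hC : η (x + 1) <;> cases hD : η (x + 2) <;>
    simp_all

end Generator

/-! ### Density of the range of `1 - c ∑ (U_x - 1)` for isometric involutions of a Hilbert space -/

section Hilbert

open scoped InnerProductSpace

variable {H : Type*} [NormedAddCommGroup H] [InnerProductSpace ℝ H]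

theorem inner_involution {U : H →ₗᵢ[ℝ] H} (hU : ∀ f, U (U f) = f) (f g : H) :
    ⟪U f, g⟫_ℝ = ⟪f, U g⟫_ℝ := by
  rw [← U.inner_map_map f (U g), hU]

/-- An isometric involution is self-adjoint, so the pairing symmetrises into its Dirichlet form. -/
theorem inner_involution_sub {U : H →ₗᵢ[ℝ] H} (hU : ∀ f, U (U f) = f) (f g : H) :
    ⟪U f - f, g⟫_ℝ = -(1 / 2) * ⟪U f - f, U g - g⟫_ℝ := by
  have h1 := inner_involution hU f g
  have h2 := U.inner_map_map f g
  simp only [inner_sub_left, inner_sub_right]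
  linarith

variable {U : ℤ → H →ₗᵢ[ℝ] H} {K : ℕ → Submodule ℝ H}

/-- The truncated operator `f ↦ f - c ∑ (U_x f - f)`. -/
noncomputable def boxOp (U : ℤ → H →ₗᵢ[ℝ] H) (c : ℝ) (n : ℕ) : H →ₗ[ℝ] H :=
  LinearMap.id - c • ∑ x ∈ Finset.Icc (-(n : ℤ) - 1) n, ((U x).toLinearMap - LinearMap.id)

theorem boxOp_apply (U : ℤ → H →ₗᵢ[ℝ] H) (c : ℝ) (n : ℕ) (f : H) :
    boxOp U c n f = f - c • ∑ x ∈ Finset.Icc (-(n : ℤ) - 1) n, (U x f - f) := by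
  simp [boxOp]

/-- Bonds that do not touch the box act trivially on `K m`, so the truncations are consistent and
define a single operator on the union of the `K n`. -/
theorem boxOp_eq_of_le
    (hout : ∀ (n : ℕ) (x : ℤ), x + 1 < -n ∨ n < x → ∀ f ∈ K n, U x f = f) (c : ℝ)
    {m n : ℕ} (h : m ≤ n) {f : H} (hf : f ∈ K m) : boxOp U c n f = boxOp U c m f := by
  rw [boxOp_apply, boxOp_apply]
  congr 2
  symm
  refine Finset.sum_subset (fun x => ?_) fun x _ hx => ?_
  · simp only [Finset.mem_Icc]; omega
  · rw [hout m x _ f hf, sub_self]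
    simp only [Finset.mem_Icc] at hx
    omega

/-- Formally `w` is orthogonal to the range of `1 - L`, and pairing with `w` itself would give `‖w‖²
+ (Dirichlet form of w) = 0`; but `w` is not local. It is replaced by its projections `v n` on `K
n`, at the price of boundary terms `δ n` from the four bonds straddling the edge of the box. These
are first merely bounded, which makes the Dirichlet form of `w` finite, and therefore they tend to
zero. -/
theorem orthogonal_boxOp_eq_zero [CompleteSpace H] (hU : ∀ x f, U x (U x f) = f)
    [∀ n, (K n).HasOrthogonalProjection] (hK : Monotone K)
    (hd : ⊤ ≤ (⨆ n, K n).topologicalClosure)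
    (hin : ∀ (n : ℕ) (x : ℤ), -n ≤ x - 1 → x + 2 ≤ n → ∀ f ∈ K n, U x f ∈ K n)
    {c : ℝ} (hc : 0 < c) {w : H} (hw : ∀ n, ∀ f ∈ K n, ⟪boxOp U c n f, w⟫_ℝ = 0) : w = 0 := by
  set v : ℕ → H := fun n => (K n).starProjection w with hv
  have hvK : ∀ n, v n ∈ K n := fun n => Submodule.starProjection_apply_mem _ _
  have hvt : Tendsto v atTop (𝓝 w) := Submodule.starProjection_tendsto_self K hK w hd
  have hvn : ∀ n, ‖v n‖ ≤ ‖w‖ := fun n => Submodule.norm_starProjection_apply_le _ _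
  have hproj : ∀ n, ∀ f ∈ K n, ⟪f, w⟫_ℝ = ⟪f, v n⟫_ℝ := by
    intro n f hf
    have := Submodule.starProjection_inner_eq_zero (K := K n) w f hf
    rw [real_inner_comm, inner_sub_right] at this
    linarith
  set d : ℤ → H → ℝ := fun x f => ‖U x f - f‖ with hdef
  set δ : ℕ → ℝ := fun n => d (-n - 1) w + d (-n) w + d (n - 1) w + d n w with hδ
  -- The orthogonality relation tested with `v n`. On an interior bond, `U x (v n) - v n` is still
  -- in `K n`, so `w` may be replaced by `v n` and the Dirichlet form appears; on a boundary bond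
  -- the operator is moved on to `w`.
  have key : ∀ n : ℕ, 2 ≤ n →
      ‖v n‖ ^ 2 + c / 2 * ∑ x ∈ Finset.Icc (-(n : ℤ) + 1) (n - 2), d x (v n) ^ 2
        ≤ c * (‖w‖ * δ n) := by
    intro n hn
    have h0 := hw n (v n) (hvK n)
    rw [boxOp_apply, inner_sub_left, real_inner_smul_left, sum_inner, hproj n _ (hvK n),
      real_inner_self_eq_norm_sq] at h0
    have hdec : Finset.Icc (-(n : ℤ) - 1) n = Finset.Icc (-(n : ℤ) + 1) (n - 2) ∪
        {-(n : ℤ) - 1, -(n : ℤ), (n : ℤ) - 1, (n : ℤ)} := by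
      ext x
      simp only [Finset.mem_Icc, Finset.mem_union, Finset.mem_insert, Finset.mem_singleton]
      omega
    have hdis : Disjoint (Finset.Icc (-(n : ℤ) + 1) (n - 2))
        {-(n : ℤ) - 1, -(n : ℤ), (n : ℤ) - 1, (n : ℤ)} := by
      rw [Finset.disjoint_left]
      intro x
      simp only [Finset.mem_Icc, Finset.mem_insert, Finset.mem_singleton]
      omega
    have hb : ∀ x, ⟪U x (v n) - v n, w⟫_ℝ ≤ ‖w‖ * d x w := by
      intro x
      have : ⟪U x (v n) - v n, w⟫_ℝ = ⟪v n, U x w - w⟫_ℝ := by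
        rw [inner_sub_left, inner_sub_right, inner_involution (hU x)]
      rw [this]
      exact (real_inner_le_norm _ _).trans (mul_le_mul_of_nonneg_right (hvn n) (norm_nonneg _))
    have hi : ∑ x ∈ Finset.Icc (-(n : ℤ) + 1) (n - 2), ⟪U x (v n) - v n, w⟫_ℝ =
        -(1 / 2) * ∑ x ∈ Finset.Icc (-(n : ℤ) + 1) (n - 2), d x (v n) ^ 2 := by
      rw [Finset.mul_sum]
      refine Finset.sum_congr rfl fun x hx => ?_
      simp only [Finset.mem_Icc] at hx
      rw [hproj n _ ((K n).sub_mem (hin n x (by omega) (by omega) _ (hvK n)) (hvK n)),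
        inner_involution_sub (hU x), real_inner_self_eq_norm_sq]
    rw [hdec, Finset.sum_union hdis, hi, Finset.sum_insert, Finset.sum_insert, Finset.sum_insert,
      Finset.sum_singleton] at h0
    · have h1 := hb (-n - 1)
      have h2 := hb (-n)
      have h3 := hb (n - 1)
      have h4 := hb n
      have : c * (⟪U (-n - 1) (v n) - v n, w⟫_ℝ + (⟪U (-n) (v n) - v n, w⟫_ℝ +
        (⟪U (n - 1) (v n) - v n, w⟫_ℝ + ⟪U n (v n) - v n, w⟫_ℝ))) ≤ c * (‖w‖ * δ n) := by
        refine mul_le_mul_of_nonneg_left ?_ hc.le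
        rw [hδ]
        linarith
      linarith
    · simp
    · simp only [Finset.mem_insert, Finset.mem_singleton]; omega
    · simp only [Finset.mem_insert, Finset.mem_singleton]; omega
  have hd2 : ∀ x, d x w ≤ 2 * ‖w‖ := fun x => by
    have := norm_sub_le (U x w) w
    rw [(U x).norm_map] at this
    simp only [hdef]; linarith
  have hdt : ∀ x, Tendsto (fun n => d x (v n)) atTop (𝓝 (d x w)) := fun x =>
    ((((U x).continuous.tendsto w).comp hvt).sub hvt).norm
  -- First use of `key`, with the crude bound `δ n ≤ 8 ‖w‖`: for a fixed finite range of bonds, let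
  -- `n → ∞`.
  have hsum : ∀ m : ℕ, ∑ x ∈ Finset.Icc (-(m : ℤ) + 1) (m - 2), d x w ^ 2 ≤ 16 * ‖w‖ ^ 2 := by
    intro m
    refine le_of_tendsto (tendsto_finsetSum _ fun x _ => (hdt x).pow 2) ?_
    filter_upwards [eventually_ge_atTop (max m 2)] with n hn
    have h1 := key n (le_of_max_le_right hn)
    have h2 : ∑ x ∈ Finset.Icc (-(m : ℤ) + 1) (m - 2), d x (v n) ^ 2 ≤
        ∑ x ∈ Finset.Icc (-(n : ℤ) + 1) (n - 2), d x (v n) ^ 2 := by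
      refine Finset.sum_le_sum_of_subset_of_nonneg (fun x => ?_) fun _ _ _ => sq_nonneg _
      have := le_of_max_le_left hn
      simp only [Finset.mem_Icc]; omega
    have h3 : δ n ≤ 8 * ‖w‖ := by
      have h1 := hd2 (-n - 1)
      have h2 := hd2 (-n)
      have h3 := hd2 (n - 1)
      have h4 := hd2 n
      simp only [hδ]; linarith
    have h4 : c * (‖w‖ * δ n) ≤ c * (‖w‖ * (8 * ‖w‖)) := by gcongr
    have h5 : c / 2 * ∑ x ∈ Finset.Icc (-(n : ℤ) + 1) (n - 2), d x (v n) ^ 2 ≤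
        c / 2 * (16 * ‖w‖ ^ 2) := by nlinarith [sq_nonneg ‖v n‖]
    exact h2.trans (le_of_mul_le_mul_left h5 (by positivity))
  have hS : Summable fun x => d x w ^ 2 := by
    refine summable_of_sum_le (fun _ => sq_nonneg _) (c := 16 * ‖w‖ ^ 2) fun s => ?_
    refine le_trans (Finset.sum_le_sum_of_subset_of_nonneg (fun x hx => ?_)
      fun _ _ _ => sq_nonneg _) (hsum (∑ a ∈ s, a.natAbs + 2))
    have : x.natAbs ≤ ∑ a ∈ s, a.natAbs :=
      Finset.single_le_sum (f := fun a : ℤ => a.natAbs) (fun _ _ => Nat.zero_le _) hx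
    simp only [Finset.mem_Icc]
    omega
  -- Square summability over the bonds forces the increments at infinity, hence the boundary terms,
  -- to vanish.
  have h0 : Tendsto (fun x => d x w) cofinite (𝓝 0) := by
    have := hS.tendsto_cofinite_zero.sqrt
    rw [Real.sqrt_zero] at this
    refine this.congr fun x => Real.sqrt_sq (norm_nonneg _)
  have hcof : ∀ e : ℕ → ℤ, Function.Injective e → Tendsto (fun n => d (e n) w) atTop (𝓝 0) :=
    fun e he => by
      rw [← Nat.cofinite_eq_atTop]
      exact h0.comp he.tendsto_cofinite
  have hδ0 : Tendsto δ atTop (𝓝 0) := by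
    have := (((hcof (fun n => -n - 1) fun a b h => by simpa using h).add
      (hcof (fun n => -n) fun a b h => by simpa using h)).add
      (hcof (fun n => n - 1) fun a b h => by simpa using h)).add
      (hcof (fun n => n) fun a b h => by simpa using h)
    simpa using this
  -- Second use of `key`, now with `δ n → 0` and the Dirichlet form discarded.
  have hle : ‖w‖ ^ 2 ≤ c * (‖w‖ * 0) := by
    refine le_of_tendsto_of_tendsto (hvt.norm.pow 2) ((hδ0.const_mul ‖w‖).const_mul c) ?_
    filter_upwards [eventually_ge_atTop 2] with n hn
    refine le_trans ?_ (key n hn)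
    have : 0 ≤ ∑ x ∈ Finset.Icc (-(n : ℤ) + 1) (n - 2), d x (v n) ^ 2 :=
      Finset.sum_nonneg fun _ _ => sq_nonneg _
    have : 0 ≤ c / 2 * ∑ x ∈ Finset.Icc (-(n : ℤ) + 1) (n - 2), d x (v n) ^ 2 := by positivity
    linarith
  have : ‖w‖ ^ 2 = 0 := le_antisymm (by simpa using hle) (sq_nonneg _)
  simpa using this

/-- A subspace with trivial orthogonal complement is dense; the images of the `K n` increase by
`boxOp_eq_of_le`, so an element of their union comes from a single box. -/
theorem exists_boxOp_near [CompleteSpace H] (hU : ∀ x f, U x (U x f) = f)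
    [∀ n, (K n).HasOrthogonalProjection] (hK : Monotone K)
    (hd : ⊤ ≤ (⨆ n, K n).topologicalClosure)
    (hin : ∀ (n : ℕ) (x : ℤ), -n ≤ x - 1 → x + 2 ≤ n → ∀ f ∈ K n, U x f ∈ K n)
    (hout : ∀ (n : ℕ) (x : ℤ), x + 1 < -n ∨ n < x → ∀ f ∈ K n, U x f = f)
    {c : ℝ} (hc : 0 < c) (F : H) {ε : ℝ} (hε : 0 < ε) :
    ∃ n, ∃ f ∈ K n, ‖boxOp U c n f - F‖ < ε := by
  set R : ℕ → Submodule ℝ H := fun n => (K n).map (boxOp U c n) with hR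
  have hmono : Monotone R := by
    rintro m n h _ ⟨f, hf, rfl⟩
    exact ⟨f, hK h hf, boxOp_eq_of_le hout c h hf⟩
  have htop : (⨆ n, R n).topologicalClosure = ⊤ := by
    rw [Submodule.topologicalClosure_eq_top_iff, Submodule.eq_bot_iff]
    intro w hw
    refine orthogonal_boxOp_eq_zero hU hK hd hin hc fun n f hf => ?_
    exact (Submodule.mem_orthogonal _ _).1 hw _ (Submodule.mem_iSup_of_mem n ⟨f, hf, rfl⟩)
  have hF : F ∈ closure ((⨆ n, R n : Submodule ℝ H) : Set H) := by
    rw [← Submodule.topologicalClosure_coe, htop]; trivial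
  obtain ⟨g, hg, hgF⟩ := Metric.mem_closure_iff.1 hF ε hε
  obtain ⟨n, f, hf, rfl⟩ := (Submodule.mem_iSup_of_directed R hmono.directed_le).1 hg
  refine ⟨n, f, hf, ?_⟩
  rwa [dist_comm, dist_eq_norm] at hgF

end Hilbert

/-! ### Approximate local solutions of the resolvent equation -/

section Resolvent

open scoped InnerProductSpace

variable {ρ : ℝ}

theorem norm_toLp_sq {f : Config → ℝ} (hf : MemLp f 2 (stationaryMeasure ρ)) :
    ‖hf.toLp f‖ ^ 2 = ∫ η, f η ^ 2 ∂stationaryMeasure ρ := by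
  rw [← real_inner_self_eq_norm_sq, L2.inner_def]
  refine integral_congr_ae ?_
  filter_upwards [hf.coeFn_toLp] with η h
  rw [h, real_inner_self_eq_norm_sq, Real.norm_eq_abs, sq_abs]

/-- The classes in `L²` of the functions of the coordinates in `{-n, …, n}`. -/
noncomputable def boxToLp (ρ : ℝ) (n : ℕ) :
    ((Set.Icc (-(n : ℤ)) n → Bool) → ℝ) →ₗ[ℝ] Lp ℝ 2 (stationaryMeasure ρ) where
  toFun g := ((isLocal_of_dependsOn_Icc (f := g ∘ Set.domRestrict _)
    (dependsOn_iff_exists_comp.2 ⟨g, rfl⟩)).memLp (stationaryMeasure ρ) 2).toLp _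
  map_add' _ _ := rfl
  map_smul' _ _ := rfl

theorem mem_range_boxToLp {n : ℕ} {f : Config → ℝ} (hf : DependsOn f (Set.Icc (-(n : ℤ)) n)) :
    ((isLocal_of_dependsOn_Icc hf).memLp (stationaryMeasure ρ) 2).toLp f ∈
      LinearMap.range (boxToLp ρ n) := by
  obtain ⟨g, rfl⟩ := dependsOn_iff_exists_comp.1 hf
  exact ⟨g, rfl⟩

theorem exists_of_mem_range_boxToLp {n : ℕ} {v : Lp ℝ 2 (stationaryMeasure ρ)}
    (hv : v ∈ LinearMap.range (boxToLp ρ n)) :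
    ∃ (f : Config → ℝ) (hf : DependsOn f (Set.Icc (-(n : ℤ)) n)),
      v = ((isLocal_of_dependsOn_Icc hf).memLp (stationaryMeasure ρ) 2).toLp f := by
  obtain ⟨g, rfl⟩ := hv
  exact ⟨g ∘ Set.domRestrict _, dependsOn_iff_exists_comp.2 ⟨g, rfl⟩, rfl⟩

theorem range_boxToLp_mono : Monotone fun n => LinearMap.range (boxToLp ρ n) := by
  intro m n h v hv
  obtain ⟨f, hf, rfl⟩ := exists_of_mem_range_boxToLp hv
  exact mem_range_boxToLp (hf.mono (Set.Icc_subset_Icc (by omega) (by omega)))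

/-- A function orthogonal to all local functions integrates to zero over every measurable cylinder,
hence over every measurable set by a π-λ argument. -/
theorem topologicalClosure_iSup_range_boxToLp :
    (⨆ n, LinearMap.range (boxToLp ρ n)).topologicalClosure = ⊤ := by
  rw [Submodule.topologicalClosure_eq_top_iff, Submodule.eq_bot_iff]
  intro w hw
  have hint : Integrable w (stationaryMeasure ρ) := (Lp.memLp w).integrable (by norm_num)
  have hloc : ∀ t ∈ measurableCylinders fun _ : ℤ => Bool,
      ∫ η in t, w η ∂stationaryMeasure ρ = 0 := by
    intro t ht
    have hl := isLocal_indicator_of_mem_measurableCylinders ht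
    obtain ⟨n, -, hn⟩ := hl.exists_box 0
    have h := (Submodule.mem_orthogonal _ _).1 hw _
      (Submodule.mem_iSup_of_mem n (mem_range_boxToLp (ρ := ρ) hn))
    rw [L2.inner_def] at h
    rw [← integral_indicator (MeasurableSet.of_mem_measurableCylinders ht), ← h]
    refine integral_congr_ae ?_
    filter_upwards [(hl.memLp (stationaryMeasure ρ) 2).coeFn_toLp] with η hη
    rw [hη]
    by_cases hm : η ∈ t <;> simp [hm]
  have hall : ∀ s, MeasurableSet s → ∫ η in s, w η ∂stationaryMeasure ρ = 0 := by
    intro s hs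
    induction s, hs using MeasurableSpace.induction_on_inter
      (generateFrom_measurableCylinders (α := fun _ : ℤ => Bool)).symm
      isPiSystem_measurableCylinders with
    | empty => simp
    | basic t ht => exact hloc t ht
    | compl t ht ih =>
      have hu := hloc Set.univ (univ_mem_measurableCylinders _)
      rw [setIntegral_univ] at hu
      have := integral_add_compl ht hint
      linarith
    | iUnion f hd hm ih =>
      rw [integral_iUnion hm hd hint.integrableOn]
      simp [ih]
  have h0 := Lp.ae_eq_zero_of_forall_setIntegral_eq_zero w (by norm_num) (by norm_num)
    (fun s _ _ => hint.integrableOn) fun s hs _ => hall s hs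
  exact (Lp.eq_zero_iff_ae_eq_zero).2 h0

/-- Composition with `exchange x`, as an isometry of `L²`. -/
noncomputable def exchangeLp (hρ : 1 / 2 < ρ) (hρ' : ρ < 1) (x : ℤ) :
    Lp ℝ 2 (stationaryMeasure ρ) →ₗᵢ[ℝ] Lp ℝ 2 (stationaryMeasure ρ) :=
  Lp.compMeasurePreservingₗᵢ ℝ (exchange x) (measurePreserving_exchange hρ hρ' x)

theorem exchangeLp_toLp (hρ : 1 / 2 < ρ) (hρ' : ρ < 1) (x : ℤ) {f : Config → ℝ}
    (hf : IsLocal f) : exchangeLp hρ hρ' x ((hf.memLp (stationaryMeasure ρ) 2).toLp f) =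
      ((hf.comp_exchange x).memLp (stationaryMeasure ρ) 2).toLp _ := by
  exact Lp.toLp_compMeasurePreserving _ _

theorem exchangeLp_exchangeLp (hρ : 1 / 2 < ρ) (hρ' : ρ < 1) (x : ℤ)
    (v : Lp ℝ 2 (stationaryMeasure ρ)) :
    exchangeLp hρ hρ' x (exchangeLp hρ hρ' x v) = v := by
  have h := Lp.compMeasurePreserving_comp_apply v (measurePreserving_exchange hρ hρ' x)
    (measurePreserving_exchange hρ hρ' x)
  have e : exchange x ∘ exchange x = id := funext fun η => exchange_exchange x η
  refine h.symm.trans ?_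
  simp only [e]
  exact Lp.compMeasurePreserving_id_apply v

/-- The range of `1 - generator` on local functions is dense in `L²`. -/
theorem exists_resolvent_near (hρ : 1 / 2 < ρ) (hρ' : ρ < 1) {p : ℝ} (hp : 0 < p)
    {F : Config → ℝ} (hF : IsLocal F) {ε : ℝ} (hε : 0 < ε) :
    ∃ u, IsLocal u ∧
      ∫ η, (u η - generator p p u η - F η) ^ 2 ∂stationaryMeasure ρ < ε ^ 2 := by
  obtain ⟨n, v, hv, hvF⟩ := exists_boxOp_near (U := exchangeLp hρ hρ')
    (K := fun n => LinearMap.range (boxToLp ρ n)) (exchangeLp_exchangeLp hρ hρ')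
    range_boxToLp_mono topologicalClosure_iSup_range_boxToLp.ge
    (by
      intro n x h1 h2 v hv
      obtain ⟨f, hf, rfl⟩ := exists_of_mem_range_boxToLp hv
      rw [exchangeLp_toLp hρ hρ' x (isLocal_of_dependsOn_Icc hf)]
      exact mem_range_boxToLp (dependsOn_comp_exchange hf h1 h2))
    (by
      intro n x h v hv
      obtain ⟨f, hf, rfl⟩ := exists_of_mem_range_boxToLp hv
      rw [exchangeLp_toLp hρ hρ' x (isLocal_of_dependsOn_Icc hf)]
      congr 1
      ext η
      exact comp_exchange_of_notMem hf h η)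
    hp ((hF.memLp (stationaryMeasure ρ) 2).toLp F) hε
  obtain ⟨u, hu, rfl⟩ := exists_of_mem_range_boxToLp hv
  have hul := isLocal_of_dependsOn_Icc hu
  refine ⟨u, hul, ?_⟩
  have hloc : IsLocal (u - generator p p u - F) := (hul.sub (hul.generator p p)).sub hF
  have e : boxOp (exchangeLp hρ hρ') p n ((hul.memLp (stationaryMeasure ρ) 2).toLp u) -
      (hF.memLp (stationaryMeasure ρ) 2).toLp F = (hloc.memLp (stationaryMeasure ρ) 2).toLp _ := by
    rw [boxOp_apply]
    simp only [exchangeLp_toLp hρ hρ' _ hul]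
    have hs : ∀ s : Finset ℤ, ∑ x ∈ s,
        (((hul.comp_exchange x).memLp (stationaryMeasure ρ) 2).toLp _ -
          (hul.memLp (stationaryMeasure ρ) 2).toLp u) =
        ((IsLocal.sum (f := fun x η => u (exchange x η) - u η) s
          fun x _ => (hul.comp_exchange x).sub hul).memLp (stationaryMeasure ρ) 2).toLp _ := by
      intro s
      classical
      induction s using Finset.induction_on with
      | empty => simp
      | insert a s ha ih =>
        rw [Finset.sum_insert ha, ih]
        simp only [Finset.sum_insert ha]
        rfl
    rw [hs, ← MemLp.toLp_const_smul, ← MemLp.toLp_sub, ← MemLp.toLp_sub]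
    -- The generator is the sum of exchanges only on ergodic configurations, which suffices in `L²`.
    rw [MemLp.toLp_eq_toLp_iff]
    filter_upwards [ae_ergodic hρ hρ'] with η hη
    simp only [Pi.sub_apply, Pi.smul_apply, smul_eq_mul, Finset.sum_apply]
    rw [generator_eq_sum_exchange hu hη]
  rw [e] at hvF
  have := norm_toLp_sq (hloc.memLp (stationaryMeasure ρ) 2)
  simp only [Pi.sub_apply] at this
  rw [← this]
  exact pow_lt_pow_left₀ hvF (norm_nonneg _) (by norm_num)

theorem integral_mul_le_sqrt {α : Type*} [MeasurableSpace α] {μ : Measure α} {f g : α → ℝ}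
    (hf : MemLp f 2 μ) (hg : MemLp g 2 μ) :
    ∫ a, f a * g a ∂μ ≤ √(∫ a, f a ^ 2 ∂μ) * √(∫ a, g a ^ 2 ∂μ) := by
  have h := real_inner_le_norm (hf.toLp f) (hg.toLp g)
  have n : ∀ {f : α → ℝ} (hf : MemLp f 2 μ), ‖hf.toLp f‖ = √(∫ a, f a ^ 2 ∂μ) := by
    intro f hf
    rw [← Real.sqrt_sq (norm_nonneg (hf.toLp f)), ← real_inner_self_eq_norm_sq, L2.inner_def]
    congr 1
    refine integral_congr_ae ?_
    filter_upwards [hf.coeFn_toLp] with η h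
    rw [h, real_inner_self_eq_norm_sq, Real.norm_eq_abs, sq_abs]
  rw [n hf, n hg, L2.inner_def] at h
  refine le_trans (le_of_eq (integral_congr_ae ?_)) h
  filter_upwards [hf.coeFn_toLp, hg.coeFn_toLp] with η h h'
  rw [h, h']
  simp [mul_comm]

/-- The Dirichlet form of the exchange at `x`, up to a factor two. -/
noncomputable def energy (ρ : ℝ) (x : ℤ) (u : Config → ℝ) : ℝ :=
  ∫ η, (u (exchange x η) - u η) ^ 2 ∂stationaryMeasure ρ

theorem energy_nonneg (x : ℤ) (u : Config → ℝ) : 0 ≤ energy ρ x u :=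
  integral_nonneg fun _ => sq_nonneg _

theorem integral_exchange_sub_mul (hρ : 1 / 2 < ρ) (hρ' : ρ < 1) {f u : Config → ℝ}
    (hf : IsLocal f) (hu : IsLocal u) (x : ℤ) :
    ∫ η, (f (exchange x η) - f η) * u η ∂stationaryMeasure ρ = -(1 / 2) *
      ∫ η, (f (exchange x η) - f η) * (u (exchange x η) - u η) ∂stationaryMeasure ρ := by
  have h1 := integral_comp_exchange hρ hρ' (hf.mul hu) x
  have h2 := integral_comp_exchange hρ hρ' ((hf.comp_exchange x).mul hu) x
  simp only [exchange_exchange] at h1 h2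
  have l1 := (hf.comp_exchange x).mul hu
  have l2 := hf.mul hu
  have l3 := (hf.comp_exchange x).mul (hu.comp_exchange x)
  have l4 := hf.mul (hu.comp_exchange x)
  have e1 : ∫ η, (f (exchange x η) - f η) * u η ∂stationaryMeasure ρ =
      ∫ η, f (exchange x η) * u η ∂stationaryMeasure ρ - ∫ η, f η * u η ∂stationaryMeasure ρ := by
    rw [← integral_sub (l1.integrable _) (l2.integrable _)]
    exact integral_congr_ae (.of_forall fun η => by ring)
  have e2 : ∫ η, (f (exchange x η) - f η) * (u (exchange x η) - u η) ∂stationaryMeasure ρ =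
      (∫ η, f (exchange x η) * u (exchange x η) ∂stationaryMeasure ρ -
        ∫ η, f (exchange x η) * u η ∂stationaryMeasure ρ) -
      (∫ η, f η * u (exchange x η) ∂stationaryMeasure ρ - ∫ η, f η * u η ∂stationaryMeasure ρ) := by
    rw [← integral_sub (l3.integrable _) (l1.integrable _),
      ← integral_sub (l4.integrable _) (l2.integrable _),
      ← integral_sub ((l3.sub l1).integrable _) ((l4.sub l2).integrable _)]
    exact integral_congr_ae (.of_forall fun η => by ring)
  rw [e1, e2]
  linarith

/-- Reversibility: for `u = f` the right side is `-(p / 2)` times a sum of energies, so the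
generator is dissipative. -/
theorem integral_generator_mul (hρ : 1 / 2 < ρ) (hρ' : ρ < 1) {p : ℝ} {f u : Config → ℝ}
    {a b : ℤ} (hf : DependsOn f (Set.Icc a b)) (hu : IsLocal u) :
    ∫ η, generator p p f η * u η ∂stationaryMeasure ρ = -(p / 2) *
      ∑ x ∈ Finset.Icc (a - 1) b, ∫ η, (f (exchange x η) - f η) * (u (exchange x η) - u η)
        ∂stationaryMeasure ρ := by
  have hfl := isLocal_of_dependsOn_Icc hf
  have e : ∫ η, generator p p f η * u η ∂stationaryMeasure ρ =
      ∫ η, p * ∑ x ∈ Finset.Icc (a - 1) b, (f (exchange x η) - f η) * u η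
        ∂stationaryMeasure ρ := by
    refine integral_congr_ae ?_
    filter_upwards [ae_ergodic hρ hρ'] with η hη
    rw [generator_eq_sum_exchange hf hη, mul_assoc, Finset.sum_mul]
  rw [e, integral_const_mul, integral_finsetSum _ fun x _ =>
    (((hfl.comp_exchange x).sub hfl).mul hu).integrable _]
  simp only [integral_exchange_sub_mul hρ hρ' hfl hu]
  rw [← Finset.mul_sum]
  ring

theorem integral_generator (hρ : 1 / 2 < ρ) (hρ' : ρ < 1) {p : ℝ} {f : Config → ℝ}
    (hf : IsLocal f) : ∫ η, generator p p f η ∂stationaryMeasure ρ = 0 := by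
  obtain ⟨n, -, hn⟩ := hf.exists_box 0
  have := integral_generator_mul (p := p) hρ hρ' hn (isLocal_const 1)
  simpa using this

/-- If `F` is controlled by the Dirichlet form, then the approximate solutions `u` of
`u - generator u = F` are small. -/
theorem exists_small_resolvent (hρ : 1 / 2 < ρ) (hρ' : ρ < 1) {p : ℝ} (hp : 0 < p)
    {F : Config → ℝ} (hF : IsLocal F) {κ : ℝ} (hκ : 0 ≤ κ) (B : Finset ℤ)
    (hFκ : ∀ u, IsLocal u →
      ∫ η, F η * u η ∂stationaryMeasure ρ ≤ κ * √(∑ x ∈ B, energy ρ x u))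
    {ε : ℝ} (hε : 0 < ε) :
    ∃ u, IsLocal u ∧
      √(∫ η, (u η - generator p p u η - F η) ^ 2 ∂stationaryMeasure ρ) ≤ ε ∧
      √(∫ η, u η ^ 2 ∂stationaryMeasure ρ) ≤ ε + κ / √p := by
  obtain ⟨u, hu, hs⟩ := exists_resolvent_near hρ hρ' hp hF hε
  refine ⟨u, hu, Real.sqrt_le_iff.2 ⟨hε.le, hs.le⟩, ?_⟩
  obtain ⟨n, -, hn⟩ := hu.exists_box 0
  set S := ∑ x ∈ Finset.Icc (-(n : ℤ) - 1) n, energy ρ x u with hS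
  have hSn : 0 ≤ S := Finset.sum_nonneg fun x _ => energy_nonneg x u
  have hB : ∑ x ∈ B, energy ρ x u ≤ S := by
    -- Bonds outside the box of `u` carry no energy, so the sum over `B` is dominated by the full
    -- Dirichlet form whatever `B` is.
    have h0 : ∀ x ∉ Finset.Icc (-(n : ℤ) - 1) n, energy ρ x u = 0 := by
      intro x hx
      have : x + 1 < -(n : ℤ) ∨ (n : ℤ) < x := by simp only [Finset.mem_Icc] at hx; omega
      simp [energy, comp_exchange_of_notMem hn this]
    classical
    calc ∑ x ∈ B, energy ρ x u = ∑ x ∈ B ∩ Finset.Icc (-(n : ℤ) - 1) n, energy ρ x u := by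
          symm
          refine Finset.sum_subset Finset.inter_subset_left fun x hx hx' => h0 x fun h => ?_
          exact hx' (Finset.mem_inter.2 ⟨hx, h⟩)
      _ ≤ S := Finset.sum_le_sum_of_subset_of_nonneg Finset.inter_subset_right
          fun x _ _ => energy_nonneg x u
  set e : Config → ℝ := u - generator p p u - F with he
  have hel : IsLocal e := (hu.sub (hu.generator p p)).sub hF
  set I := ∫ η, u η ^ 2 ∂stationaryMeasure ρ with hI
  have hI0 : 0 ≤ I := integral_nonneg fun _ => sq_nonneg _
  -- Energy identity: the approximate equation is paired with `u`.
  have h1 : ∫ η, e η * u η ∂stationaryMeasure ρ + ∫ η, F η * u η ∂stationaryMeasure ρ =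
      I - ∫ η, generator p p u η * u η ∂stationaryMeasure ρ := by
    rw [hI, ← integral_add ((hel.mul hu).integrable _) ((hF.mul hu).integrable _),
      ← integral_sub ((hu.map₂ hu fun a _ => a ^ 2).integrable _)
        (((hu.generator p p).mul hu).integrable _)]
    refine integral_congr_ae (.of_forall fun η => ?_)
    simp only [he, Pi.sub_apply]
    ring
  rw [integral_generator_mul hρ hρ' hn hu] at h1
  simp only [← sq] at h1
  change _ = I - -(p / 2) * S at h1
  have h2 := hFκ u hu
  have h3 := integral_mul_le_sqrt (hel.memLp (stationaryMeasure ρ) 2)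
    (hu.memLp (stationaryMeasure ρ) 2)
  have h4 : √(∫ η, e η ^ 2 ∂stationaryMeasure ρ) ≤ ε := Real.sqrt_le_iff.2 ⟨hε.le, hs.le⟩
  have h5 : κ * √(∑ x ∈ B, energy ρ x u) ≤ κ * √S := by gcongr
  have h6 : √(∫ η, e η ^ 2 ∂stationaryMeasure ρ) * √I ≤ ε * √I := by gcongr
  set a := √I
  have ha : a ^ 2 = I := Real.sq_sqrt hI0
  have ha0 : 0 ≤ a := Real.sqrt_nonneg _
  set s := √S
  have hs2 : s ^ 2 = S := Real.sq_sqrt hSn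
  set q := √p
  have hq : q ^ 2 = p := Real.sq_sqrt hp.le
  have hq0 : 0 < q := Real.sqrt_pos.2 hp
  set k := κ / q
  have hk : κ = k * q := by simp only [k]; field_simp
  have hk0 : 0 ≤ k := by positivity
  have h7 : a ^ 2 + q ^ 2 / 2 * s ^ 2 ≤ ε * a + k * q * s := by
    rw [ha, hs2, hq, ← hk]
    linarith
  -- Young's inequality absorbs `k q s` into the Dirichlet form, leaving a quadratic inequality
  -- which gives `a ≤ ε + k`.
  have h8 : a ^ 2 ≤ ε * a + k ^ 2 := by nlinarith [sq_nonneg (q * s - k)]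
  by_contra! hlt
  nlinarith [mul_nonneg hk0 hε.le]

end Resolvent

/-! ### Path regularity, joint measurability and consequences of the martingale problem -/

section Trajectory

variable {Ω : Type*} [MeasurableSpace Ω] {P : Measure Ω} {p q : ℝ}
  {μ₀ : Measure Config} {η : ℝ≥0 → Ω → Config}

theorem tendsto_floor_add_one_div (s : ℝ) :
    Tendsto (fun k : ℕ => ((⌊s * (k + 1)⌋ : ℝ) + 1) / (k + 1)) atTop (𝓝[≥] s) := by
  have hpos : ∀ k : ℕ, (0 : ℝ) < k + 1 := fun k => by positivity
  have hge : ∀ k : ℕ, s ≤ ((⌊s * (k + 1)⌋ : ℝ) + 1) / (k + 1) := fun k => by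
    rw [le_div_iff₀ (hpos k)]
    exact (Int.lt_floor_add_one _).le
  refine tendsto_nhdsWithin_iff.2 ⟨?_, .of_forall hge⟩
  refine tendsto_of_tendsto_of_tendsto_of_le_of_le tendsto_const_nhds
    (h := fun k : ℕ => s + 1 / ((k : ℝ) + 1)) ?_ hge fun k => ?_
  · have := (tendsto_one_div_add_atTop_nhds_zero_nat (𝕜 := ℝ)).const_add s
    simpa using this
  · have h1 : ((k : ℝ) + 1) ≠ 0 := (hpos k).ne'
    change _ ≤ s + 1 / ((k : ℝ) + 1)
    rw [show s + 1 / ((k : ℝ) + 1) = (s * (k + 1) + 1) / (k + 1) by field_simp]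
    gcongr
    exact Int.floor_le _

theorem IsProcess.path_right_continuous (h : IsProcess P p q μ₀ η) {f : Config → ℝ}
    (hf : IsLocal f) (ω : Ω) (s : ℝ) :
    ContinuousWithinAt (fun s : ℝ => f (η s.toNNReal ω)) (Set.Ici s) s := by
  have h1 : ContinuousWithinAt (fun s : ℝ => η s.toNNReal ω) (Set.Ici s) s :=
    (h.right_continuous ω s.toNNReal).comp continuous_real_toNNReal.continuousWithinAt
      fun x hx => Real.toNNReal_le_toNNReal hx
  exact hf.continuous.continuousAt.comp_continuousWithinAt h1

theorem IsProcess.measurable_marginal (h : IsProcess P p q μ₀ η) {f : Config → ℝ}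
    (hf : IsLocal f) (s : ℝ) : Measurable fun ω => f (η s.toNNReal ω) :=
  hf.measurable.comp (h.measurable _)

/-- Times are rounded up to a grid of mesh `1 / (k + 1)`, where measurability is a countable matter;
right continuity gives the limit. Rounding must be from above since there is no left continuity. -/
theorem IsProcess.measurable_uncurry (h : IsProcess P p q μ₀ η) {f : Config → ℝ}
    (hf : IsLocal f) : Measurable fun z : ℝ × Ω => f (η z.1.toNNReal z.2) := by
  refine measurable_of_tendsto_metrizable (f := fun (k : ℕ) (z : ℝ × Ω) =>
    f (η (((⌊z.1 * (k + 1)⌋ : ℝ) + 1) / (k + 1)).toNNReal z.2)) (fun k => ?_) ?_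
  · have h1 : Measurable fun z : Ω × ℤ => f (η (((z.2 : ℝ) + 1) / (k + 1)).toNNReal z.1) :=
      measurable_from_prod_countable_left fun j =>
        h.measurable_marginal hf (((j : ℝ) + 1) / (k + 1))
    have h2 : Measurable fun z : ℝ × Ω => (z.2, ⌊z.1 * ((k : ℝ) + 1)⌋) :=
      measurable_snd.prodMk (Int.measurable_floor.comp (measurable_fst.mul_const _))
    exact h1.comp h2
  · rw [tendsto_pi_nhds]
    rintro ⟨s, ω⟩
    have := (h.path_right_continuous hf ω s).tendsto.comp (tendsto_floor_add_one_div s)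
    exact this

theorem IsProcess.measurable_path (h : IsProcess P p q μ₀ η) {f : Config → ℝ}
    (hf : IsLocal f) (ω : Ω) : Measurable fun s : ℝ => f (η s.toNNReal ω) :=
  (h.measurable_uncurry hf).comp (measurable_id.prodMk measurable_const)

theorem IsProcess.intervalIntegrable (h : IsProcess P p q μ₀ η) {f : Config → ℝ}
    (hf : IsLocal f) (ω : Ω) (a b : ℝ) :
    IntervalIntegrable (fun s : ℝ => f (η s.toNNReal ω)) volume a b := by
  obtain ⟨M, -, hM⟩ := hf.bounded
  refine (intervalIntegrable_const (c := M)).mono_fun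
    (h.measurable_path hf ω).aestronglyMeasurable (.of_forall fun s => ?_)
  exact (hM _).trans (le_abs_self M)

theorem IsProcess.measurable_integral (h : IsProcess P p q μ₀ η) {f : Config → ℝ}
    (hf : IsLocal f) (a b : ℝ) : Measurable fun ω => ∫ s in a..b, f (η s.toNNReal ω) := by
  have hm : StronglyMeasurable fun z : Ω × ℝ => f (η z.2.toNNReal z.1) :=
    ((h.measurable_uncurry hf).comp measurable_swap).stronglyMeasurable
  simp only [intervalIntegral]
  exact (hm.integral_prod_right (ν := volume.restrict (Set.Ioc a b))).measurable.sub
    (hm.integral_prod_right (ν := volume.restrict (Set.Ioc b a))).measurable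

/-- The square of `∫ s in r..t` is differentiated in `r`. The path is only right continuous, so the
fundamental theorem of calculus is used in its version for right derivatives. -/
theorem IsProcess.sq_integral_eq (h : IsProcess P p q μ₀ η) {F : Config → ℝ}
    (hF : IsLocal F) {t : ℝ} (ht : 0 ≤ t) (ω : Ω) :
    (∫ s in (0 : ℝ)..t, F (η s.toNNReal ω)) ^ 2 =
      2 * ∫ r in (0 : ℝ)..t, F (η r.toNNReal ω) * ∫ s in r..t, F (η s.toNNReal ω) := by
  set φ : ℝ → ℝ := fun s => F (η s.toNNReal ω) with hφ
  have hi : ∀ a b, IntervalIntegrable φ volume a b := h.intervalIntegrable hF ω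
  have hcont : ContinuousOn (fun r => ∫ s in r..t, φ s) (Set.uIcc 0 t) :=
    intervalIntegral.continuousOn_primitive_interval_left
      ((intervalIntegrable_iff_integrableOn_Icc_of_le ht).1 (hi 0 t) |>.mono_set (by
        rw [Set.uIcc_of_le ht]))
  have hderiv : ∀ x, HasDerivWithinAt (fun r => (∫ s in r..t, φ s) ^ 2)
      (2 * (∫ s in x..t, φ s) * (-φ x)) (Set.Ioi x) x := by
    intro x
    have h1 : HasDerivWithinAt (fun r => ∫ s in r..t, φ s) (-φ x) (Set.Ici x) x :=
      intervalIntegral.integral_hasDerivWithinAt_left (hi x t)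
        ((h.measurable_path hF ω).stronglyMeasurable.stronglyMeasurableAtFilter)
        ((h.path_right_continuous hF ω x).mono Set.Ioi_subset_Ici_self)
    have h2 := (h1.mono Set.Ioi_subset_Ici_self).pow 2
    convert! h2 using 1
    simp
  have hint : IntervalIntegrable (fun r => φ r * ∫ s in r..t, φ s) volume 0 t :=
    (hi 0 t).mul_continuousOn hcont
  have := intervalIntegral.integral_eq_sub_of_hasDeriv_right (hcont.pow 2)
    (fun x _ => hderiv x) (by
      refine (hint.const_mul (-2)).congr ?_
      exact fun r _ => by ring)
  rw [← intervalIntegral.integral_const_mul]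
  have e : ∀ y, 2 * (∫ s in y..t, φ s) * -φ y = -(2 * (φ y * ∫ s in y..t, φ s)) := fun y => by ring
  simp only [e, intervalIntegral.integral_neg, Pi.pow_apply, intervalIntegral.integral_same] at this
  linarith

variable [IsProbabilityMeasure P]

theorem IsProcess.memLp_integral (h : IsProcess P p q μ₀ η) {f : Config → ℝ}
    (hf : IsLocal f) (a b : ℝ) (r : ℝ≥0∞) :
    MemLp (fun ω => ∫ s in a..b, f (η s.toNNReal ω)) r P := by
  obtain ⟨M, -, hM⟩ := hf.bounded
  exact MemLp.of_bound (h.measurable_integral hf a b).aestronglyMeasurable (M * |b - a|)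
    (.of_forall fun ω => intervalIntegral.norm_integral_le_of_norm_le_const
      (f := fun s => f (η s.toNNReal ω)) fun s _ => hM _)

theorem IsProcess.memLp_marginal (h : IsProcess P p q μ₀ η) {f : Config → ℝ}
    (hf : IsLocal f) (s : ℝ) (r : ℝ≥0∞) : MemLp (fun ω => f (η s.toNNReal ω)) r P := by
  obtain ⟨M, -, hM⟩ := hf.bounded
  exact MemLp.of_bound (h.measurable_marginal hf s).aestronglyMeasurable M (.of_forall fun _ => hM _)

theorem IsProcess.integrable_mul (h : IsProcess P p q μ₀ η) {f g : Config → ℝ}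
    (hf : IsLocal f) (hg : IsLocal g) (r s : ℝ) :
    Integrable (fun ω => f (η r.toNNReal ω) * g (η s.toNNReal ω)) P :=
  (h.memLp_marginal hf r 2).integrable_mul (h.memLp_marginal hg s 2)

theorem IsProcess.integrable_mul_integral (h : IsProcess P p q μ₀ η) {f g : Config → ℝ}
    (hf : IsLocal f) (hg : IsLocal g) (r a b : ℝ) :
    Integrable (fun ω => f (η r.toNNReal ω) * ∫ s in a..b, g (η s.toNNReal ω)) P :=
  (h.memLp_marginal hf r 2).integrable_mul (h.memLp_integral hg a b 2)

theorem integrable_prod_of_bound {a b M : ℝ} {F : ℝ → Ω → ℝ} (hF : Measurable (Function.uncurry F))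
    (hM : ∀ s ω, s ∈ Set.uIoc a b → |F s ω| ≤ M) :
    Integrable (Function.uncurry F) ((volume.restrict (Set.uIoc a b)).prod P) := by
  have : IsFiniteMeasure ((volume : Measure ℝ).restrict (Set.uIoc a b)) :=
    ⟨by rw [Measure.restrict_apply_univ, Set.uIoc]; exact measure_Ioc_lt_top⟩
  refine Integrable.of_bound hF.aestronglyMeasurable M ?_
  rw [Measure.ae_prod_iff_ae_ae]
  · filter_upwards [ae_restrict_mem measurableSet_uIoc] with s hs
    exact .of_forall fun ω => hM s ω hs
  · exact measurableSet_le hF.norm measurable_const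

theorem IsProcess.integral_mul_integral (h : IsProcess P p q μ₀ η) {f g : Config → ℝ}
    (hf : IsLocal f) (hg : IsLocal g) (r a b : ℝ) :
    ∫ ω, f (η r.toNNReal ω) * (∫ s in a..b, g (η s.toNNReal ω)) ∂P =
      ∫ s in a..b, ∫ ω, f (η r.toNNReal ω) * g (η s.toNNReal ω) ∂P := by
  obtain ⟨M, hM0, hM⟩ := hf.bounded
  obtain ⟨M', -, hM'⟩ := hg.bounded
  rw [intervalIntegral_integral_swap (f := fun s ω => f (η r.toNNReal ω) * g (η s.toNNReal ω))]
  · simp only [intervalIntegral.integral_const_mul]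
  · refine integrable_prod_of_bound (M := M * M') ?_ fun s ω _ => ?_
    · exact ((h.measurable_marginal hf r).comp measurable_snd).mul (h.measurable_uncurry hg)
    · rw [abs_mul]
      exact mul_le_mul (hM _) (hM' _) (abs_nonneg _) hM0

/-- A bounded function of the configuration at time `r` is measurable with respect to the past at
`r`, hence uncorrelated with the increment of the martingale of `u` after `r`. -/
theorem IsProcess.integral_mul_martingale (h : IsProcess P p q μ₀ η) {f u : Config → ℝ}
    (hf : IsLocal f) (hu : IsLocal u) {r t : ℝ} (hr : 0 ≤ r) (hrt : r ≤ t) :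
    ∫ ω, f (η r.toNNReal ω) * (∫ s in r..t, generator p q u (η s.toNNReal ω)) ∂P =
      ∫ ω, f (η r.toNNReal ω) * u (η t.toNNReal ω) ∂P -
        ∫ ω, f (η r.toNNReal ω) * u (η r.toNNReal ω) ∂P := by
  have hL := hu.generator p q
  have hM := h.martingale u hu
  set ℱ := Filtration.natural η fun t => (h.measurable t).stronglyMeasurable
  set M : ℝ≥0 → Ω → ℝ := fun t ω => u (η t ω) - u (η 0 ω)
        - ∫ s in (0 : ℝ)..t, generator p q u (η s.toNNReal ω) with hMdef
  have hle : r.toNNReal ≤ t.toNNReal := Real.toNNReal_le_toNNReal hrt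
  obtain ⟨C, -, hC⟩ := hf.bounded
  have hfm : StronglyMeasurable[ℱ r.toNNReal] fun ω => f (η r.toNNReal ω) :=
    hf.continuous.comp_stronglyMeasurable (Filtration.stronglyAdapted_natural _ r.toNNReal)
  have hce := condExp_stronglyMeasurable_mul_of_bound (ℱ.le r.toNNReal) hfm
    (hM.integrable t.toNNReal) C (.of_forall fun ω => hC _)
  have heq : ∫ ω, f (η r.toNNReal ω) * M t.toNNReal ω ∂P =
      ∫ ω, f (η r.toNNReal ω) * M r.toNNReal ω ∂P := by
    rw [← integral_condExp (ℱ.le r.toNNReal)]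
    refine integral_congr_ae (hce.trans ?_)
    filter_upwards [hM.2 _ _ hle] with ω hω
    simp only [Pi.mul_apply]
    rw [hω]
  have hi : ∀ s, Integrable (fun ω => f (η r.toNNReal ω) * M s ω) P := fun s =>
    (hM.integrable s).bdd_mul (h.measurable_marginal hf r).aestronglyMeasurable
      (.of_forall fun ω => hC _)
  rw [← sub_eq_zero, ← integral_sub (hi _) (hi _)] at heq
  rw [← integral_sub' (h.integrable_mul hf hu r t) (h.integrable_mul hf hu r r), ← sub_eq_zero,
    ← integral_sub (h.integrable_mul_integral hf hL r r t)
      ((h.integrable_mul hf hu r t).sub (h.integrable_mul hf hu r r)), ← neg_eq_zero,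
    ← integral_neg, ← heq]
  refine integral_congr_ae (.of_forall fun ω => ?_)
  have hsub := intervalIntegral.integral_interval_sub_left (h.intervalIntegrable hL ω 0 t)
    (h.intervalIntegrable hL ω 0 r)
  simp only [hMdef, Pi.sub_apply]
  rw [← hsub, Real.coe_toNNReal r hr, Real.coe_toNNReal t (hr.trans hrt)]
  ring

/-- The law at time `t` evolves according to the forward equation. -/
theorem IsProcess.forward_equation (h : IsProcess P p q μ₀ η) {u : Config → ℝ}
    (hu : IsLocal u) {r t : ℝ} (hr : 0 ≤ r) (hrt : r ≤ t) :
    ∫ ω, u (η t.toNNReal ω) ∂P - ∫ ω, u (η r.toNNReal ω) ∂P =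
      ∫ s in r..t, ∫ ω, generator p q u (η s.toNNReal ω) ∂P := by
  have h1 := h.integral_mul_martingale (isLocal_const 1) hu hr hrt
  have h2 := h.integral_mul_integral (isLocal_const 1) (hu.generator p q) r r t
  simp only [one_mul] at h1 h2
  rw [← h1, h2]

end Trajectory

/-! ### Invariance of the stationary measure for every solution of the martingale problem -/

section Stationarity

variable {ρ : ℝ} {Ω : Type*} [MeasurableSpace Ω] {P : Measure Ω} [IsProbabilityMeasure P] {p : ℝ}
  {μ₀ : Measure Config} {η : ℝ≥0 → Ω → Config}

/-- The forward equation is iterated `k` times. Since `generator f` has stationary mean zero, the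
defect for `f` is the time integral of the defect for `generator f`. Each application costs a factor
`16 p (m + 1)` and widens the box by two sites on each side, that is `m` by one; the product of
these factors against the `1 / k!` of the iterated integrals is the binomial coefficient. -/
theorem IsProcess.abs_integral_sub_le (hρ : 1 / 2 < ρ) (hρ' : ρ < 1) (hp : 0 ≤ p)
    (h : IsProcess P p p μ₀ η) {r : ℝ} (hr : 0 ≤ r)
    (hst : ∀ f, IsLocal f → ∫ ω, f (η r.toNNReal ω) ∂P = ∫ ζ, f ζ ∂stationaryMeasure ρ) (k : ℕ) :
    ∀ (m : ℕ) (f : Config → ℝ) (M : ℝ), DependsOn f (Set.Icc (-((2 * m : ℕ) : ℤ)) (2 * m : ℕ)) →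
      (∀ ζ, |f ζ| ≤ M) → ∀ s, r ≤ s →
      |∫ ω, f (η s.toNNReal ω) ∂P - ∫ ζ, f ζ ∂stationaryMeasure ρ| ≤
        2 * M * (16 * p * (s - r)) ^ k * ((m + k).choose k : ℝ) := by
  induction k with
  | zero =>
    intro m f M hf hM s _
    have h1 : |∫ ω, f (η s.toNNReal ω) ∂P| ≤ M := by
      have := norm_integral_le_of_norm_le_const (μ := P) (f := fun ω => f (η s.toNNReal ω))
        (.of_forall fun ω => hM _)
      simpa using this
    have h2 : |∫ ζ, f ζ ∂stationaryMeasure ρ| ≤ M := by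
      have := norm_integral_le_of_norm_le_const (μ := stationaryMeasure ρ) (f := f)
        (.of_forall hM)
      simpa using this
    refine (abs_sub _ _).trans ?_
    simp only [pow_zero, mul_one, add_zero, Nat.choose_zero_right, Nat.cast_one]
    linarith
  | succ k ih =>
    intro m f M hf hM s hs
    have hfl := isLocal_of_dependsOn_Icc hf
    have hM0 : 0 ≤ M := (abs_nonneg _).trans (hM fun _ => true)
    have hLf : DependsOn (generator p p f)
        (Set.Icc (-((2 * (m + 1) : ℕ) : ℤ)) (2 * (m + 1) : ℕ)) :=
      (dependsOn_generator hf p).mono (Set.Icc_subset_Icc (by push_cast; omega)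
        (by push_cast; omega))
    have hLM : ∀ ζ, |generator p p f ζ| ≤ 16 * p * (m + 1) * M := fun ζ => by
      refine (abs_generator_le hp hf hM ζ).trans ?_
      push_cast
      have : 0 ≤ p * M := by positivity
      nlinarith
    have hb := ih (m + 1) (generator p p f) _ hLf hLM
    rw [integral_generator hρ hρ' hfl] at hb
    have hfe := h.forward_equation hfl hr hs
    rw [← hst f hfl, hfe, ← Real.norm_eq_abs]
    set c : ℝ := 2 * (16 * p * (m + 1) * M) * (16 * p) ^ k * ((m + 1 + k).choose k : ℝ) with hc
    have hle := intervalIntegral.norm_integral_le_of_norm_le (μ := volume) hs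
      (f := fun s => ∫ ω, generator p p f (η s.toNNReal ω) ∂P)
      (g := fun s => c * (s - r) ^ k) (.of_forall fun σ hσ => by
        have := hb σ hσ.1.le
        rw [sub_zero, mul_pow] at this
        rw [Real.norm_eq_abs]
        refine this.trans (le_of_eq ?_)
        rw [hc]; ring) ((by fun_prop : Continuous fun s : ℝ => c * (s - r) ^ k).intervalIntegrable _ _)
    refine hle.trans (le_of_eq ?_)
    rw [intervalIntegral.integral_const_mul,
      intervalIntegral.integral_comp_sub_right (fun x => x ^ k), integral_pow, sub_self]
    -- The factor `m + 1` from the generator and `1 / (k + 1)` from the integration turn one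
    -- binomial coefficient into the next.
    have hch : ((m + (k + 1)).choose (k + 1) : ℝ) * (k + 1) = ((m + 1 + k).choose k : ℝ) * (m + 1) := by
      have := Nat.choose_succ_right_eq (m + (k + 1)) k
      rw [show m + (k + 1) - k = m + 1 by omega] at this
      rw [show m + 1 + k = m + (k + 1) by ring]
      exact_mod_cast this
    rw [hc, zero_pow (by omega)]
    have hk : ((k : ℝ) + 1) ≠ 0 := by positivity
    rw [sub_zero, ← mul_div_assoc, div_eq_iff hk]
    calc _ = 2 * M * (16 * p * (s - r)) ^ (k + 1) * (((m + 1 + k).choose k : ℝ) * (m + 1)) := by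
          simp only [mul_pow, pow_succ]; ring
      _ = _ := by rw [← hch]; ring

/-- The binomial coefficient is at most `2 ^ (m + k)`, so over a time `1 / (64 p)` the defect is at
most of order `2⁻ᵏ` for every `k`. The length of time does not depend on `f`, so the argument can be
restarted. -/
theorem IsProcess.integral_eq_of_le (hρ : 1 / 2 < ρ) (hρ' : ρ < 1) (hp : 0 ≤ p)
    (h : IsProcess P p p μ₀ η) {r : ℝ} (hr : 0 ≤ r)
    (hst : ∀ f, IsLocal f → ∫ ω, f (η r.toNNReal ω) ∂P = ∫ ζ, f ζ ∂stationaryMeasure ρ)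
    {s : ℝ} (hs : r ≤ s) (hs' : 64 * p * (s - r) ≤ 1) {f : Config → ℝ} (hf : IsLocal f) :
    ∫ ω, f (η s.toNNReal ω) ∂P = ∫ ζ, f ζ ∂stationaryMeasure ρ := by
  obtain ⟨m, -, hm⟩ := hf.exists_box 0
  obtain ⟨M, hM0, hM⟩ := hf.bounded
  have hm' : DependsOn f (Set.Icc (-((2 * m : ℕ) : ℤ)) (2 * m : ℕ)) :=
    hm.mono (Set.Icc_subset_Icc (by push_cast; omega) (by push_cast; omega))
  have hsr : 0 ≤ s - r := by linarith
  have hb : ∀ k : ℕ, |∫ ω, f (η s.toNNReal ω) ∂P - ∫ ζ, f ζ ∂stationaryMeasure ρ| ≤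
      2 * M * 2 ^ m * (1 / 2) ^ k := by
    intro k
    refine (h.abs_integral_sub_le hρ hρ' hp hr hst k m f M hm' hM s hs).trans ?_
    have h1 : ((m + k).choose k : ℝ) ≤ 2 ^ (m + k) := by exact_mod_cast Nat.choose_le_two_pow _ _
    have h2 : (16 * p * (s - r)) ^ k ≤ (1 / 4) ^ k :=
      pow_le_pow_left₀ (by positivity) (by linarith) k
    calc 2 * M * (16 * p * (s - r)) ^ k * ((m + k).choose k : ℝ)
        ≤ 2 * M * (1 / 4) ^ k * 2 ^ (m + k) := by gcongr
      _ = 2 * M * 2 ^ m * (1 / 2) ^ k := by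
        rw [pow_add, show (1 / 4 : ℝ) = 1 / 2 * (1 / 2) by norm_num, mul_pow, one_div, inv_pow]
        field_simp
  have hlim : Tendsto (fun k : ℕ => 2 * M * 2 ^ m * (1 / 2 : ℝ) ^ k) atTop (𝓝 (2 * M * 2 ^ m * 0)) :=
    (tendsto_pow_atTop_nhds_zero_of_lt_one (by norm_num) (by norm_num)).const_mul _
  have := ge_of_tendsto' hlim hb
  rw [mul_zero] at this
  exact sub_eq_zero.1 (abs_nonpos_iff.1 this)

/-- The stationary measure is invariant. -/
theorem IsProcess.integral_eq (hρ : 1 / 2 < ρ) (hρ' : ρ < 1) (hp : 0 ≤ p)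
    (h : IsProcess P p p (stationaryMeasure ρ) η) {f : Config → ℝ} (hf : IsLocal f) (s : ℝ) :
    ∫ ω, f (η s.toNNReal ω) ∂P = ∫ ζ, f ζ ∂stationaryMeasure ρ := by
  have h0 : ∀ f, IsLocal f → ∫ ω, f (η 0 ω) ∂P = ∫ ζ, f ζ ∂stationaryMeasure ρ := by
    intro f hf
    rw [← h.initial, integral_map (h.measurable 0).aemeasurable hf.measurable.aestronglyMeasurable]
  -- The summand `1` covers `p = 0`, which is the intensity at `N = 0`.
  set δ : ℝ := 1 / (64 * p + 1) with hδ
  have hδ0 : 0 < δ := by positivity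
  have hδ1 : 64 * p * δ ≤ 1 := by
    rw [hδ, mul_one_div, div_le_one (by positivity)]; linarith
  have hstep : ∀ j : ℕ, ∀ s, 0 ≤ s → s ≤ j * δ → ∀ f, IsLocal f →
      ∫ ω, f (η s.toNNReal ω) ∂P = ∫ ζ, f ζ ∂stationaryMeasure ρ := by
    intro j
    induction j with
    | zero =>
      intro s hs hs' f hf
      rw [show s = 0 by simp at hs'; linarith, Real.toNNReal_zero]
      exact h0 f hf
    | succ j ih =>
      intro s hs hs' f hf
      by_cases hle : s ≤ j * δ
      · exact ih s hs hle f hf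
      · push_cast at hs'
        refine h.integral_eq_of_le hρ hρ' hp (r := j * δ) (by positivity)
          (fun f hf => ih _ (by positivity) le_rfl f hf) (by linarith) ?_ hf
        refine le_trans ?_ hδ1
        gcongr
        linarith
  -- `toNNReal` sends negative times to `0`, so the identity holds there too.
  rcases le_total s 0 with hs | hs
  · rw [Real.toNNReal_of_nonpos hs]; exact h0 f hf
  · obtain ⟨j, hj⟩ := exists_nat_ge (s / δ)
    exact hstep j s hs ((div_le_iff₀ hδ0).1 hj) f hf

end Stationarity

/-! ### Static and dynamic bounds on the second moment of additive functionals -/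

section SecondMoment

variable {ρ : ℝ} {Ω : Type*} [MeasurableSpace Ω] {P : Measure Ω} [IsProbabilityMeasure P] {p : ℝ}
  {η : ℝ≥0 → Ω → Config}

/-- After `sq_integral_eq` and Fubini, it suffices to bound the correlation of `F` at time `r` with
its integral over the future, uniformly in `r`. -/
theorem IsProcess.integral_sq_le {μ₀ : Measure Config} (h : IsProcess P p p μ₀ η)
    {F : Config → ℝ} (hF : IsLocal F) {t C : ℝ} (ht : 0 ≤ t)
    (hC : ∀ r, 0 ≤ r → r ≤ t →
      ∫ ω, F (η r.toNNReal ω) * (∫ s in r..t, F (η s.toNNReal ω)) ∂P ≤ C) :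
    ∫ ω, (∫ s in (0 : ℝ)..t, F (η s.toNNReal ω)) ^ 2 ∂P ≤ 2 * t * C := by
  obtain ⟨M, hM0, hM⟩ := hF.bounded
  simp only [h.sq_integral_eq hF ht]
  rw [integral_const_mul, mul_assoc]
  refine mul_le_mul_of_nonneg_left ?_ (by norm_num)
  have hprim : Measurable fun z : ℝ × Ω => ∫ s in z.1..t, F (η s.toNNReal z.2) := by
    have e : ∀ z : ℝ × Ω, ∫ s in z.1..t, F (η s.toNNReal z.2) =
        (∫ s in (0 : ℝ)..t, F (η s.toNNReal z.2)) - ∫ s in (0 : ℝ)..z.1, F (η s.toNNReal z.2) :=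
      fun z => (intervalIntegral.integral_interval_sub_left (h.intervalIntegrable hF z.2 0 t)
        (h.intervalIntegrable hF z.2 0 z.1)).symm
    simp only [e]
    refine ((h.measurable_integral hF 0 t).comp measurable_snd).sub ?_
    have : StronglyMeasurable (Function.uncurry fun (r : ℝ) (ω : Ω) =>
        ∫ s in (0 : ℝ)..r, F (η s.toNNReal ω)) :=
      stronglyMeasurable_uncurry_of_continuous_of_stronglyMeasurable
        (fun ω => intervalIntegral.continuous_primitive (h.intervalIntegrable hF ω) 0)
        fun r => (h.measurable_integral hF 0 r).stronglyMeasurable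
    exact this.measurable
  have hmeas : Measurable (Function.uncurry fun (r : ℝ) (ω : Ω) =>
      F (η r.toNNReal ω) * ∫ s in r..t, F (η s.toNNReal ω)) :=
    (h.measurable_uncurry hF).mul hprim
  have hInt : Integrable (Function.uncurry fun (r : ℝ) (ω : Ω) =>
      F (η r.toNNReal ω) * ∫ s in r..t, F (η s.toNNReal ω))
        ((volume.restrict (Set.uIoc 0 t)).prod P) := by
    refine integrable_prod_of_bound (M := M * (M * t)) hmeas fun r ω hr => ?_
    rw [Set.uIoc_of_le ht] at hr
    rw [abs_mul]
    refine mul_le_mul (hM _) ?_ (abs_nonneg _) hM0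
    refine (intervalIntegral.norm_integral_le_of_norm_le_const
      (f := fun s => F (η s.toNNReal ω)) fun s _ => hM _).trans ?_
    gcongr
    rw [abs_of_nonneg (by linarith [hr.2])]
    linarith [hr.1]
  rw [← intervalIntegral_integral_swap hInt]
  have h2 : IntervalIntegrable (fun r => ∫ ω, F (η r.toNNReal ω) * (∫ s in r..t,
      F (η s.toNNReal ω)) ∂P) volume 0 t := by
    rw [intervalIntegrable_iff]
    exact hInt.integral_prod_left
  refine (intervalIntegral.integral_mono_on ht h2 (intervalIntegrable_const (c := C))
    fun r hr => hC r hr.1 hr.2).trans ?_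
  simp

/-- Cauchy–Schwarz on the path space; only the stationarity of one-time marginals enters, applied to
the squares. -/
theorem IsProcess.integral_mul_le (hρ : 1 / 2 < ρ) (hρ' : ρ < 1) (hp : 0 ≤ p)
    (h : IsProcess P p p (stationaryMeasure ρ) η) {f g : Config → ℝ} (hf : IsLocal f)
    (hg : IsLocal g) (r s : ℝ) :
    |∫ ω, f (η r.toNNReal ω) * g (η s.toNNReal ω) ∂P| ≤
      √(∫ ζ, f ζ ^ 2 ∂stationaryMeasure ρ) * √(∫ ζ, g ζ ^ 2 ∂stationaryMeasure ρ) := by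
  have key : ∀ f g, IsLocal f → IsLocal g → ∫ ω, f (η r.toNNReal ω) * g (η s.toNNReal ω) ∂P ≤
      √(∫ ζ, f ζ ^ 2 ∂stationaryMeasure ρ) * √(∫ ζ, g ζ ^ 2 ∂stationaryMeasure ρ) := by
    intro f g hf hg
    have := integral_mul_le_sqrt (h.memLp_marginal hf r 2) (h.memLp_marginal hg s 2)
    rwa [h.integral_eq hρ hρ' hp (hf.map₂ hf fun a _ => a ^ 2),
      h.integral_eq hρ hρ' hp (hg.map₂ hg fun a _ => a ^ 2)] at this
  refine abs_le.2 ⟨?_, key f g hf hg⟩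
  have := key (fun ζ => -f ζ) g hf.neg hg
  simp only [neg_mul, integral_neg, neg_sq] at this
  linarith

theorem IsProcess.integral_mul_integral_le (hρ : 1 / 2 < ρ) (hρ' : ρ < 1) (hp : 0 ≤ p)
    (h : IsProcess P p p (stationaryMeasure ρ) η) {f g : Config → ℝ} (hf : IsLocal f)
    (hg : IsLocal g) {r t : ℝ} (hr : 0 ≤ r) (hrt : r ≤ t) :
    |∫ ω, f (η r.toNNReal ω) * (∫ s in r..t, g (η s.toNNReal ω)) ∂P| ≤
      √(∫ ζ, f ζ ^ 2 ∂stationaryMeasure ρ) * √(∫ ζ, g ζ ^ 2 ∂stationaryMeasure ρ) * t := by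
  rw [h.integral_mul_integral hf hg]
  refine (intervalIntegral.norm_integral_le_of_norm_le_const
    (f := fun s => ∫ ω, f (η r.toNNReal ω) * g (η s.toNNReal ω) ∂P) fun s _ =>
    h.integral_mul_le hρ hρ' hp hf hg r s).trans ?_
  gcongr
  rw [abs_of_nonneg (by linarith)]
  linarith

/-- The static bound on the second moment of an additive functional. -/
theorem IsProcess.integral_sq_le_static (hρ : 1 / 2 < ρ) (hρ' : ρ < 1) (hp : 0 ≤ p)
    (h : IsProcess P p p (stationaryMeasure ρ) η) {F : Config → ℝ} (hF : IsLocal F) {t : ℝ}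
    (ht : 0 ≤ t) :
    ∫ ω, (∫ s in (0 : ℝ)..t, F (η s.toNNReal ω)) ^ 2 ∂P ≤
      2 * t ^ 2 * ∫ ζ, F ζ ^ 2 ∂stationaryMeasure ρ := by
  have hn : 0 ≤ ∫ ζ, F ζ ^ 2 ∂stationaryMeasure ρ := integral_nonneg fun _ => sq_nonneg _
  refine (h.integral_sq_le hF ht (C := (∫ ζ, F ζ ^ 2 ∂stationaryMeasure ρ) * t)
    fun r hr hrt => ?_).trans (le_of_eq (by ring))
  refine (le_abs_self _).trans ((h.integral_mul_integral_le hρ hρ' hp hF hF hr hrt).trans ?_)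
  rw [Real.mul_self_sqrt hn]

/-- The dynamic bound on the second moment of an additive functional: a Kipnis–Varadhan type
estimate. -/
theorem IsProcess.integral_sq_le_dynamic (hρ : 1 / 2 < ρ) (hρ' : ρ < 1) (hp : 0 < p)
    (h : IsProcess P p p (stationaryMeasure ρ) η) {F : Config → ℝ} (hF : IsLocal F) {t : ℝ}
    (ht : 0 ≤ t) {κ : ℝ} (hκ : 0 ≤ κ) (B : Finset ℤ)
    (hFκ : ∀ u, IsLocal u →
      ∫ ζ, F ζ * u ζ ∂stationaryMeasure ρ ≤ κ * √(∑ x ∈ B, energy ρ x u)) :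
    ∫ ω, (∫ s in (0 : ℝ)..t, F (η s.toNNReal ω)) ^ 2 ∂P ≤
      2 * t * (√(∫ ζ, F ζ ^ 2 ∂stationaryMeasure ρ) * (t + 2) * (κ / √p)) := by
  set A := √(∫ ζ, F ζ ^ 2 ∂stationaryMeasure ρ) with hA
  have hA0 : 0 ≤ A := Real.sqrt_nonneg _
  have key : ∀ ε > 0, ∫ ω, (∫ s in (0 : ℝ)..t, F (η s.toNNReal ω)) ^ 2 ∂P ≤
      2 * t * (A * (t + 2) * (ε + κ / √p) + A * ε * t) := by
    intro ε hε
    obtain ⟨u, hu, he, hu'⟩ := exists_small_resolvent hρ hρ' hp hF hκ B hFκ hε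
    have hL := hu.generator p p
    set e : Config → ℝ := fun ζ => u ζ - generator p p u ζ - F ζ with hedef
    have hel : IsLocal e := (hu.sub hL).sub hF
    refine h.integral_sq_le hF ht fun r hr hrt => ?_
    -- Writing `F = u - generator u - e`: the integral of `generator u` becomes the boundary values
    -- of `u` by the martingale property. These give the `2`, and the integral of `u` the `t`, in
    -- the factor `t + 2`.
    have hdec : ∫ ω, F (η r.toNNReal ω) * (∫ s in r..t, F (η s.toNNReal ω)) ∂P =
        ∫ ω, F (η r.toNNReal ω) * (∫ s in r..t, u (η s.toNNReal ω)) ∂P -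
        ∫ ω, F (η r.toNNReal ω) * (∫ s in r..t, generator p p u (η s.toNNReal ω)) ∂P -
        ∫ ω, F (η r.toNNReal ω) * (∫ s in r..t, e (η s.toNNReal ω)) ∂P := by
      have i1 := h.integrable_mul_integral hF hu r r t
      have i2 := h.integrable_mul_integral hF hL r r t
      have i3 := h.integrable_mul_integral hF hel r r t
      rw [← integral_sub' i1 i2, ← integral_sub (i1.sub i2) i3]
      refine integral_congr_ae (.of_forall fun ω => ?_)
      have j1 := h.intervalIntegrable hu ω r t
      have j2 := h.intervalIntegrable hL ω r t
      have j3 := h.intervalIntegrable hel ω r t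
      simp only [Pi.sub_apply, ← mul_sub]
      rw [← intervalIntegral.integral_sub j1 j2, ← intervalIntegral.integral_sub (j1.sub j2) j3]
      congr 2
      ext s
      simp only [hedef]
      ring
    rw [hdec, h.integral_mul_martingale hF hu hr hrt]
    have b1 := abs_le.1 (h.integral_mul_integral_le hρ hρ' hp.le hF hu hr hrt)
    have b2 := abs_le.1 (h.integral_mul_integral_le hρ hρ' hp.le hF hel hr hrt)
    have b3 := abs_le.1 (h.integral_mul_le hρ hρ' hp.le hF hu r t)
    have b4 := abs_le.1 (h.integral_mul_le hρ hρ' hp.le hF hu r r)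
    rw [← hA] at b1 b2 b3 b4
    have c1 : A * √(∫ ζ, u ζ ^ 2 ∂stationaryMeasure ρ) ≤ A * (ε + κ / √p) := by gcongr
    have c2 : A * √(∫ ζ, e ζ ^ 2 ∂stationaryMeasure ρ) * t ≤ A * ε * t := by gcongr
    have c3 : A * √(∫ ζ, u ζ ^ 2 ∂stationaryMeasure ρ) * t ≤ A * (ε + κ / √p) * t := by gcongr
    linarith [b1.2, b2.1, b3.1, b4.2]
  -- The precision `ε` of the approximate resolvent is arbitrary and is removed in the limit.
  have hlim : Tendsto (fun ε : ℝ => 2 * t * (A * (t + 2) * (ε + κ / √p) + A * ε * t)) (𝓝[>] 0)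
      (𝓝 (2 * t * (A * (t + 2) * (0 + κ / √p) + A * 0 * t))) :=
    ((by fun_prop : Continuous fun ε : ℝ =>
      2 * t * (A * (t + 2) * (ε + κ / √p) + A * ε * t)).tendsto 0).mono_left nhdsWithin_le_nhds
  have := ge_of_tendsto hlim (eventually_nhdsWithin_of_forall key)
  simpa using this

end SecondMoment

/-! ### Fluctuation fields of local functions -/

section Field

/-- Quantitative properties of a test function: support in `[-R, R]`, a bound `C` and a Lipschitz
constant `L`. -/
structure IsTest (G : ℝ → ℝ) (R : ℕ) (C L : ℝ) : Prop where
  support : ∀ y, (R : ℝ) < |y| → G y = 0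
  bound : ∀ y, |G y| ≤ C
  lipschitz : ∀ y z, |G y - G z| ≤ L * |y - z|

theorem exists_isTest {G : ℝ → ℝ} (hG : ContDiff ℝ ((⊤ : ℕ∞) : WithTop ℕ∞) G)
    (hGc : HasCompactSupport G) : ∃ R C L, IsTest G R C L := by
  obtain ⟨C, hC⟩ := hG.continuous.bounded_above_of_compact_support hGc
  obtain ⟨K, hK⟩ := ContDiff.lipschitzWith_of_hasCompactSupport hGc hG (by simp)
  obtain ⟨r, hr⟩ := hGc.isCompact.isBounded.exists_norm_le
  obtain ⟨R, hR⟩ := exists_nat_ge r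
  refine ⟨R, C, K, fun y hy => ?_, hC, fun y z => ?_⟩
  · by_contra h0
    have := hr y (subset_tsupport G h0)
    rw [Real.norm_eq_abs] at this
    linarith
  · have := hK.dist_le_mul y z
    rwa [Real.dist_eq, Real.dist_eq] at this

variable {G : ℝ → ℝ} {R : ℕ} {C L : ℝ}

/-- The sites which contribute to the field at scale `N`. -/
noncomputable def sites (R N : ℕ) : Finset ℤ := Finset.Icc (-((R * N : ℕ) : ℤ)) (R * N : ℕ)

theorem card_sites_le {R N : ℕ} (hN : 1 ≤ N) : ((sites R N).card : ℝ) ≤ (2 * R + 1) * N := by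
  rw [sites, Int.card_Icc, show (((R * N : ℕ) : ℤ) + 1 - -((R * N : ℕ) : ℤ)).toNat =
    2 * (R * N) + 1 by omega]
  have : (1 : ℝ) ≤ N := by exact_mod_cast hN
  push_cast
  linarith

theorem IsTest.eq_zero (hG : IsTest G R C L) {N : ℕ} (hN : 1 ≤ N) {x : ℤ} (hx : x ∉ sites R N) :
    G ((x : ℝ) / N) = 0 := by
  have hN0 : (0 : ℝ) < N := by exact_mod_cast hN
  apply hG.support
  rw [abs_div, abs_of_pos hN0, lt_div_iff₀ hN0]
  have : ((R * N : ℕ) : ℤ) < |x| := by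
    simp only [sites, Finset.mem_Icc, not_and_or, not_le] at hx
    rcases hx with hx | hx
    · exact lt_abs.2 (Or.inr (by omega))
    · exact lt_abs.2 (Or.inl hx)
  exact_mod_cast this

theorem IsTest.field_eq (hG : IsTest G R C L) (N : ℕ) (V : Config → ℝ) (η : Config) :
    field N G V η = (√(N : ℝ))⁻¹ * ∑ x ∈ sites R N, G ((x : ℝ) / N) * translate x V η := by
  rcases Nat.eq_zero_or_pos N with rfl | hN
  · simp [field]
  · rw [field, tsum_eq_sum fun x hx => by rw [hG.eq_zero hN hx, zero_mul]]

theorem isLocal_translate {V : Config → ℝ} (hV : IsLocal V) (x : ℤ) : IsLocal (translate x V) :=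
  hV.comp (T := fun η y => η (y - x)) fun z => ⟨{z - x}, fun η ζ h => h (z - x) (by simp)⟩

theorem IsTest.isLocal_field (hG : IsTest G R C L) (N : ℕ) {V : Config → ℝ} (hV : IsLocal V) :
    IsLocal (field N G V) := by
  rw [show field N G V = fun η => (√(N : ℝ))⁻¹ * (∑ x ∈ sites R N,
    fun η => G ((x : ℝ) / N) * translate x V η) η by
      ext η; rw [hG.field_eq, Finset.sum_apply]]
  exact (IsLocal.sum _ fun x _ => (isLocal_translate hV x).smul _).smul _

theorem IsTest.field_add (hG : IsTest G R C L) (N : ℕ) (V W : Config → ℝ) (η : Config) :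
    field N G (fun ζ => V ζ + W ζ) η = field N G V η + field N G W η := by
  simp only [hG.field_eq, translate, mul_add, Finset.sum_add_distrib]

theorem IsTest.field_smul (hG : IsTest G R C L) (N : ℕ) (c : ℝ) (V : Config → ℝ) (η : Config) :
    field N G (fun ζ => c * V ζ) η = c * field N G V η := by
  simp only [hG.field_eq, translate, Finset.mul_sum]
  exact Finset.sum_congr rfl fun x _ => by ring

theorem IsTest.nonneg (hG : IsTest G R C L) : 0 ≤ C := (abs_nonneg _).trans (hG.bound 0)

theorem IsTest.lipschitz_nonneg (hG : IsTest G R C L) : 0 ≤ L := by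
  have := (abs_nonneg _).trans (hG.lipschitz 1 0)
  simpa using this

theorem inv_sqrt_mul_self {N : ℕ} : (√(N : ℝ))⁻¹ * N = √(N : ℝ) := by
  rcases Nat.eq_zero_or_pos N with rfl | hN
  · simp
  · have : (0 : ℝ) < N := by exact_mod_cast hN
    rw [inv_mul_eq_div, Real.div_sqrt]

theorem IsTest.abs_field_le (hG : IsTest G R C L) {N : ℕ} (hN : 1 ≤ N) {V : Config → ℝ} {M : ℝ}
    (hV : ∀ ζ, |V ζ| ≤ M) (η : Config) : |field N G V η| ≤ (2 * R + 1) * C * M * √(N : ℝ) := by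
  have hC := hG.nonneg
  have hM : 0 ≤ M := (abs_nonneg _).trans (hV η)
  rw [hG.field_eq, abs_mul, abs_of_nonneg (by positivity)]
  have h1 : |∑ x ∈ sites R N, G ((x : ℝ) / N) * translate x V η| ≤
      (sites R N).card • (C * M) := by
    refine (Finset.abs_sum_le_sum_abs _ _).trans (Finset.sum_le_card_nsmul _ _ _ fun x _ => ?_)
    rw [abs_mul]
    exact mul_le_mul (hG.bound _) (hV _) (abs_nonneg _) hC
  rw [nsmul_eq_mul] at h1
  calc _ ≤ (√(N : ℝ))⁻¹ * (((2 * R + 1) * N) * (C * M)) := by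
        gcongr
        exact h1.trans (by gcongr; exact card_sites_le hN)
    _ = (2 * R + 1) * C * M * ((√(N : ℝ))⁻¹ * N) := by ring
    _ = _ := by rw [inv_sqrt_mul_self]

theorem exchange_shift (x y : ℤ) (η : Config) :
    exchange x (fun z => η (z - y)) = fun z => exchange (x - y) η (z - y) := by
  have e1 : x - 1 - y = x - y - 1 := by ring
  have e2 : x + 2 - y = x - y + 2 := by ring
  ext z
  simp only [exchange, e1, e2]
  split_ifs
  · by_cases hz : z = x
    · subst hz
      rw [swap_left, swap_left]; congr 1; ring
    · by_cases hz' : z = x + 1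
      · subst hz'
        rw [swap_right, show x + 1 - y = x - y + 1 by ring, swap_right]
      · rw [swap_of_ne _ hz hz', swap_of_ne _ (by omega) (by omega)]
  · rfl

/-- The field of `f ∘ exchange x - f` is controlled by the Dirichlet form. -/
theorem IsTest.integral_field_exchange_mul_le {ρ : ℝ} (hρ : 1 / 2 < ρ) (hρ' : ρ < 1)
    (hG : IsTest G R C L) {N : ℕ} (hN : 1 ≤ N) {f : Config → ℝ} (hf : IsLocal f) {M : ℝ}
    (hM : ∀ ζ, |f ζ| ≤ M) (x : ℤ) {u : Config → ℝ} (hu : IsLocal u) :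
    ∫ η, field N G (fun ζ => f (exchange x ζ) - f ζ) η * u η ∂stationaryMeasure ρ ≤
      (C * M * √(2 * R + 1)) *
        √(∑ z ∈ (sites R N).image (fun y => x - y), energy ρ z u) := by
  have hC := hG.nonneg
  have hM0 : 0 ≤ M := (abs_nonneg _).trans (hM fun _ => true)
  have hN0 : (0 : ℝ) < N := by exact_mod_cast hN
  -- Translating by `y` moves the exchange to the bond `x - y`; distinct `y` use distinct bonds, so
  -- each energy is counted once.
  rw [Finset.sum_image fun a _ b _ h => by simpa using h]
  have e : ∀ η, field N G (fun ζ => f (exchange x ζ) - f ζ) η * u η = (√(N : ℝ))⁻¹ *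
      ∑ y ∈ sites R N, G ((y : ℝ) / N) *
        ((translate y f (exchange (x - y) η) - translate y f η) * u η) := by
    intro η
    rw [hG.field_eq, mul_assoc, Finset.sum_mul]
    congr 1
    refine Finset.sum_congr rfl fun y _ => ?_
    simp only [translate, exchange_shift]
    ring
  simp only [e]
  rw [integral_const_mul, integral_finsetSum _ fun y _ =>
    (((((isLocal_translate hf y).comp_exchange (x - y)).sub (isLocal_translate hf y)).mul
      hu).integrable _).const_mul _]
  simp only [integral_const_mul, integral_exchange_sub_mul hρ hρ' (isLocal_translate hf _) hu]
  have hterm : ∀ y ∈ sites R N, G ((y : ℝ) / N) * (-(1 / 2) *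
      ∫ η, (translate y f (exchange (x - y) η) - translate y f η) *
        (u (exchange (x - y) η) - u η) ∂stationaryMeasure ρ) ≤
      C * M * √(energy ρ (x - y) u) := by
    intro y _
    have hl : IsLocal fun η => translate y f (exchange (x - y) η) - translate y f η :=
      ((isLocal_translate hf y).comp_exchange (x - y)).sub (isLocal_translate hf y)
    have hlu : IsLocal fun η => u (exchange (x - y) η) - u η := (hu.comp_exchange (x - y)).sub hu
    have hsq : √(∫ η, (translate y f (exchange (x - y) η) - translate y f η) ^ 2
        ∂stationaryMeasure ρ) ≤ 2 * M := by
      refine Real.sqrt_le_iff.2 ⟨by positivity, ?_⟩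
      refine (integral_mono ((hl.map₂ hl fun a _ => a ^ 2).integrable _)
        (integrable_const ((2 * M) ^ 2)) fun η => ?_).trans (by simp)
      refine sq_le_sq' ?_ ?_ <;>
        linarith [abs_le.1 (hM fun z => exchange (x - y) η (z - y)),
          abs_le.1 (hM fun z => η (z - y)), (abs_le.1 (hM fun z => η (z - y))).1,
          (abs_le.1 (hM fun z => η (z - y))).2,
          (abs_le.1 (hM fun z => exchange (x - y) η (z - y))).1,
          (abs_le.1 (hM fun z => exchange (x - y) η (z - y))).2,
          show translate y f η = f fun z => η (z - y) from rfl,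
          show translate y f (exchange (x - y) η) = f fun z => exchange (x - y) η (z - y) from rfl]
    have habs : |∫ η, (translate y f (exchange (x - y) η) - translate y f η) *
        (u (exchange (x - y) η) - u η) ∂stationaryMeasure ρ| ≤ 2 * M * √(energy ρ (x - y) u) := by
      have h1 := integral_mul_le_sqrt (hl.memLp (stationaryMeasure ρ) 2)
        (hlu.memLp (stationaryMeasure ρ) 2)
      have h2 := integral_mul_le_sqrt (hl.neg.memLp (stationaryMeasure ρ) 2)
        (hlu.memLp (stationaryMeasure ρ) 2)
      simp only [neg_mul, integral_neg, neg_sq] at h2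
      have h3 : √(∫ η, (translate y f (exchange (x - y) η) - translate y f η) ^ 2
        ∂stationaryMeasure ρ) * √(∫ η, (u (exchange (x - y) η) - u η) ^ 2 ∂stationaryMeasure ρ) ≤
          2 * M * √(energy ρ (x - y) u) := mul_le_mul_of_nonneg_right hsq (Real.sqrt_nonneg _)
      exact abs_le.2 ⟨by linarith, by linarith⟩
    refine (le_abs_self _).trans ?_
    rw [abs_mul, abs_mul, abs_neg, abs_of_pos (by norm_num : (0 : ℝ) < 1 / 2)]
    calc _ ≤ C * (1 / 2 * (2 * M * √(energy ρ (x - y) u))) := by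
          gcongr
          exact hG.bound _
      _ = _ := by ring
  -- Cauchy–Schwarz over at most `(2 R + 1) N` sites; the `√N` it produces cancels the normalisation
  -- of the field, so the final constant is free of `N`.
  have hcs : ∑ y ∈ sites R N, √(energy ρ (x - y) u) ≤
      √((2 * R + 1) * N) * √(∑ y ∈ sites R N, energy ρ (x - y) u) := by
    have h1 := Real.sum_sqrt_mul_sqrt_le (sites R N) (f := fun _ => (1 : ℝ))
      (g := fun y => energy ρ (x - y) u) (fun _ => zero_le_one) fun y => energy_nonneg _ _
    simp only [Real.sqrt_one, one_mul, Finset.sum_const, nsmul_eq_mul, mul_one] at h1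
    refine h1.trans ?_
    gcongr
    exact card_sites_le hN
  calc _ ≤ (√(N : ℝ))⁻¹ * ∑ y ∈ sites R N, C * M * √(energy ρ (x - y) u) :=
        mul_le_mul_of_nonneg_left (Finset.sum_le_sum hterm) (by positivity)
    _ ≤ (√(N : ℝ))⁻¹ * (C * M *
        (√((2 * R + 1) * N) * √(∑ y ∈ sites R N, energy ρ (x - y) u))) := by
        rw [← Finset.mul_sum]
        gcongr
    _ = _ := by
        rw [Real.sqrt_mul (by positivity)]
        have : √(N : ℝ) ≠ 0 := (Real.sqrt_pos.2 hN0).ne'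
        field_simp

theorem translate_translate (x z : ℤ) (f : Config → ℝ) (η : Config) :
    translate x (translate z f) η = translate (x + z) f η := by
  simp only [translate]
  congr 1
  ext y
  congr 1
  ring

/-- Summation by parts moves the gradient on to `G`, whose increments are at most `L / N`. With
order `N` sites and the normalisation `N^{-1/2}`, the field is small pointwise. -/
theorem IsTest.abs_field_gradient_le (hG : IsTest G R C L) {N : ℕ} (hN : 1 ≤ N)
    {f : Config → ℝ} {M : ℝ} (hM : ∀ ζ, |f ζ| ≤ M) (η : Config) :
    |field N G (fun ζ => f ζ - translate 1 f ζ) η| ≤ (2 * R + 2) * L * M * (√(N : ℝ))⁻¹ := by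
  have hL := hG.lipschitz_nonneg
  have hM0 : 0 ≤ M := (abs_nonneg _).trans (hM fun _ => true)
  have hN0 : (0 : ℝ) < N := by exact_mod_cast hN
  have hs : ∀ φ : ℤ → ℝ, Summable fun x : ℤ => G ((x : ℝ) / N) * φ x := fun φ =>
    summable_of_ne_finset_zero (s := sites R N) fun x hx => by rw [hG.eq_zero hN hx, zero_mul]
  have hshift : ∑' x : ℤ, G ((x : ℝ) / N) * translate (x + 1) f η =
      ∑' x : ℤ, G (((x - 1 : ℤ) : ℝ) / N) * translate x f η := by
    rw [← (Equiv.subRight (1 : ℤ)).tsum_eq]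
    simp [Equiv.subRight]
  have hs' : Summable fun x : ℤ => G (((x - 1 : ℤ) : ℝ) / N) * translate x f η := by
    have := (Equiv.subRight (1 : ℤ)).summable_iff.2 (hs fun x => translate (x + 1) f η)
    refine this.congr fun x => ?_
    simp [Equiv.subRight]
  have e : field N G (fun ζ => f ζ - translate 1 f ζ) η = (√(N : ℝ))⁻¹ *
      ∑' x : ℤ, (G ((x : ℝ) / N) - G (((x - 1 : ℤ) : ℝ) / N)) * translate x f η := by
    simp only [sub_mul]
    rw [(hs _).tsum_sub hs', ← hshift, ← (hs _).tsum_sub (hs _)]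
    simp only [field]
    congr 2
    ext x
    rw [← mul_sub, ← translate_translate]
    rfl
  -- The shifted test function reaches one site further to the right, which turns `2 R + 1` into `2
  -- R + 2`.
  have hz : ∀ x ∉ Finset.Icc (-((R * N : ℕ) : ℤ)) ((R * N : ℕ) + 1),
      (G ((x : ℝ) / N) - G (((x - 1 : ℤ) : ℝ) / N)) * translate x f η = 0 := by
    intro x hx
    simp only [Finset.mem_Icc, not_and_or, not_le] at hx
    rw [hG.eq_zero hN (x := x), hG.eq_zero hN (x := x - 1), sub_self, zero_mul] <;>
    · simp only [sites, Finset.mem_Icc]; omega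
  rw [e, tsum_eq_sum hz, abs_mul, abs_of_nonneg (by positivity : 0 ≤ (√(N : ℝ))⁻¹), mul_comm]
  refine mul_le_mul_of_nonneg_right ?_ (by positivity)
  have h1 : |∑ x ∈ Finset.Icc (-((R * N : ℕ) : ℤ)) ((R * N : ℕ) + 1),
      (G ((x : ℝ) / N) - G (((x - 1 : ℤ) : ℝ) / N)) * translate x f η| ≤
      (Finset.Icc (-((R * N : ℕ) : ℤ)) ((R * N : ℕ) + 1)).card • (L * (1 / N) * M) := by
    refine (Finset.abs_sum_le_sum_abs _ _).trans (Finset.sum_le_card_nsmul _ _ _ fun x _ => ?_)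
    rw [abs_mul]
    refine mul_le_mul ?_ (hM _) (abs_nonneg _) (by positivity)
    refine (hG.lipschitz _ _).trans (le_of_eq ?_)
    congr 1
    push_cast
    rw [← sub_div, sub_sub_cancel, abs_of_pos (by positivity)]
  refine h1.trans ?_
  rw [Int.card_Icc, show (((R * N : ℕ) : ℤ) + 1 + 1 - -((R * N : ℕ) : ℤ)).toNat =
    2 * (R * N) + 2 by omega, nsmul_eq_mul]
  have hN1 : (1 : ℝ) ≤ N := by exact_mod_cast hN
  have : ((2 * (R * N) + 2 : ℕ) : ℝ) ≤ (2 * R + 2) * N := by push_cast; linarith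
  calc _ ≤ ((2 * R + 2) * N) * (L * (1 / N) * M) := by gcongr
    _ = _ := by field_simp

end Field

/-! ### Functions with negligible field -/

section Negligible

variable {ρ : ℝ} {G : ℝ → ℝ} {R : ℕ} {C L t : ℝ} {Ω : ℕ → Type*} [∀ N, MeasurableSpace (Ω N)]
  {P : (N : ℕ) → Measure (Ω N)} {η : (N : ℕ) → ℝ≥0 → Ω N → Config}

/-- The second moment of the integrated field of `V` vanishes as `N → ∞`. -/
def Negligible (G : ℝ → ℝ) (t : ℝ) (P : (N : ℕ) → Measure (Ω N))
    (η : (N : ℕ) → ℝ≥0 → Ω N → Config) (V : Config → ℝ) : Prop :=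
  Tendsto (fun N : ℕ => ∫ ω, (integratedField N G V (η N) t ω) ^ 2 ∂(P N)) atTop (𝓝 0)

/-- The processes at scale `N` are stationary facilitated exclusion processes, accelerated by
`N ^ 2`. -/
def IsDiffusiveFamily (ρ : ℝ) (P : (N : ℕ) → Measure (Ω N))
    (η : (N : ℕ) → ℝ≥0 → Ω N → Config) : Prop :=
  ∀ N : ℕ, IsProcess (P N) ((N : ℝ) ^ 2) ((N : ℝ) ^ 2) (stationaryMeasure ρ) (η N)

theorem integratedField_add (hη : IsDiffusiveFamily ρ P η) (hG : IsTest G R C L)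
    {V W : Config → ℝ} (hV : IsLocal V) (hW : IsLocal W) (N : ℕ) (ω : Ω N) :
    integratedField N G (fun ζ => V ζ + W ζ) (η N) t ω =
      integratedField N G V (η N) t ω + integratedField N G W (η N) t ω := by
  simp only [integratedField, hG.field_add]
  exact intervalIntegral.integral_add ((hη N).intervalIntegrable (hG.isLocal_field N hV) ω 0 t)
    ((hη N).intervalIntegrable (hG.isLocal_field N hW) ω 0 t)

theorem Negligible.of_le {V : Config → ℝ} {b : ℕ → ℝ} (hb : Tendsto b atTop (𝓝 0))
    (h : ∀ N ≥ 1, ∫ ω, (integratedField N G V (η N) t ω) ^ 2 ∂(P N) ≤ b N) :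
    Negligible G t P η V :=
  tendsto_of_tendsto_of_tendsto_of_le_of_le' tendsto_const_nhds hb
    (.of_forall fun _ => integral_nonneg fun _ => sq_nonneg _)
    (eventually_atTop.2 ⟨1, h⟩)

theorem Negligible.smul (hG : IsTest G R C L) {V : Config → ℝ}
    (h : Negligible G t P η V) (c : ℝ) : Negligible G t P η fun ζ => c * V ζ := by
  have : ∀ N : ℕ, ∫ ω, (integratedField N G (fun ζ => c * V ζ) (η N) t ω) ^ 2 ∂(P N) =
      c ^ 2 * ∫ ω, (integratedField N G V (η N) t ω) ^ 2 ∂(P N) := fun N => by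
    rw [← integral_const_mul]
    refine integral_congr_ae (.of_forall fun ω => ?_)
    simp only [integratedField, hG.field_smul, intervalIntegral.integral_const_mul]
    ring
  simpa only [Negligible, this, mul_zero] using Tendsto.const_mul (c ^ 2) h

variable [∀ N, IsProbabilityMeasure (P N)]

theorem memLp_integratedField (hη : IsDiffusiveFamily ρ P η) (hG : IsTest G R C L) {V : Config → ℝ}
    (hV : IsLocal V) (N : ℕ) : MemLp (integratedField N G V (η N) t) 2 (P N) :=
  (hη N).memLp_integral (hG.isLocal_field N hV) 0 t 2

theorem integral_sq_integratedField_add_le (hη : IsDiffusiveFamily ρ P η) (hG : IsTest G R C L)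
    {V W : Config → ℝ} (hV : IsLocal V) (hW : IsLocal W) (N : ℕ) :
    ∫ ω, (integratedField N G (fun ζ => V ζ + W ζ) (η N) t ω) ^ 2 ∂(P N) ≤
      2 * ∫ ω, (integratedField N G V (η N) t ω) ^ 2 ∂(P N) +
        2 * ∫ ω, (integratedField N G W (η N) t ω) ^ 2 ∂(P N) := by
  have h1 := (memLp_integratedField (t := t) hη hG hV N).integrable_sq
  have h2 := (memLp_integratedField (t := t) hη hG hW N).integrable_sq
  have h3 := (memLp_integratedField (t := t) hη hG (hV.add hW) N).integrable_sq
  rw [← integral_const_mul, ← integral_const_mul,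
    ← integral_add (h1.const_mul 2) (h2.const_mul 2)]
  refine integral_mono h3 ((h1.const_mul 2).add (h2.const_mul 2)) fun ω => ?_
  simp only [integratedField_add hη hG hV hW]
  nlinarith [sq_nonneg (integratedField N G V (η N) t ω - integratedField N G W (η N) t ω)]

theorem Negligible.add (hη : IsDiffusiveFamily ρ P η) (hG : IsTest G R C L) {V W : Config → ℝ}
    (hV : IsLocal V) (hW : IsLocal W) (h1 : Negligible G t P η V) (h2 : Negligible G t P η W) :
    Negligible G t P η fun ζ => V ζ + W ζ := by
  refine Negligible.of_le ?_ fun N _ => integral_sq_integratedField_add_le hη hG hV hW N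
  simpa using (h1.const_mul 2).add (h2.const_mul 2)

theorem integral_sq_integratedField_le (hρ : 1 / 2 < ρ) (hρ' : ρ < 1)
    (hη : IsDiffusiveFamily ρ P η) (hG : IsTest G R C L) (ht : 0 ≤ t) {V : Config → ℝ}
    (hV : IsLocal V) (N : ℕ) :
    ∫ ω, (integratedField N G V (η N) t ω) ^ 2 ∂(P N) ≤
      2 * t ^ 2 * ∫ ζ, field N G V ζ ^ 2 ∂stationaryMeasure ρ :=
  (hη N).integral_sq_le_static hρ hρ' (by positivity) (hG.isLocal_field N hV) ht

/-- The ergodic configurations are stable under translation and have full measure, so the field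
vanishes almost surely and the static bound is zero. -/
theorem Negligible.of_ergodic (hρ : 1 / 2 < ρ) (hρ' : ρ < 1) (hη : IsDiffusiveFamily ρ P η)
    (hG : IsTest G R C L) (ht : 0 ≤ t) {V : Config → ℝ} (hV : IsLocal V)
    (h0 : ∀ ζ, Ergodic ζ → V ζ = 0) : Negligible G t P η V := by
  refine Negligible.of_le (b := fun _ => 0) tendsto_const_nhds fun N _ => ?_
  refine (integral_sq_integratedField_le hρ hρ' hη hG ht hV N).trans (le_of_eq ?_)
  have : ∫ ζ, field N G V ζ ^ 2 ∂stationaryMeasure ρ = ∫ ζ, 0 ∂stationaryMeasure ρ := by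
    refine integral_congr_ae ?_
    filter_upwards [ae_ergodic hρ hρ'] with ζ hζ
    have : ∀ x, translate x V ζ = 0 := fun x => h0 _ fun y => by
      have := hζ (y - x)
      rwa [show y - x + 1 = y + 1 - x by ring] at this
    simp [hG.field_eq, this]
  rw [this]
  simp

theorem Negligible.gradient (hρ : 1 / 2 < ρ) (hρ' : ρ < 1) (hη : IsDiffusiveFamily ρ P η)
    (hG : IsTest G R C L) (ht : 0 ≤ t) {f : Config → ℝ} (hf : IsLocal f) :
    Negligible G t P η fun ζ => f ζ - translate 1 f ζ := by
  obtain ⟨M, hM0, hM⟩ := hf.bounded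
  have hV : IsLocal fun ζ => f ζ - translate 1 f ζ := hf.sub (isLocal_translate hf 1)
  set K := (2 * R + 2) * L * M with hK
  refine Negligible.of_le (b := fun N => 2 * t ^ 2 * (K ^ 2 * (N : ℝ)⁻¹)) ?_ fun N hN => ?_
  · simpa using ((tendsto_inv_atTop_nhds_zero_nat (𝕜 := ℝ)).const_mul (K ^ 2)).const_mul (2 * t ^ 2)
  · refine (integral_sq_integratedField_le hρ hρ' hη hG ht hV N).trans ?_
    gcongr
    have hl := hG.isLocal_field N hV
    refine (integral_mono ((hl.map₂ hl fun a _ => a ^ 2).integrable _)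
      (integrable_const (K ^ 2 * (N : ℝ)⁻¹)) fun ζ => ?_).trans (by simp)
    have h1 := hG.abs_field_gradient_le hN hM ζ
    have h2 : (K * (√(N : ℝ))⁻¹) ^ 2 = K ^ 2 * (N : ℝ)⁻¹ := by
      rw [mul_pow, inv_pow, Real.sq_sqrt (by positivity)]
    rw [← h2]
    exact sq_le_sq' (by linarith [(abs_le.1 h1).1]) (abs_le.1 h1).2

/-- The static norm of the field may be of order `√N`, so the static bound is useless; the dynamic
bound gains `1 / N` and leaves `N^{-1/2}`. -/
theorem Negligible.exchange_sub (hρ : 1 / 2 < ρ) (hρ' : ρ < 1) (hη : IsDiffusiveFamily ρ P η)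
    (hG : IsTest G R C L) (ht : 0 ≤ t) {f : Config → ℝ} (hf : IsLocal f) (x : ℤ) :
    Negligible G t P η fun ζ => f (exchange x ζ) - f ζ := by
  obtain ⟨M, hM0, hM⟩ := hf.bounded
  have hC := hG.nonneg
  have hV : IsLocal fun ζ => f (exchange x ζ) - f ζ := (hf.comp_exchange x).sub hf
  set κ := C * M * √(2 * R + 1) with hκ
  set A := (2 * R + 1) * C * (2 * M) with hA
  refine Negligible.of_le
    (b := fun N => 2 * t * (A * (t + 2) * κ) * (√(N : ℝ))⁻¹) ?_ fun N hN => ?_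
  · have h1 : Tendsto (fun N : ℕ => (√(N : ℝ))⁻¹) atTop (𝓝 0) :=
      (Real.tendsto_sqrt_atTop.comp tendsto_natCast_atTop_atTop).inv_tendsto_atTop
    simpa using h1.const_mul (2 * t * (A * (t + 2) * κ))
  · have hN0 : (0 : ℝ) < N := by exact_mod_cast hN
    have hl := hG.isLocal_field N hV
    refine ((hη N).integral_sq_le_dynamic hρ hρ' (by positivity) hl ht (κ := κ) (by positivity)
      ((sites R N).image fun y => x - y) fun u hu =>
        hG.integral_field_exchange_mul_le hρ hρ' hN hf hM x hu).trans ?_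
    have hb : √(∫ ζ, field N G (fun ζ => f (exchange x ζ) - f ζ) ζ ^ 2 ∂stationaryMeasure ρ) ≤
        A * √(N : ℝ) := by
      refine Real.sqrt_le_iff.2 ⟨by positivity, ?_⟩
      refine (integral_mono ((hl.map₂ hl fun a _ => a ^ 2).integrable _)
        (integrable_const ((A * √(N : ℝ)) ^ 2)) fun ζ => ?_).trans (by simp)
      have h1 := hG.abs_field_le hN (V := fun ζ => f (exchange x ζ) - f ζ) (M := 2 * M)
        (fun ζ => (abs_sub _ _).trans (by linarith [hM ζ, hM (exchange x ζ)])) ζ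
      exact sq_le_sq' (by linarith [(abs_le.1 h1).1]) (abs_le.1 h1).2
    -- The intensity is `N ^ 2`, so `κ / √p` is `κ / N`.
    rw [Real.sqrt_sq hN0.le]
    calc _ ≤ 2 * t * (A * √(N : ℝ) * (t + 2) * (κ / N)) := by gcongr
      _ = 2 * t * (A * (t + 2) * κ) * (√(N : ℝ))⁻¹ := by
        have h2 : √(N : ℝ) ≠ 0 := (Real.sqrt_pos.2 hN0).ne'
        rw [show κ / N = κ / (√(N : ℝ) * √(N : ℝ)) by rw [Real.mul_self_sqrt hN0.le]]
        field_simp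

/-- For a fixed `g` the part `V - g` disappears as `N → ∞`, and what remains is bounded by the
static variance of the field of `g`, small uniformly in `N`. -/
theorem Negligible.of_approx (hρ : 1 / 2 < ρ) (hρ' : ρ < 1) (hη : IsDiffusiveFamily ρ P η)
    (hG : IsTest G R C L) (ht : 0 ≤ t) {V : Config → ℝ} (hV : IsLocal V)
    (h : ∀ ε > 0, ∃ g, IsLocal g ∧ Negligible G t P η (fun ζ => V ζ - g ζ) ∧
      ∀ N ≥ 1, ∫ ζ, field N G g ζ ^ 2 ∂stationaryMeasure ρ ≤ ε) : Negligible G t P η V := by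
  rw [Negligible, Metric.tendsto_atTop]
  intro ε hε
  -- With this choice the static bound `2 t ^ 2 * (…)` is at most `ε / 4`; the summand `1` avoids a
  -- division by zero.
  obtain ⟨g, hg, hn, hb⟩ := h (ε / (8 * t ^ 2 + 1)) (by positivity)
  obtain ⟨N₀, hN₀⟩ := Metric.tendsto_atTop.1 hn (ε / 4) (by positivity)
  refine ⟨max N₀ 1, fun N hN => ?_⟩
  have h1 := hN₀ N (le_of_max_le_left hN)
  have h2 := hb N (le_of_max_le_right hN)
  have h3 := integral_sq_integratedField_le (t := t) hρ hρ' hη hG ht hg N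
  have h4 := integral_sq_integratedField_add_le (t := t) hη hG (hV.sub hg) hg N
  simp only [sub_add_cancel] at h4
  have h0 : ∀ W : Config → ℝ, 0 ≤ ∫ ω, (integratedField N G W (η N) t ω) ^ 2 ∂(P N) :=
    fun W => integral_nonneg fun _ => sq_nonneg _
  rw [Real.dist_eq, sub_zero, abs_of_nonneg (h0 _)] at h1 ⊢
  have h5 : 2 * t ^ 2 * ∫ ζ, field N G g ζ ^ 2 ∂stationaryMeasure ρ ≤ ε / 4 := by
    calc _ ≤ 2 * t ^ 2 * (ε / (8 * t ^ 2 + 1)) := by gcongr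
      _ ≤ ε / 4 := by
        rw [← mul_div_assoc, div_le_div_iff₀ (by positivity) (by positivity)]
        nlinarith
  have h6 : ε / 4 + ε / 4 = ε / 2 := by ring
  linarith

end Negligible

/-! ### Words in the letters `1` and `01` -/

section Words

/-- The number of sites covered by a word: the letter `true` stands for the pattern `1`, the letter
`false` for the pattern `01`. -/
def wordSize : List Bool → ℕ
  | [] => 0
  | true :: w => wordSize w + 1
  | false :: w => wordSize w + 2

/-- The indicator that the patterns of the letters of the word are read from `b + 1` on. -/
def letters (b : ℤ) : List Bool → Config → ℝ
  | [], _ => 1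
  | true :: w, η => occ η (b + 1) * letters (b + 1) w η
  | false :: w, η => (1 - occ η (b + 1)) * occ η (b + 2) * letters (b + 2) w η

/-- The indicator that a particle sits at `b` and is followed by the patterns of the word. -/
def word (b : ℤ) (w : List Bool) (η : Config) : ℝ := occ η b * letters b w η

theorem wordSize_append (v w : List Bool) : wordSize (v ++ w) = wordSize v + wordSize w := by
  induction v with
  | nil => simp [wordSize]
  | cons a v ih => cases a <;> simp [wordSize, ih] <;> ring

theorem wordSize_le (w : List Bool) : wordSize w ≤ 2 * w.length := by
  induction w with
  | nil => simp [wordSize]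
  | cons a v ih => cases a <;> simp [wordSize] <;> omega

theorem letters_append (b : ℤ) (v w : List Bool) (η : Config) :
    letters b (v ++ w) η = letters b v η * letters (b + wordSize v) w η := by
  induction v generalizing b with
  | nil => simp [letters, wordSize]
  | cons a v ih =>
    cases a <;> simp only [List.cons_append, letters, wordSize, ih] <;> push_cast
    · rw [show b + 2 + (wordSize v : ℤ) = b + (wordSize v + 2) by ring]; ring
    · rw [show b + 1 + (wordSize v : ℤ) = b + (wordSize v + 1) by ring]; ring

theorem word_append (b : ℤ) (v w : List Bool) (η : Config) :
    word b (v ++ w) η = word b v η * letters (b + wordSize v) w η := by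
  rw [word, letters_append, ← mul_assoc, ← word]

theorem occ_mul_self (η : Config) (x : ℤ) : occ η x * occ η x = occ η x := by
  unfold occ; split_ifs <;> norm_num

theorem word_cons_true (b : ℤ) (w : List Bool) (η : Config) :
    word b (true :: w) η = occ η b * word (b + 1) w η := rfl

theorem word_cons_false (b : ℤ) (w : List Bool) (η : Config) :
    word b (false :: w) η = occ η b * (1 - occ η (b + 1)) * word (b + 2) w η := by
  simp only [word, letters]; ring

/-- Both letters end with a particle, so reading can always resume after a word. -/
theorem word_mul_occ_end (b : ℤ) (w : List Bool) (η : Config) :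
    word b w η * occ η (b + wordSize w) = word b w η := by
  induction w generalizing b with
  | nil => simp [word, letters, wordSize, occ_mul_self]
  | cons a w ih =>
    cases a
    · have := ih (b + 2)
      rw [word_cons_false, wordSize, mul_assoc,
        show b + ((wordSize w + 2 : ℕ) : ℤ) = b + 2 + wordSize w by push_cast; ring, this]
    · have := ih (b + 1)
      rw [word_cons_true, wordSize, mul_assoc,
        show b + ((wordSize w + 1 : ℕ) : ℤ) = b + 1 + wordSize w by push_cast; ring, this]

theorem dependsOn_letters (b : ℤ) (w : List Bool) :
    DependsOn (letters b w) (Set.Icc (b + 1) (b + wordSize w)) := by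
  induction w generalizing b with
  | nil => intro _ _ _; rfl
  | cons a w ih =>
    intro η ζ h
    simp only [Set.mem_Icc] at h
    cases a <;> simp only [wordSize] at h <;> push_cast at h <;> simp only [letters]
    · rw [occ_eq_of_eq (h (b + 1) (by omega)), occ_eq_of_eq (h (b + 2) (by omega)),
        ih (b + 2) fun i hi => h i (by simp only [Set.mem_Icc] at hi; omega)]
    · rw [occ_eq_of_eq (h (b + 1) (by omega)),
        ih (b + 1) fun i hi => h i (by simp only [Set.mem_Icc] at hi; omega)]

theorem dependsOn_word (b : ℤ) (w : List Bool) :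
    DependsOn (word b w) (Set.Icc b (b + wordSize w)) := by
  intro η ζ h
  rw [word, word, occ_eq_of_eq (h b (by simp)), dependsOn_letters b w fun i hi => h i (by
    simp only [Set.mem_Icc] at hi ⊢; omega)]

theorem isLocal_word (b : ℤ) (w : List Bool) : IsLocal (word b w) :=
  isLocal_of_dependsOn_Icc (dependsOn_word b w)

theorem word_mul_self (b : ℤ) (w : List Bool) (η : Config) :
    word b w η * word b w η = word b w η := by
  induction w generalizing b with
  | nil => simp [word, letters, occ_mul_self]
  | cons a w ih =>
    cases a
    · rw [word_cons_false]
      have h : (1 - occ η (b + 1)) * (1 - occ η (b + 1)) = 1 - occ η (b + 1) := by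
        unfold occ; split_ifs <;> norm_num
      calc _ = (occ η b * occ η b) * ((1 - occ η (b + 1)) * (1 - occ η (b + 1))) *
            (word (b + 2) w η * word (b + 2) w η) := by ring
        _ = _ := by rw [occ_mul_self, h, ih]
    · rw [word_cons_true]
      calc _ = (occ η b * occ η b) * (word (b + 1) w η * word (b + 1) w η) := by ring
        _ = _ := by rw [occ_mul_self, ih]

/-- The reading of letters is deterministic: two words with equally many letters and the same
starting point exclude each other from the first letter where they differ, even if they cover
different numbers of sites. -/
theorem word_mul_word_of_ne (b : ℤ) {v w : List Bool} (hl : v.length = w.length) (h : v ≠ w)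
    (η : Config) : word b v η * word b w η = 0 := by
  induction v generalizing b w with
  | nil =>
    exact absurd (List.length_eq_zero_iff.1 hl.symm).symm h
  | cons a v ih =>
    cases w with
    | nil => simp at hl
    | cons a' w =>
      have hl' : v.length = w.length := by simpa using hl
      have hc : ∀ v w, word b (true :: v) η * word b (false :: w) η = 0 := by
        intro v w
        have : occ η (b + 1) * (1 - occ η (b + 1)) = 0 := by unfold occ; split_ifs <;> norm_num
        simp only [word, letters]
        linear_combination (occ η b * letters (b + 1) v η * (occ η b * occ η (b + 2) *
          letters (b + 2) w η)) * this
      cases a <;> cases a'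
      · have := ih (b + 2) hl' fun e => h (by rw [e])
        rw [word_cons_false, word_cons_false]
        linear_combination (occ η b * (1 - occ η (b + 1))) ^ 2 * this
      · rw [mul_comm]; exact hc _ _
      · exact hc _ _
      · have := ih (b + 1) hl' fun e => h (by rw [e])
        rw [word_cons_true, word_cons_true]
        linear_combination (occ η b) ^ 2 * this

theorem word_concat_true (b : ℤ) (w : List Bool) (η : Config) :
    word b (w ++ [true]) η = word b w η * occ η (b + wordSize w + 1) := by
  rw [word_append]; simp [letters]

theorem Ergodic.one_sub_occ_mul {η : Config} (hη : Ergodic η) (x : ℤ) :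
    (1 - occ η x) * occ η (x + 1) = 1 - occ η x := by
  unfold occ
  rcases hη x with h | h <;> simp [h]

theorem Ergodic.occ_mul_one_sub {η : Config} (hη : Ergodic η) (x : ℤ) :
    occ η x * (1 - occ η (x + 1)) = 1 - occ η (x + 1) := by
  unfold occ
  rcases hη x with h | h <;> simp [h]

theorem Ergodic.word_concat_false {η : Config} (hη : Ergodic η) (b : ℤ) (w : List Bool) :
    word b (w ++ [false]) η = word b w η * (1 - occ η (b + wordSize w + 1)) := by
  rw [word_append]
  have := hη.one_sub_occ_mul (b + wordSize w + 1)
  rw [show b + (wordSize w : ℤ) + 1 + 1 = b + wordSize w + 2 by ring] at this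
  simp only [letters, mul_one, this]

theorem translate_word (x b : ℤ) (w : List Bool) (η : Config) :
    translate x (word b w) η = word (b - x) w η := by
  induction w generalizing b with
  | nil => rfl
  | cons a w ih =>
    simp only [translate] at ih ⊢
    have ho : ∀ z, occ (fun y => η (y - x)) z = occ η (z - x) := fun _ => rfl
    cases a
    · rw [word_cons_false, word_cons_false, ih, show b + 2 - x = b - x + 2 by ring, ho, ho,
        show b + 1 - x = b - x + 1 by ring]
    · rw [word_cons_true, word_cons_true, ih, show b + 1 - x = b - x + 1 by ring]
      rfl

/-- The exchange dynamics exchanges adjacent letters. -/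
theorem word_exchange (b : ℤ) (u v : List Bool) (η : Config) :
    word b (u ++ true :: false :: v) (exchange (b + wordSize u + 1) η) =
      word b (u ++ false :: true :: v) η := by
  rw [word_append, word_append]
  set e := b + (wordSize u : ℤ) with he
  have h1 : word b u (exchange (e + 1) η) = word b u η := by
    refine dependsOn_word b u fun i hi => exchange_of_ne η ?_ ?_ <;>
    · simp only [Set.mem_Icc] at hi; omega
  have h2 : letters (e + 3) v (exchange (e + 1) η) = letters (e + 3) v η := by
    refine dependsOn_letters _ v fun i hi => exchange_of_ne η ?_ ?_ <;>
    · simp only [Set.mem_Icc] at hi; omega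
  have h3 : occ (exchange (e + 1) η) (e + 3) = occ η (e + 3) :=
    occ_eq_of_eq (exchange_of_ne η (by omega) (by omega))
  simp only [letters, show e + 1 + 1 = e + 2 by ring, show e + 1 + 2 = e + 3 by ring,
    show e + 2 + 1 = e + 3 by ring]
  rw [h1, h2, h3, ← word_mul_occ_end b u η, ← he]
  by_cases h : η e = true ∧ η (e + 3) = true
  · have hx : exchange (e + 1) η = swap η (e + 1) (e + 2) := by
      rw [exchange, if_pos, show e + 1 + 1 = e + 2 by ring]
      rwa [show e + 1 - 1 = e by ring, show e + 1 + 2 = e + 3 by ring]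
    have e1 : occ (exchange (e + 1) η) (e + 1) = occ η (e + 2) := by
      rw [hx, ← show e + 1 + 1 = e + 2 by ring]; unfold occ; rw [swap_left]
    have e2 : occ (exchange (e + 1) η) (e + 2) = occ η (e + 1) := by
      rw [hx, ← show e + 1 + 1 = e + 2 by ring]; unfold occ; rw [swap_right]
    rw [e1, e2]; ring
  -- If one end of the window is empty, no exchange occurs and both words vanish.
  · have : occ η e * occ η (e + 3) = 0 := by
      unfold occ
      rw [not_and_or] at h
      rcases h with h | h <;> simp [h]
    linear_combination (word b u η * occ (exchange (e + 1) η) (e + 1) *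
      (1 - occ (exchange (e + 1) η) (e + 2)) * letters (e + 3) v η -
      word b u η * (1 - occ η (e + 1)) * occ η (e + 2) * letters (e + 3) v η) * this

open Polynomial in
/-- The weight of a word as a polynomial in the probability of the letter `false`. -/
noncomputable def wordPoly (w : List Bool) : ℝ[X] :=
  (w.map fun c => if c then 1 - Polynomial.X else Polynomial.X).prod

/-- The probability of the letter `false` at density `ρ`. -/
noncomputable def hole (ρ : ℝ) : ℝ := (1 - ρ) / ρ

theorem one_sub_activity {ρ : ℝ} (hρ : 1 / 2 < ρ) : 1 - activity ρ = hole ρ := by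
  have : ρ ≠ 0 := by linarith
  unfold activity hole; field_simp; ring

/-- The Markov chain renews itself at each particle: given what lies up to a particle at `b`, the
letters after `b` are independent. -/
theorem integral_mul_word {ρ : ℝ} (hρ : 1 / 2 < ρ) (hρ' : ρ < 1) {z b : ℤ} (hz : z ≤ b)
    {φ : Config → ℝ} (hφ : DependsOn φ (Set.Icc z b)) (w : List Bool) :
    ∫ η, φ η * word b w η ∂stationaryMeasure ρ =
      (wordPoly w).eval (hole ρ) * ∫ η, φ η * occ η b ∂stationaryMeasure ρ := by
  induction w using List.reverseRecOn with
  | nil => simp [wordPoly, word, letters]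
  | append_singleton w a ih =>
    obtain ⟨n, hn⟩ : ∃ n : ℕ, b + (wordSize w : ℤ) = z + n :=
      ⟨(b + wordSize w - z).toNat, by omega⟩
    have hd : DependsOn (fun η => φ η * word b w η) (Set.Icc z (z + n)) := by
      intro η ζ h
      simp only [Set.mem_Icc] at h
      simp only
      rw [hφ fun i hi => h i (by simp only [Set.mem_Icc] at hi; omega),
        dependsOn_word b w fun i hi => h i (by simp only [Set.mem_Icc] at hi; omega)]
    -- A word ends with a particle, so the next transition always starts from `true`.
    have hstep : ∀ c : Bool, ∫ η, φ η * word b w η * (if η (z + n + 1) = c then 1 else 0)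
        ∂stationaryMeasure ρ = tr ρ true c * ∫ η, φ η * word b w η ∂stationaryMeasure ρ := by
      intro c
      rw [integral_mul_next hρ hρ' hd, ← integral_const_mul]
      refine integral_congr_ae (.of_forall fun η => ?_)
      have h := word_mul_occ_end b w η
      rw [hn] at h
      simp only
      rw [← h]
      cases hη : η (z + n)
      · simp [occ, hη]
      · ring
    have hp : (wordPoly (w ++ [a])).eval (hole ρ) = tr ρ true a * (wordPoly w).eval (hole ρ) := by
      simp only [wordPoly, List.map_append, List.prod_append, Polynomial.eval_mul, List.map_cons,
        List.map_nil, List.prod_singleton]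
      rw [mul_comm]
      congr 1
      cases a
      · simp [tr, one_sub_activity hρ]
      · simp [tr, ← one_sub_activity hρ]
    rw [hp, mul_assoc, ← ih, ← hstep a]
    refine integral_congr_ae ?_
    filter_upwards [ae_ergodic hρ hρ'] with η hη
    cases a
    · rw [hη.word_concat_false, hn]
      cases h : η (z + n + 1) <;> simp [occ, h]
    · rw [word_concat_true, hn]
      cases h : η (z + n + 1) <;> simp [occ, h]

theorem integral_word {ρ : ℝ} (hρ : 1 / 2 < ρ) (hρ' : ρ < 1) (b : ℤ) (w : List Bool) :
    ∫ η, word b w η ∂stationaryMeasure ρ = ρ * (wordPoly w).eval (hole ρ) := by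
  have := integral_mul_word hρ hρ' le_rfl (φ := fun _ => 1) (z := b) (b := b)
    (fun _ _ _ => rfl) w
  simp only [one_mul, integral_occ hρ hρ'] at this
  rw [this, mul_comm]

/-- Local functions are generated by words, up to their values on configurations with two adjacent
empty sites. -/
theorem word_induction {p : (Config → ℝ) → Prop}
    (hword : ∀ b w, p (word b w))
    (hadd : ∀ f g, IsLocal f → IsLocal g → p f → p g → p fun η => f η + g η)
    (hsmul : ∀ (c : ℝ) f, IsLocal f → p f → p fun η => c * f η)
    (hcongr : ∀ f g, IsLocal f → IsLocal g → (∀ η, Ergodic η → f η = g η) → p f → p g)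
    {ψ : Config → ℝ} (hψ : IsLocal ψ) : p ψ := by
  -- Strong induction on the number `n` of sites beyond the word that `φ` may still read; a letter
  -- uses up one or two of them.
  have key : ∀ (n : ℕ) (b : ℤ) (w : List Bool) (φ : Config → ℝ),
      DependsOn φ (Set.Icc (b + wordSize w + 1) (b + wordSize w + n)) →
      p fun η => word b w η * φ η := by
    intro n
    induction n using Nat.strong_induction_on with
    | _ n ih =>
      intro b w φ hφ
      set e := b + (wordSize w : ℤ) with he
      rcases Nat.eq_zero_or_pos n with rfl | hn
      · have hc : ∀ η, φ η = φ fun _ => true := fun η => hφ fun i hi => by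
          simp only [Set.mem_Icc] at hi; omega
        have : (fun η => word b w η * φ η) = fun η => φ (fun _ => true) * word b w η := by
          ext η; rw [hc η, mul_comm]
        rw [this]
        exact hsmul _ _ (isLocal_word b w) (hword b w)
      -- The next letter is substituted into `φ`, which then no longer depends on the sites covered
      -- by that letter.
      · set φ₁ : Config → ℝ := fun η => φ (Function.update η (e + 1) true) with hφ₁
        set φ₀ : Config → ℝ := fun η =>
          φ (Function.update (Function.update η (e + 1) false) (e + 2) true) with hφ₀
        have d1 : DependsOn φ₁ (Set.Icc (e + 1 + 1) (e + 1 + (n - 1 : ℕ))) := by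
          intro η ζ h
          refine hφ fun i hi => ?_
          simp only [Set.mem_Icc] at hi h
          by_cases h1 : i = e + 1
          · rw [h1, Function.update_self, Function.update_self]
          · rw [Function.update_of_ne h1, Function.update_of_ne h1]
            exact h i (by omega)
        -- For `n = 1` the letter `01` overshoots the support of `φ`; the truncated difference `n -
        -- 2 = 0` is then the right value.
        have d0 : DependsOn φ₀ (Set.Icc (e + 2 + 1) (e + 2 + (n - 2 : ℕ))) := by
          intro η ζ h
          refine hφ fun i hi => ?_
          simp only [Set.mem_Icc] at hi h
          by_cases h2 : i = e + 2
          · rw [h2, Function.update_self, Function.update_self]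
          · rw [Function.update_of_ne h2, Function.update_of_ne h2]
            by_cases h1 : i = e + 1
            · rw [h1, Function.update_self, Function.update_self]
            · rw [Function.update_of_ne h1, Function.update_of_ne h1]
              exact h i (by omega)
        have s1 : b + (wordSize (w ++ [true]) : ℤ) = e + 1 := by
          rw [wordSize_append, he]; simp [wordSize]; ring
        have s0 : b + (wordSize (w ++ [false]) : ℤ) = e + 2 := by
          rw [wordSize_append, he]; simp [wordSize]; ring
        have p1 := ih (n - 1) (by omega) b (w ++ [true]) φ₁ (by rw [s1]; exact d1)
        have l1 : IsLocal fun η => word b (w ++ [true]) η * φ₁ η :=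
          (isLocal_word _ _).mul (isLocal_of_dependsOn_Icc d1)
        have l0 : IsLocal fun η => word b (w ++ [false]) η * φ₀ η :=
          (isLocal_word _ _).mul (isLocal_of_dependsOn_Icc d0)
        have p0 := ih (n - 2) (by omega) b (w ++ [false]) φ₀ (by rw [s0]; exact d0)
        refine hcongr _ _ (l1.add l0) ((isLocal_word _ _).mul (isLocal_of_dependsOn_Icc hφ)) ?_
          (hadd _ _ l1 l0 p1 p0)
        intro η hη
        rw [word_concat_true, hη.word_concat_false, ← he]
        cases h : η (e + 1)
        · have h2 : η (e + 2) = true := by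
            have := hη (e + 1)
            rw [show e + 1 + 1 = e + 2 by ring] at this
            simpa [h] using this
          have : Function.update (Function.update η (e + 1) false) (e + 2) true = η := by
            rw [← h, Function.update_eq_self, ← h2, Function.update_eq_self]
          simp [occ, h, hφ₀, this]
        · have : Function.update η (e + 1) true = η := by rw [← h, Function.update_eq_self]
          simp [occ, h, hφ₁, this]
  obtain ⟨n, -, hn⟩ := hψ.exists_box 0
  -- To start the reading left of the box: there is a particle at `-n - 1`, or that site is empty
  -- and ergodicity puts one at `-n - 2`.
  have l1 : IsLocal fun η => word (-n - 1) [] η * ψ η := (isLocal_word _ _).mul hψ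
  have lo : IsLocal fun η => (1 - occ η (-n - 1)) * ψ η :=
    ((isLocal_const 1).sub (isLocal_occ _)).mul hψ
  have l0 : IsLocal fun η => word (-n - 2) [] η * ((1 - occ η (-n - 1)) * ψ η) :=
    (isLocal_word _ _).mul lo
  have p1 := key (2 * n + 1) (-n - 1) [] ψ (hn.mono (Set.Icc_subset_Icc
    (by simp [wordSize]) (by simp [wordSize]; omega)))
  have p0 := key (2 * n + 2) (-n - 2) [] (fun η => (1 - occ η (-n - 1)) * ψ η) (by
    intro η ζ h
    simp only [wordSize, Set.mem_Icc] at h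
    push_cast at h
    simp only
    rw [occ_eq_of_eq (h (-n - 1) (by omega)), hn fun i hi => h i (by
      simp only [Set.mem_Icc] at hi; omega)])
  refine hcongr _ _ (l1.add l0) hψ (fun η hη => ?_) (hadd _ _ l1 l0 p1 p0)
  have := hη.occ_mul_one_sub (-n - 2)
  rw [show -(n : ℤ) - 2 + 1 = -n - 1 by ring] at this
  simp only [word, letters, mul_one]
  linear_combination ψ η * this

end Words

/-! ### Linear combinations of words and the variance of their fields -/

section WordSums

variable {ρ : ℝ} {ι : Type*} [Fintype ι]

/-- A linear combination of words based at `b`. -/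
noncomputable def wordSum (c : ι → ℝ) (W : ι → List Bool) (b : ℤ) (η : Config) : ℝ :=
  ∑ i, c i * word b (W i) η

theorem isLocal_wordSum (c : ι → ℝ) (W : ι → List Bool) (b : ℤ) : IsLocal (wordSum c W b) := by
  have := IsLocal.sum (f := fun i η => c i * word b (W i) η) Finset.univ
    fun i _ => (isLocal_word b (W i)).smul (c i)
  convert this using 1
  ext η
  simp [wordSum]

theorem translate_wordSum (x b : ℤ) (c : ι → ℝ) (W : ι → List Bool) (η : Config) :
    translate x (wordSum c W b) η = wordSum c W (b - x) η := by
  have : ∀ i, word b (W i) (fun y => η (y - x)) = word (b - x) (W i) η := fun i =>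
    translate_word x b (W i) η
  simp only [translate, wordSum, this]

theorem dependsOn_wordSum (c : ι → ℝ) {W : ι → List Bool} {n : ℕ} (hn : ∀ i, (W i).length = n)
    (b : ℤ) : DependsOn (wordSum c W b) (Set.Icc b (b + (2 * n : ℕ))) := by
  intro η ζ h
  refine Finset.sum_congr rfl fun i _ => ?_
  rw [dependsOn_word b (W i) fun j hj => h j ?_]
  have := wordSize_le (W i)
  rw [hn] at this
  simp only [Set.mem_Icc] at hj ⊢
  omega

/-- The letters after `b` are independent of `φ`, so the vanishing of the mean of the combination
makes it centred given the past. -/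
theorem integral_mul_wordSum (hρ : 1 / 2 < ρ) (hρ' : ρ < 1) (c : ι → ℝ) {W : ι → List Bool}
    (hc : ∑ i, c i * (wordPoly (W i)).eval (hole ρ) = 0) {z b : ℤ} (hz : z ≤ b)
    {φ : Config → ℝ} (hφ : DependsOn φ (Set.Icc z b)) :
    ∫ η, φ η * wordSum c W b η ∂stationaryMeasure ρ = 0 := by
  have hl := isLocal_of_dependsOn_Icc hφ
  simp only [wordSum, Finset.mul_sum]
  rw [integral_finsetSum _ fun i _ => (hl.mul ((isLocal_word b (W i)).smul (c i))).integrable _]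
  have : ∀ i, ∫ η, φ η * (c i * word b (W i) η) ∂stationaryMeasure ρ =
      c i * (wordPoly (W i)).eval (hole ρ) * ∫ η, φ η * occ η b ∂stationaryMeasure ρ := by
    intro i
    rw [mul_assoc, ← integral_mul_word hρ hρ' hz hφ, ← integral_const_mul]
    exact integral_congr_ae (.of_forall fun η => by ring)
  simp only [this]
  rw [← Finset.sum_mul, hc, zero_mul]

/-- Distinct words with equally many letters are indicators of disjoint events, so there are no
cross terms. -/
theorem integral_wordSum_sq (hρ : 1 / 2 < ρ) (hρ' : ρ < 1) (c : ι → ℝ) {W : ι → List Bool} {n : ℕ}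
    (hW : Function.Injective W) (hn : ∀ i, (W i).length = n) (b : ℤ) :
    ∫ η, wordSum c W b η ^ 2 ∂stationaryMeasure ρ =
      ρ * ∑ i, c i ^ 2 * (wordPoly (W i)).eval (hole ρ) := by
  have e : ∀ η, wordSum c W b η ^ 2 = ∑ i, c i ^ 2 * word b (W i) η := by
    intro η
    rw [wordSum, sq, Finset.sum_mul_sum]
    refine Finset.sum_congr rfl fun i _ => ?_
    rw [Finset.sum_eq_single i]
    · linear_combination c i ^ 2 * word_mul_self b (W i) η
    · intro j _ hj
      have := word_mul_word_of_ne b ((hn i).trans (hn j).symm) (fun h => hj (hW h).symm) η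
      linear_combination c i * c j * this
    · simp
  simp only [e]
  rw [integral_finsetSum _ fun i _ => ((isLocal_word b (W i)).smul _).integrable _, Finset.mul_sum]
  refine Finset.sum_congr rfl fun i _ => ?_
  rw [integral_const_mul, integral_word hρ hρ']
  ring

/-- The variance of the field of a linear combination of words which is centred given the past. -/
theorem IsTest.integral_field_wordSum_sq_le {G : ℝ → ℝ} {R : ℕ} {C L : ℝ} (hG : IsTest G R C L)
    (hρ : 1 / 2 < ρ) (hρ' : ρ < 1) (c : ι → ℝ)
    {W : ι → List Bool} {n : ℕ} (hW : Function.Injective W) (hn : ∀ i, (W i).length = n)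
    (hc : ∑ i, c i * (wordPoly (W i)).eval (hole ρ) = 0) {D : ℝ}
    (hD : ∑ i, c i ^ 2 * (wordPoly (W i)).eval (hole ρ) ≤ D) {N : ℕ} (hN : 1 ≤ N) :
    ∫ η, field N G (wordSum c W 0) η ^ 2 ∂stationaryMeasure ρ ≤
      (2 * R + 1) * C ^ 2 * (4 * n + 1) * D := by
  have hN0 : (0 : ℝ) < N := by exact_mod_cast hN
  have hC := hG.nonneg
  set g : ℤ → Config → ℝ := fun x => wordSum c W (-x) with hg
  have hgl : ∀ x, IsLocal (g x) := fun x => isLocal_wordSum c W (-x)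
  have hgd : ∀ x, DependsOn (g x) (Set.Icc (-x) (-x + (2 * n : ℕ))) :=
    fun x => dependsOn_wordSum c hn (-x)
  have hg2 : ∀ x, ∫ η, g x η ^ 2 ∂stationaryMeasure ρ ≤ D := by
    intro x
    have h0 : 0 ≤ ∫ η, g x η ^ 2 ∂stationaryMeasure ρ := integral_nonneg fun _ => sq_nonneg _
    have h1 := integral_wordSum_sq hρ hρ' c hW hn (-x)
    set S := ∑ i, c i ^ 2 * (wordPoly (W i)).eval (hole ρ)
    simp only [hg] at h0 ⊢
    rw [h1] at h0 ⊢
    have hS : 0 ≤ S := nonneg_of_mul_nonneg_right h0 (by linarith)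
    nlinarith
  have hD0 : 0 ≤ D := (integral_nonneg fun _ => sq_nonneg _).trans (hg2 0)
  -- Words of `n` letters reach at most `2 n` sites to the right of their base: beyond that distance
  -- the covariance is zero, and at most `4 n + 1` sites `y` interact with a given `x`.
  have hcorr : ∀ x y, |∫ η, g x η * g y η ∂stationaryMeasure ρ| ≤
      if |x - y| ≤ (2 * n : ℕ) then D else 0 := by
    intro x y
    split_ifs with h
    · have hle : ∀ φ : Config → ℝ, IsLocal φ → (∫ η, φ η ^ 2 ∂stationaryMeasure ρ ≤ D) →
          ∫ η, φ η * g y η ∂stationaryMeasure ρ ≤ D := by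
        intro φ hφ hφD
        refine (integral_mul_le_sqrt (hφ.memLp _ 2) ((hgl y).memLp _ 2)).trans ?_
        calc _ ≤ √D * √D := by gcongr; exact hg2 y
          _ = D := Real.mul_self_sqrt hD0
      have h1 := hle (g x) (hgl x) (hg2 x)
      have h2 := hle (fun η => -g x η) (hgl x).neg (by simpa using hg2 x)
      simp only [neg_mul, integral_neg] at h2
      exact abs_le.2 ⟨by linarith, h1⟩
    -- The factor `g x` is based at `-x`, to the left of `-y`, and is read entirely before the word
    -- based at `-y` starts.
    · have hlt : ∀ x y : ℤ, (2 * n : ℕ) < x - y →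
          ∫ η, g x η * g y η ∂stationaryMeasure ρ = 0 := by
        intro x y h
        exact integral_mul_wordSum hρ hρ' c hc (by omega)
          ((hgd x).mono (Set.Icc_subset_Icc le_rfl (by omega)))
      rw [not_le, lt_abs] at h
      rcases h with h | h
      · rw [hlt x y h, abs_zero]
      · have := hlt y x (by omega)
        simp only [mul_comm (g y _)] at this
        rw [this, abs_zero]
  have e : ∀ η, field N G (wordSum c W 0) η ^ 2 = (N : ℝ)⁻¹ * ∑ x ∈ sites R N, ∑ y ∈ sites R N,
      G ((x : ℝ) / N) * G ((y : ℝ) / N) * (g x η * g y η) := by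
    intro η
    rw [hG.field_eq, mul_pow, inv_pow, Real.sq_sqrt hN0.le, sq, Finset.sum_mul_sum]
    congr 1
    refine Finset.sum_congr rfl fun x _ => Finset.sum_congr rfl fun y _ => ?_
    rw [translate_wordSum, translate_wordSum, zero_sub, zero_sub]
    ring
  simp only [e]
  rw [integral_const_mul, integral_finsetSum _ fun x _ => integrable_finsetSum _ fun y _ =>
    (((hgl x).mul (hgl y)).integrable _).const_mul _]
  have hx : ∀ x ∈ sites R N, ∫ η, ∑ y ∈ sites R N,
      G ((x : ℝ) / N) * G ((y : ℝ) / N) * (g x η * g y η) ∂stationaryMeasure ρ ≤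
        C ^ 2 * ((4 * n + 1) * D) := by
    intro x _
    rw [integral_finsetSum _ fun y _ => (((hgl x).mul (hgl y)).integrable _).const_mul _]
    have hy : ∀ y ∈ sites R N, ∫ η, G ((x : ℝ) / N) * G ((y : ℝ) / N) * (g x η * g y η)
        ∂stationaryMeasure ρ ≤ C ^ 2 * if |x - y| ≤ (2 * n : ℕ) then D else 0 := by
      intro y _
      rw [integral_const_mul]
      refine (le_abs_self _).trans ?_
      rw [abs_mul, abs_mul, sq]
      gcongr
      · exact hG.bound _
      · exact hG.bound _
      · exact hcorr x y
    refine (Finset.sum_le_sum hy).trans ?_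
    rw [← Finset.mul_sum, ← Finset.sum_filter, Finset.sum_const, nsmul_eq_mul]
    have hcard : (((sites R N).filter fun y => |x - y| ≤ (2 * n : ℕ)).card : ℝ) ≤ 4 * n + 1 := by
      have hsub : ((sites R N).filter fun y => |x - y| ≤ (2 * n : ℕ)) ⊆
          Finset.Icc (x - (2 * n : ℕ)) (x + (2 * n : ℕ)) := by
        intro y hy
        have := abs_le.1 (Finset.mem_filter.1 hy).2
        rw [Finset.mem_Icc]
        omega
      have := Finset.card_le_card hsub
      rw [Int.card_Icc, show (x + ((2 * n : ℕ) : ℤ) + 1 - (x - ((2 * n : ℕ) : ℤ))).toNat =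
        4 * n + 1 by omega] at this
      exact_mod_cast this
    gcongr
  have hsum := Finset.sum_le_card_nsmul _ _ _ hx
  rw [nsmul_eq_mul] at hsum
  calc _ ≤ (N : ℝ)⁻¹ * (((2 * R + 1) * N) * (C ^ 2 * ((4 * n + 1) * D))) := by
        gcongr
        exact hsum.trans (by gcongr; exact card_sites_le hN)
    _ = _ := by field_simp

end WordSums

/-! ### Averages of independent letters -/

section Averages

open Polynomial

/-- The centred number of letters `false`. -/
noncomputable def excess (y : ℝ) (c : Bool) : ℝ := (if c then 0 else 1) - y

/-- The average over a word of the centred number of letters `false`. -/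
noncomputable def meanExcess (y : ℝ) {l : ℕ} (v : Fin l → Bool) : ℝ :=
  (l : ℝ)⁻¹ * ∑ i, excess y (v i)

theorem wordPoly_ofFn {l : ℕ} (v : Fin l → Bool) :
    wordPoly (List.ofFn v) = ∏ i, if v i then 1 - X else (X : ℝ[X]) := by
  rw [wordPoly, List.map_ofFn, List.prod_ofFn]
  rfl

theorem wordPoly_append (v w : List Bool) : wordPoly (v ++ w) = wordPoly v * wordPoly w := by
  simp [wordPoly]

theorem sum_prod_bool {A : Type*} [CommRing A] {l : ℕ} (f : Fin l → Bool → A) :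
    ∑ v : Fin l → Bool, ∏ i, f i (v i) = ∏ i, (f i true + f i false) := by
  have := Finset.prod_univ_sum (fun _ : Fin l => (Finset.univ : Finset Bool)) f
  rw [Fintype.piFinset_univ] at this
  rw [← this]
  simp

theorem sum_wordPoly_ofFn_mul_excess {l : ℕ} (y : ℝ) (i : Fin l) :
    ∑ v : Fin l → Bool, C (excess y (v i)) * wordPoly (List.ofFn v) = X - C y := by
  classical
  -- The weights factorise over the letters: all factors but the `i`-th sum to `(1 - X) + X = 1`.
  have h := sum_prod_bool fun (j : Fin l) (c : Bool) =>
    (if j = i then C (excess y c) else 1) * if c then 1 - X else (X : ℝ[X])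
  simp only [Finset.prod_mul_distrib, Finset.prod_ite_eq', Finset.mem_univ, if_true] at h
  simp only [wordPoly_ofFn]
  rw [h, Finset.prod_eq_single i]
  · simp [excess]; ring
  · intro j _ hj
    simp [hj]
  · simp

/-- The identity holds for polynomials and not only at `X = y`: this is what represents `X - y` by
an average over arbitrarily long blocks. -/
theorem sum_meanExcess_mul_wordPoly {l : ℕ} (hl : 0 < l) (y : ℝ) :
    ∑ v : Fin l → Bool, C (meanExcess y v) * wordPoly (List.ofFn v) = X - C y := by
  have e : ∀ v : Fin l → Bool, C (meanExcess y v) * wordPoly (List.ofFn v) =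
      C (l : ℝ)⁻¹ * ∑ i, C (excess y (v i)) * wordPoly (List.ofFn v) := by
    intro v
    rw [meanExcess, C_mul, map_sum, mul_assoc, Finset.sum_mul]
  simp only [e]
  rw [← Finset.mul_sum, Finset.sum_comm]
  simp only [sum_wordPoly_ofFn_mul_excess]
  rw [Finset.sum_const, Finset.card_univ, Fintype.card_fin, nsmul_eq_mul, ← mul_assoc,
    ← C_eq_natCast, ← C_mul, inv_mul_cancel₀ (by positivity), C_1, one_mul]

/-- The variance of the average of `l` independent letters is `y (1 - y) / l`. -/
theorem sum_meanExcess_sq_mul_le {l : ℕ} (hl : 0 < l) {y : ℝ} (hy : 0 ≤ y) (hy' : y ≤ 1) :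
    ∑ v : Fin l → Bool, meanExcess y v ^ 2 * (wordPoly (List.ofFn v)).eval y ≤ (l : ℝ)⁻¹ := by
  classical
  have hw : ∀ v : Fin l → Bool, (wordPoly (List.ofFn v)).eval y = ∏ i, if v i then 1 - y else y := by
    intro v
    rw [wordPoly_ofFn, eval_prod]
    refine Finset.prod_congr rfl fun i _ => ?_
    split_ifs <;> simp
  have hij : ∀ i j : Fin l, ∑ v : Fin l → Bool, excess y (v i) * excess y (v j) *
      ∏ k, (if v k then 1 - y else y) = if i = j then y * (1 - y) else 0 := by
    intro i j
    have h := sum_prod_bool fun (k : Fin l) (c : Bool) =>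
      (if k = i then excess y c else 1) * (if k = j then excess y c else 1) *
        if c then 1 - y else y
    simp only [Finset.prod_mul_distrib, Finset.prod_ite_eq', Finset.mem_univ, if_true] at h
    rw [h]
    by_cases e : i = j
    · subst e
      rw [if_pos rfl, Finset.prod_eq_single i]
      · simp [excess]; ring
      · intro k _ hk
        simp [hk]
      · simp
    · rw [if_neg e]
      refine Finset.prod_eq_zero (Finset.mem_univ i) ?_
      simp [e, excess]; ring
  have hexp : ∀ v : Fin l → Bool, meanExcess y v ^ 2 * (wordPoly (List.ofFn v)).eval y =
      ((l : ℝ)⁻¹) ^ 2 * ∑ i, ∑ j, excess y (v i) * excess y (v j) *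
        ∏ k, (if v k then 1 - y else y) := by
    intro v
    rw [hw, meanExcess, mul_pow, sq (∑ i, _), Finset.sum_mul_sum, mul_assoc, Finset.sum_mul]
    congr 1
    exact Finset.sum_congr rfl fun i _ => Finset.sum_mul _ _ _
  simp only [hexp]
  rw [← Finset.mul_sum, Finset.sum_comm]
  have : ∀ i : Fin l, ∑ v : Fin l → Bool, ∑ j, excess y (v i) * excess y (v j) *
      ∏ k, (if v k then 1 - y else y) = y * (1 - y) := by
    intro i
    rw [Finset.sum_comm]
    simp [hij]
  simp only [this]
  rw [Finset.sum_const, Finset.card_univ, Fintype.card_fin, nsmul_eq_mul]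
  have hl0 : (0 : ℝ) < l := by exact_mod_cast hl
  have h1 : y * (1 - y) ≤ 1 := by nlinarith
  calc ((l : ℝ)⁻¹) ^ 2 * (l * (y * (1 - y))) ≤ ((l : ℝ)⁻¹) ^ 2 * (l * 1) := by gcongr
    _ = _ := by field_simp

end Averages

/-! ### Reduction of local functions to polynomials -/

section Reduction

open Polynomial

/-- A space of functions modulo which words depend only on their numbers of letters. -/
structure IsReducing (Z : Submodule ℝ (Config → ℝ)) : Prop where
  of_ergodic : ∀ {V : Config → ℝ}, IsLocal V → (∀ ζ, Ergodic ζ → V ζ = 0) → V ∈ Z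
  gradient : ∀ {f : Config → ℝ}, IsLocal f → (fun ζ => f ζ - translate 1 f ζ) ∈ Z
  exchange_sub : ∀ {f : Config → ℝ}, IsLocal f → ∀ x, (fun ζ => f (exchange x ζ) - f ζ) ∈ Z

/-- The linear map which sends `X ^ k` to the word made of `k` letters `false`. -/
noncomputable def polyField : ℝ[X] →ₗ[ℝ] (Config → ℝ) :=
  Polynomial.lsum fun k => LinearMap.toSpanSingleton ℝ _ (word 0 (List.replicate k false))

theorem polyField_X_pow (k : ℕ) : polyField (X ^ k) = word 0 (List.replicate k false) := by
  rw [polyField, lsum_apply, ← monomial_one_right_eq_X_pow, sum_monomial_index _ _ (by simp)]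
  simp

theorem isLocal_polyField (Q : ℝ[X]) : IsLocal (polyField Q) := by
  induction Q using Polynomial.induction_on' with
  | add p q hp hq =>
    rw [map_add]
    exact hp.add hq
  | monomial n a =>
    rw [← C_mul_X_pow_eq_monomial, ← smul_eq_C_mul, map_smul, polyField_X_pow]
    exact (isLocal_word 0 _).smul a

variable {Z : Submodule ℝ (Config → ℝ)}

theorem IsReducing.word_sub_word_zero (hZ : IsReducing Z) (b : ℤ) (w : List Bool) :
    word b w - word 0 w ∈ Z := by
  have hs : ∀ c, word c w - word (c - 1) w ∈ Z := fun c => by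
    have h := hZ.gradient (isLocal_word c w)
    simp only [translate_word] at h
    exact h
  induction b using Int.induction_on with
  | zero => simp
  | succ n ih =>
    have := hs (n + 1)
    rw [add_sub_cancel_right] at this
    simpa using Z.add_mem this ih
  | pred n ih => simpa using Z.sub_mem ih (hs (-n))

/-- Permutations are generated by adjacent transpositions, and transposing two different letters is
an exchange of the dynamics. The prefix `u` is carried along so that the induction can pass under a
common first letter. -/
theorem IsReducing.word_append_sub_of_perm (hZ : IsReducing Z) {v w : List Bool}
    (h : v.Perm w) (u : List Bool) : word 0 (u ++ v) - word 0 (u ++ w) ∈ Z := by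
  have hs : ∀ u v : List Bool,
      word 0 (u ++ false :: true :: v) - word 0 (u ++ true :: false :: v) ∈ Z := fun u v => by
    have h := hZ.exchange_sub (isLocal_word 0 (u ++ true :: false :: v)) (0 + wordSize u + 1)
    simp only [word_exchange] at h
    exact h
  induction h generalizing u with
  | nil => simp
  | cons x _ ih => simpa using ih (u ++ [x])
  | swap x y l =>
    cases x <;> cases y
    · simp
    · simpa using Z.neg_mem (hs u l)
    · exact hs u l
    · simp
  | trans _ _ ih₁ ih₂ => simpa using Z.add_mem (ih₁ u) (ih₂ u)

/-- On an ergodic configuration a particle is followed by exactly one of the two letters. -/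
theorem IsReducing.word_sub_concat (hZ : IsReducing Z) (w : List Bool) :
    word 0 w - word 0 (w ++ [true]) - word 0 (w ++ [false]) ∈ Z := by
  refine hZ.of_ergodic (((isLocal_word 0 w).sub (isLocal_word 0 _)).sub (isLocal_word 0 _))
    fun ζ hζ => ?_
  simp only [Pi.sub_apply]
  rw [word_concat_true, hζ.word_concat_false]
  ring

/-- A letter `1` is moved to the end of the word, where it equals no constraint minus the letter
`01`: it acts as multiplication by `1 - X`. -/
theorem IsReducing.word_replicate_sub (hZ : IsReducing Z) (k : ℕ) (w : List Bool) :
    word 0 (List.replicate k false ++ w) - polyField (X ^ k * wordPoly w) ∈ Z := by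
  induction w generalizing k with
  | nil => simp [wordPoly, polyField_X_pow]
  | cons a w ih =>
    cases a
    · have h := ih (k + 1)
      rw [List.replicate_succ', List.append_assoc, pow_succ, mul_assoc] at h
      simpa [wordPoly] using h
    · have h1 := hZ.word_append_sub_of_perm (List.perm_append_singleton true w).symm
        (List.replicate k false)
      have h2 := hZ.word_sub_concat (List.replicate k false ++ w)
      have h3 := hZ.word_append_sub_of_perm (List.perm_append_singleton false w)
        (List.replicate k false)
      have h4 := ih (k + 1)
      rw [List.replicate_succ', List.append_assoc] at h4
      have e : polyField (X ^ k * wordPoly (true :: w)) =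
          polyField (X ^ k * wordPoly w) - polyField (X ^ (k + 1) * wordPoly w) := by
        rw [← map_sub]
        congr 1
        simp only [wordPoly, List.map_cons, List.prod_cons, if_true]
        ring
      rw [List.append_assoc, List.append_assoc] at h2
      have h := Z.sub_mem (Z.sub_mem (Z.sub_mem (Z.add_mem h1 (ih k)) h2) h3) h4
      rw [e]
      convert h using 1
      simp only [List.cons_append, List.nil_append]
      abel

theorem IsReducing.word_sub_polyField (hZ : IsReducing Z) (b : ℤ) (w : List Bool) :
    word b w - polyField (wordPoly w) ∈ Z := by
  have h := Z.add_mem (hZ.word_sub_word_zero b w) (hZ.word_replicate_sub 0 w)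
  simpa using h

/-- On ergodic configurations an empty site at `0` lies between two particles, so `1 - η_0` is the
word `01` read from a particle at `-1`; with `η_0` this makes up the constant. The counterpart for
means is `1 = ρ (1 + hole ρ)`. -/
theorem IsReducing.one_sub_polyField (hZ : IsReducing Z) :
    (fun _ => 1) - polyField (1 + X) ∈ Z := by
  have h1 : (fun _ => 1) - word 0 [] - word (-1) [false] ∈ Z := by
    refine hZ.of_ergodic (((isLocal_const 1).sub (isLocal_word _ _)).sub (isLocal_word _ _))
      fun ζ hζ => ?_
    have e1 := hζ.occ_mul_one_sub (-1)
    have e2 := hζ.one_sub_occ_mul 0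
    norm_num at e1 e2
    simp only [Pi.sub_apply, word, letters]
    norm_num
    rw [e2, e1]
    ring
  have h2 := hZ.word_sub_polyField 0 []
  have h3 := hZ.word_sub_polyField (-1) [false]
  have h := Z.add_mem (Z.add_mem h1 h2) h3
  rw [map_add]
  simp only [wordPoly, List.map_nil, List.prod_nil, List.map_cons, List.prod_singleton,
    Bool.false_eq_true, if_false] at h
  convert h using 1
  abel

/-- Every local function is equivalent to a linear combination of words without letter `true`. -/
theorem IsReducing.exists_polyField (hZ : IsReducing Z) {ψ : Config → ℝ} (hψ : IsLocal ψ) :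
    ∃ Q : ℝ[X], (∀ r, 1 / 2 < r → r < 1 → mean ψ r = r * Q.eval (hole r)) ∧
      ψ - polyField Q ∈ Z := by
  refine word_induction (p := fun ψ => ∃ Q : ℝ[X],
    (∀ r, 1 / 2 < r → r < 1 → mean ψ r = r * Q.eval (hole r)) ∧ ψ - polyField Q ∈ Z)
    (fun b w => ?_) (fun f g hf hg ihf ihg => ?_) (fun c f hf ih => ?_)
    (fun f g hf hg hfg ih => ?_) hψ
  · exact ⟨wordPoly w, fun r hr hr' => integral_word hr hr' b w,
      hZ.word_sub_polyField b w⟩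
  · obtain ⟨Q, h1, h2⟩ := ihf
    obtain ⟨Q', h1', h2'⟩ := ihg
    refine ⟨Q + Q', fun r hr hr' => ?_, ?_⟩
    · rw [eval_add, mul_add, ← h1 r hr hr', ← h1' r hr hr']
      exact integral_add (hf.integrable _) (hg.integrable _)
    · rw [map_add]
      convert Z.add_mem h2 h2' using 1
      ext ζ
      simp only [Pi.sub_apply, Pi.add_apply]
      ring
  · obtain ⟨Q, h1, h2⟩ := ih
    refine ⟨c • Q, fun r hr hr' => ?_, ?_⟩
    · rw [eval_smul, smul_eq_mul, mul_left_comm, ← h1 r hr hr']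
      exact integral_const_mul _ _
    · rw [map_smul]
      convert Z.smul_mem c h2 using 1
      ext ζ
      simp only [Pi.sub_apply, Pi.smul_apply, smul_eq_mul]
      ring
  · obtain ⟨Q, h1, h2⟩ := ih
    refine ⟨Q, fun r hr hr' => ?_, ?_⟩
    · rw [← h1 r hr hr']
      refine integral_congr_ae ?_
      filter_upwards [ae_ergodic hr hr'] with η hη
      exact (hfg η hη).symm
    · have h3 : g - f ∈ Z := hZ.of_ergodic (hg.sub hf) fun ζ hζ => by
        simp [hfg ζ hζ]
      simpa using Z.add_mem h3 h2

theorem hasDerivAt_of_eq_eval_hole {ρ : ℝ} (hρ : 1 / 2 < ρ) (hρ' : ρ < 1) {m : ℝ → ℝ} {Q : ℝ[X]}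
    (h : ∀ r, 1 / 2 < r → r < 1 → m r = r * Q.eval (hole r)) :
    HasDerivAt m (Q.eval (hole ρ) - Q.derivative.eval (hole ρ) / ρ) ρ := by
  have h0 : ρ ≠ 0 := by linarith
  have hd : HasDerivAt hole (-(1 / ρ ^ 2)) ρ := by
    have := ((hasDerivAt_id ρ).const_sub 1).div (hasDerivAt_id ρ) h0
    refine this.congr_deriv ?_
    simp only [id]
    field_simp
    ring
  have := (hasDerivAt_id ρ).mul ((Q.hasDerivAt (hole ρ)).comp ρ hd)
  refine (this.congr_deriv ?_).congr_of_eventuallyEq ?_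
  · simp only [id, Function.comp]
    field_simp
    ring
  · filter_upwards [Ioo_mem_nhds hρ hρ'] with r hr
    exact h r hr.1 hr.2

end Reduction

/-! ### Polynomials with a double root are negligible -/

section Conclusion

open Polynomial

theorem sq_dvd_of_isRoot_derivative {Q : ℝ[X]} {y : ℝ} (h : Q.eval y = 0)
    (h' : Q.derivative.eval y = 0) : (X - C y) ^ 2 ∣ Q := by
  obtain ⟨S, rfl⟩ := dvd_iff_isRoot.2 h
  have : S.eval y = 0 := by simpa using h'
  obtain ⟨T, rfl⟩ := dvd_iff_isRoot.2 this
  exact ⟨T, by ring⟩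

variable {ρ : ℝ} {G : ℝ → ℝ} {R : ℕ} {C L t : ℝ} {Ω : ℕ → Type*} [∀ N, MeasurableSpace (Ω N)]
  {P : (N : ℕ) → Measure (Ω N)} {η : (N : ℕ) → ℝ≥0 → Ω N → Config}
  [∀ N, IsProbabilityMeasure (P N)]

/-- The space of local functions with negligible field. -/
def negligibleSubmodule (hρ : 1 / 2 < ρ) (hρ' : ρ < 1) (hη : IsDiffusiveFamily ρ P η)
    (hG : IsTest G R C L) (ht : 0 ≤ t) : Submodule ℝ (Config → ℝ) where
  carrier := {V | IsLocal V ∧ Negligible G t P η V}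
  add_mem' hV hW := ⟨hV.1.add hW.1, hV.2.add hη hG hV.1 hW.1 hW.2⟩
  zero_mem' := ⟨isLocal_const 0, .of_ergodic hρ hρ' hη hG ht (isLocal_const 0) fun _ _ => rfl⟩
  smul_mem' c _ hV := ⟨hV.1.smul c, hV.2.smul hG c⟩

theorem isReducing_negligibleSubmodule (hρ : 1 / 2 < ρ) (hρ' : ρ < 1)
    (hη : IsDiffusiveFamily ρ P η) (hG : IsTest G R C L) (ht : 0 ≤ t) :
    IsReducing (negligibleSubmodule hρ hρ' hη hG ht) where
  of_ergodic hV h := ⟨hV, .of_ergodic hρ hρ' hη hG ht hV h⟩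
  gradient hf := ⟨hf.sub (isLocal_translate hf 1), .gradient hρ hρ' hη hG ht hf⟩
  exchange_sub hf x := ⟨(hf.comp_exchange x).sub hf, .exchange_sub hρ hρ' hη hG ht hf x⟩

/-- The pairs of words of length `l`, preceded by `k` letters `false`. -/
def pairWord (k l : ℕ) (v : (Fin l → Bool) × (Fin l → Bool)) : List Bool :=
  List.replicate k false ++ (List.ofFn v.1 ++ List.ofFn v.2)

theorem pairWord_injective (k l : ℕ) : Function.Injective (pairWord k l) := by
  rintro ⟨v₁, v₂⟩ ⟨w₁, w₂⟩ h
  obtain ⟨h1, h2⟩ := List.append_inj (List.append_cancel_left h) (by simp)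
  exact Prod.ext (List.ofFn_injective h1) (List.ofFn_injective h2)

theorem length_pairWord (k l : ℕ) (v : (Fin l → Bool) × (Fin l → Bool)) :
    (pairWord k l v).length = k + 2 * l := by
  simp [pairWord]; ring

theorem wordPoly_pairWord (k l : ℕ) (v : (Fin l → Bool) × (Fin l → Bool)) :
    wordPoly (pairWord k l v) = X ^ k * (wordPoly (List.ofFn v.1) * wordPoly (List.ofFn v.2)) := by
  rw [pairWord, wordPoly_append, wordPoly_append]
  congr 1
  simp [wordPoly]

theorem sum_pair {l : ℕ} {A : Type*} [CommRing A] (a : A) (f g : (Fin l → Bool) → A) :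
    ∑ v : (Fin l → Bool) × (Fin l → Bool), a * (f v.1 * g v.2) =
      a * ((∑ v, f v) * ∑ v, g v) := by
  rw [← Finset.mul_sum, Finset.sum_mul_sum, Fintype.sum_prod_type]

theorem sum_meanExcess_mul_wordPoly_pair {l : ℕ} (hl : 0 < l) (k : ℕ) (y : ℝ) :
    ∑ v : (Fin l → Bool) × (Fin l → Bool), Polynomial.C (meanExcess y v.1 * meanExcess y v.2) *
      wordPoly (pairWord k l v) = X ^ k * (X - Polynomial.C y) ^ 2 := by
  rw [sq, ← sum_meanExcess_mul_wordPoly hl y, ← sum_pair]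
  refine Finset.sum_congr rfl fun v _ => ?_
  rw [wordPoly_pairWord, C_mul]
  ring

theorem hole_mem (hρ : 1 / 2 < ρ) (hρ' : ρ < 1) : 0 ≤ hole ρ ∧ hole ρ ≤ 1 :=
  ⟨div_nonneg (by linarith) (by linarith), (div_le_one (by linarith)).2 (by linarith)⟩

theorem eval_wordPoly_nonneg {y : ℝ} (hy : 0 ≤ y) (hy' : y ≤ 1) (w : List Bool) :
    0 ≤ (wordPoly w).eval y := by
  induction w with
  | nil => simp [wordPoly]
  | cons a w ih =>
    rw [wordPoly] at ih ⊢
    rw [List.map_cons, List.prod_cons, eval_mul]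
    refine mul_nonneg ?_ ih
    cases a <;> simp [hy, hy']

theorem sum_meanExcess_sq_mul_eval_pair_le {l : ℕ} (hl : 0 < l) (k : ℕ) {y : ℝ} (hy : 0 ≤ y)
    (hy' : y ≤ 1) :
    ∑ v : (Fin l → Bool) × (Fin l → Bool), (meanExcess y v.1 * meanExcess y v.2) ^ 2 *
      (wordPoly (pairWord k l v)).eval y ≤ ((l : ℝ)⁻¹) ^ 2 := by
  have e : ∀ v : (Fin l → Bool) × (Fin l → Bool), (meanExcess y v.1 * meanExcess y v.2) ^ 2 *
      (wordPoly (pairWord k l v)).eval y =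
      y ^ k * ((meanExcess y v.1 ^ 2 * (wordPoly (List.ofFn v.1)).eval y) *
        (meanExcess y v.2 ^ 2 * (wordPoly (List.ofFn v.2)).eval y)) := by
    intro v
    rw [wordPoly_pairWord, eval_mul, eval_mul, eval_pow, eval_X]
    ring
  simp only [e]
  rw [sum_pair (y ^ k) (fun v : Fin l → Bool => meanExcess y v ^ 2 * (wordPoly (List.ofFn v)).eval y)
    fun v : Fin l → Bool => meanExcess y v ^ 2 * (wordPoly (List.ofFn v)).eval y, ← sq]
  have h0 : 0 ≤ ∑ v : Fin l → Bool, meanExcess y v ^ 2 * (wordPoly (List.ofFn v)).eval y :=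
    Finset.sum_nonneg fun v _ => mul_nonneg (sq_nonneg _) (eval_wordPoly_nonneg hy hy' _)
  calc _ ≤ 1 * ((l : ℝ)⁻¹) ^ 2 := by
        gcongr
        · exact pow_le_one₀ hy hy'
        · exact sum_meanExcess_sq_mul_le hl hy hy'
    _ = _ := one_mul _

/-- The two blocks of averages have polynomial `X ^ k (X - y) ^ 2`, and words are determined modulo
`Z` by their polynomials. -/
theorem wordSum_pairWord_sub_mem {Z : Submodule ℝ (Config → ℝ)} (hZ : IsReducing Z) {l : ℕ}
    (hl : 0 < l) (k : ℕ) (y : ℝ) :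
    polyField (X ^ k * (X - Polynomial.C y) ^ 2) -
      wordSum (fun v => meanExcess y v.1 * meanExcess y v.2) (pairWord k l) 0 ∈ Z := by
  have h := Z.sum_mem (t := Finset.univ) fun v (_ : v ∈ Finset.univ) =>
    Z.smul_mem (meanExcess y v.1 * meanExcess y v.2) (hZ.word_sub_polyField 0 (pairWord k l v))
  rw [← Z.neg_mem_iff, ← sum_meanExcess_mul_wordPoly_pair hl k y]
  convert h using 1
  ext ζ
  simp only [map_sum, ← smul_eq_C_mul, map_smul, smul_sub, Finset.sum_sub_distrib, neg_sub,
    Pi.sub_apply, Finset.sum_apply, Pi.smul_apply, smul_eq_mul, wordSum]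

/-- The block length `l` is free. Each block average contributes `1 / l` to the second moment,
whereas the range only grows like `l`, so the variance of the field is of order `1 / l`. A single
factor `X - y` would not suffice. -/
theorem polyField_X_pow_mul_mem (hρ : 1 / 2 < ρ) (hρ' : ρ < 1) (hη : IsDiffusiveFamily ρ P η)
    (hG : IsTest G R C L) (ht : 0 ≤ t) (k : ℕ) :
    polyField (X ^ k * (X - Polynomial.C (hole ρ)) ^ 2) ∈
      negligibleSubmodule hρ hρ' hη hG ht := by
  have hZ := isReducing_negligibleSubmodule hρ hρ' hη hG ht
  obtain ⟨hy, hy'⟩ := hole_mem hρ hρ'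
  set y := hole ρ with hydef
  refine ⟨isLocal_polyField _, .of_approx hρ hρ' hη hG ht (isLocal_polyField _) fun ε hε => ?_⟩
  -- The variance bound for words of `k + 2 l` letters with second moment at most `l⁻²`.
  have hlim : Tendsto (fun l : ℕ => (2 * R + 1) * C ^ 2 * (4 * (k + 2 * l : ℕ) + 1) *
      ((l : ℝ)⁻¹) ^ 2) atTop (𝓝 0) := by
    have h1 := tendsto_inv_atTop_nhds_zero_nat (𝕜 := ℝ)
    have h2 := ((h1.const_mul 8).add ((h1.pow 2).const_mul (4 * (k : ℝ) + 1))).const_mul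
      ((2 * (R : ℝ) + 1) * C ^ 2)
    simp only [mul_zero, ne_eq, OfNat.ofNat_ne_zero, not_false_eq_true, zero_pow, add_zero] at h2
    refine h2.congr' ?_
    filter_upwards [eventually_gt_atTop 0] with l hl
    have : (l : ℝ) ≠ 0 := by positivity
    push_cast
    field_simp
    ring
  obtain ⟨l, hl, hl0⟩ := ((hlim.eventually (gt_mem_nhds hε)).and (eventually_gt_atTop 0)).exists
  refine ⟨_, isLocal_wordSum _ _ 0, (wordSum_pairWord_sub_mem hZ hl0 k y).2, fun N hN => ?_⟩
  refine (hG.integral_field_wordSum_sq_le hρ hρ' _ (pairWord_injective k l) (length_pairWord k l)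
    ?_ (sum_meanExcess_sq_mul_eval_pair_le hl0 k hy hy') hN).trans hl.le
  have := congrArg (Polynomial.eval y) (sum_meanExcess_mul_wordPoly_pair hl0 k y)
  simpa [eval_finsetSum] using this

theorem polyField_mem_of_sq_dvd (hρ : 1 / 2 < ρ) (hρ' : ρ < 1) (hη : IsDiffusiveFamily ρ P η)
    (hG : IsTest G R C L) (ht : 0 ≤ t) {Q : ℝ[X]} (hQ : (X - Polynomial.C (hole ρ)) ^ 2 ∣ Q) :
    polyField Q ∈ negligibleSubmodule hρ hρ' hη hG ht := by
  obtain ⟨S, rfl⟩ := hQ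
  rw [mul_comm]
  induction S using Polynomial.induction_on' with
  | add p q hp hq =>
    rw [add_mul, map_add]
    exact Submodule.add_mem _ hp hq
  | monomial n a =>
    rw [← C_mul_X_pow_eq_monomial, ← smul_eq_C_mul, smul_mul_assoc, map_smul]
    exact Submodule.smul_mem _ a (polyField_X_pow_mul_mem hρ hρ' hη hG ht n)

theorem differentiableAt_mean (hρ : 1 / 2 < ρ) (hρ' : ρ < 1) {ψ : Config → ℝ} (hψ : IsLocal ψ) :
    DifferentiableAt ℝ (mean ψ) ρ := by
  -- The formula for the mean involves neither the process nor `Z`, so the whole space serves as a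
  -- reducing space.
  obtain ⟨Q, hQ, -⟩ := IsReducing.exists_polyField (Z := ⊤)
    ⟨fun _ _ => trivial, fun _ => trivial, fun _ _ => trivial⟩ hψ
  exact (hasDerivAt_of_eq_eval_hole hρ hρ' hQ).differentiableAt

theorem isLocal_centred {ψ : Config → ℝ} (hψ : IsLocal ψ) (r : ℝ) : IsLocal (centred ψ r) :=
  (hψ.sub (isLocal_const _)).sub (((isLocal_occ 0).sub (isLocal_const r)).smul _)

theorem negligible_centred (hρ : 1 / 2 < ρ) (hρ' : ρ < 1) (hη : IsDiffusiveFamily ρ P η)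
    (hG : IsTest G R C L) (ht : 0 ≤ t) {ψ : Config → ℝ} (hψ : IsLocal ψ) :
    Negligible G t P η (centred ψ ρ) := by
  set Z := negligibleSubmodule hρ hρ' hη hG ht
  have hZ : IsReducing Z := isReducing_negligibleSubmodule hρ hρ' hη hG ht
  obtain ⟨Q, hQ, hψQ⟩ := hZ.exists_polyField hψ
  have hm := hQ ρ hρ hρ'
  have hd := (hasDerivAt_of_eq_eval_hole hρ hρ' hQ).deriv
  have h0 : ρ ≠ 0 := by linarith
  have hy : 1 + hole ρ = 1 / ρ := by unfold hole; field_simp; ring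
  set m := mean ψ ρ
  set d := deriv (mean ψ) ρ
  -- The polynomial of the centred function: constants become multiples of `1 + X`, and `η_0`
  -- becomes `1`.
  set S : ℝ[X] := Q - m • (1 + X) - d • (1 - ρ • (1 + X)) with hS
  -- The value at `hole ρ` vanishes because `m = ρ Q(hole ρ)` and `ρ (1 + hole ρ) = 1`; the
  -- derivative vanishes because `ρ d = m - Q'(hole ρ)`, which is the choice of the slope in
  -- `centred`.
  have hdvd : (X - Polynomial.C (hole ρ)) ^ 2 ∣ S := by
    apply sq_dvd_of_isRoot_derivative
    · simp only [hS, eval_sub, eval_smul, eval_add, eval_one, eval_X, smul_eq_mul, hy, hm]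
      field_simp
      ring
    · simp only [hS, derivative_sub, derivative_smul, derivative_add, derivative_one,
        derivative_X, eval_sub, eval_smul, eval_add, eval_zero, eval_one, smul_eq_mul, hm, hd]
      field_simp
      ring
  have h1 := polyField_mem_of_sq_dvd hρ hρ' hη hG ht hdvd
  have h2 := hZ.one_sub_polyField
  have h3 : polyField 1 = fun ζ => occ ζ 0 := by
    rw [← pow_zero X, polyField_X_pow]
    ext ζ
    simp [word, letters]
  have h := Z.add_mem (Z.add_mem hψQ h1) (Z.smul_mem (d * ρ - m) h2)
  suffices centred ψ ρ ∈ Z from this.2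
  convert h using 1
  ext ζ
  simp only [hS, map_sub, map_smul, h3, centred, Pi.add_apply, Pi.sub_apply, Pi.smul_apply,
    smul_eq_mul]
  ring

end Conclusion

end FEP

theorem proposition5p3 (ρ : ℝ) (hρ : 1 / 2 < ρ) (hρ' : ρ < 1)
    (ψ : FEP.Config → ℝ) (hψ : FEP.IsLocal ψ)
    (G : ℝ → ℝ) (hG : ContDiff ℝ ((⊤ : ℕ∞) : WithTop ℕ∞) G) (hGc : HasCompactSupport G)
    (t : ℝ) (ht : 0 < t)
    (Ω : ℕ → Type*) [∀ N, MeasurableSpace (Ω N)]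
    (P : (N : ℕ) → Measure (Ω N)) [∀ N, IsProbabilityMeasure (P N)]
    (η : (N : ℕ) → ℝ≥0 → Ω N → FEP.Config)
    (hη : ∀ N : ℕ, FEP.IsProcess (P N) ((N : ℝ) ^ 2) ((N : ℝ) ^ 2)
      (FEP.stationaryMeasure ρ) (η N)) :
    DifferentiableAt ℝ (FEP.mean ψ) ρ ∧
    (∀ N : ℕ, MemLp (FEP.integratedField N G (FEP.centred ψ ρ) (η N) t) 2 (P N)) ∧
    Tendsto
      (fun N : ℕ => ∫ ω, (FEP.integratedField N G (FEP.centred ψ ρ) (η N) t ω) ^ 2 ∂(P N))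
      atTop (𝓝 0) := by
  obtain ⟨R, C, L, hT⟩ := FEP.exists_isTest hG hGc
  exact ⟨FEP.differentiableAt_mean hρ hρ' hψ,
    FEP.memLp_integratedField hη hT (FEP.isLocal_centred hψ ρ),
    FEP.negligible_centred hρ hρ' hη hT ht.le hψ⟩
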